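/- Let $D$ be the open unit disk in $\mathbb C$ and identify $C^\infty(\partial D)$ with the smooth $2\pi$-periodic functions of the angle. A function $u$ on $D$ has the boundary value $u_b\in\mathcal D'(\partial D)$ in the sense of distributions if $\langle u_b,\varphi\rangle=\lim_{r\nearrow1}\int_0^{2\pi}u(re^{i\theta})\varphi(\theta)\,d\theta$ for all $\varphi\in C^\infty(\partial D)$. Let $H_b$ be the set of holomorphic functions on $D$ for which all these limits exist, and let $\mathrm{Re}\{(H^p(D))_b\}$ be the set of real parts of the boundary values of functions in the Hardy space $H^p(D)$. For a functional $\Lambda$, $\langle\mathrm{Re}\,\Lambda,\varphi\rangle=\frac12(\langle\Lambda,\varphi\rangle+\overline{\langle\Lambda,\overline\varphi\rangle})$ and $\langle\mathrm{Im}\,\Lambda,\varphi\rangle=\frac1{2i}(\langle\Lambda,\varphi\rangle-\overline{\langle\Lambda,\overline\varphi\rangle})$. Put $$P_r(\theta)=\frac{1-r^2}{1-2r\cos\theta+r^2},\qquad Q_r(\theta)=\frac{2r\sin\theta}{1-2r\cos\theta+r^2}.$$ **Theorem.** Let $n\ge1$. Let $f\in L^1(D)$ be such that $\zeta\mapsto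 f(\zeta)/\zeta$ is also in $L^1(D)$. Let $h_0\in H_b$, let $h_k\in\mathrm{Re}\{(H^{p_k}(D))_b\}$ with $\frac12<p_k\le1$ for $1\le k\le n-1$, and let $c_k\in\mathbb R$ for $0\le k\le n-1$. For $z=re^{i\theta}\in D$ let $$\begin{aligned}w(z)={}&i\sum_{k=0}^{n-1}\frac{c_k}{k!}(z+\bar z)^k-I+\frac1{2\pi}\langle(h_0)_b,P_r(\theta-\cdot)\rangle\\&+\sum_{k=1}^{n-1}\frac{(-1)^k}{2\pi k!}\Big\langle h_k,\big(P_r(\theta-\cdot)+iQ_r(\theta-\cdot)\big)\big(e^{i(\cdot)}-z+\overline{e^{i(\cdot)}-z}\big)^k\Big\rangle\\&+\frac{(-1)^n}{2\pi(n-1)!}\iint_D\Big(\frac{f(\zeta)}{\zeta}\,\frac{\zeta+z}{\zeta-z}+\frac{\overline{f(\zeta)}}{\overline\zeta}\,\frac{1+z\overline\zeta}{1-z\overline\zeta}\Big)\big(\zeta-z+\overline{\zeta-z}\big)^{n-1}\,d\xi\,d\eta,\end{aligned}$$ where $I=\frac{i}{2\pi}\langle\mathrm{Im}\{(h_0)_b\},1\rangle$.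 The area integral converges absolutely for almost every $z\in D$ and for $z=0$, and for every $z\in D$ if $n\ge2$. The function $w$ solves the Schwarz boundary value problem $$\frac{\partial^nw}{\partial\bar z^n}=f\ \text{ in }D,\qquad\mathrm{Re}\Big\{\Big(\frac{\partial^kw}{\partial\bar z^k}\Big)_b\Big\}=h_k\ (1\le k\le n-1),\qquad\mathrm{Re}\{w_b\}=\mathrm{Re}\{(h_0)_b\},\qquad\mathrm{Im}\Big\{\frac{\partial^kw}{\partial\bar z^k}(0)\Big\}=c_k\ (0\le k\le n-1),$$ in the following sense. * The equation $\partial^nw/\partial\bar z^n=f$ holds in the sense of distributions on $D$. * For $k\le n-1$, the function $\partial^kw/\partial\bar z^k$ is the $k$-fold iterated pointwise derivative. The differentiability that this requires holds at almost every point of $D$ and at $0$, and the function is locally integrable on $D$ and is also the distributional derivative of $w$. * For $k\le n-2$, the boundary value of $\partial^kw/\partial\bar z^k$ exists as the limit over all $r\nearrow1$. * For $k=n-1$, the function $\partial^kw/\partial\bar z^k$ is in general only defined almost everywhere. The limit is then taken over those $r\in(0,1)$ for which $(\theta,\zeta)\mapsto f(\zeta)/(\zeta-re^{i\theta})$ is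 integrable on $(0,2\pi)\times D$. This is the case for almost every $r\in(0,1)$, and for these $r$ the function is integrable on the circle $|z|=r$. -/

import Mathlib

open Complex Filter Topology MeasureTheory Set
open scoped ContDiff ComplexConjugate

noncomputable section

namespace DiskSchwarz

/-- The open unit disk. -/
def disk : Set ℂ := Metric.ball 0 1

/-! ### Test functions and distributions on the unit circle -/

/-- Smooth functions on the unit circle, written as smooth `2π`-periodic functions of the angle. -/
def CircleTest : Submodule ℂ (ℝ → ℂ) where
  carrier := {φ | ContDiff ℝ ∞ φ ∧ Function.Periodic φ (2 * Real.pi)}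
  zero_mem' := ⟨contDiff_const, fun _ => rfl⟩
  add_mem' := fun ha hb => ⟨ha.1.add hb.1, ha.2.add hb.2⟩
  smul_mem' := fun c _ ha => ⟨contDiff_const.smul ha.1, fun x => by simp [ha.2 x]⟩

/-- The complex conjugate of a test function. -/
def conjTest (φ : CircleTest) : CircleTest :=
  ⟨fun t => (starRingEnd ℂ) (φ.1 t),
    conjCLE.contDiff.comp φ.2.1, fun t => by simp only [φ.2.2 t]⟩

/-- Distributions on the unit circle: linear functionals on the test functions that are bounded by
finitely many of the norms `sup |φ^(j)|`. -/
structure CircleDistribution where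
  toLinearMap : CircleTest →ₗ[ℂ] ℂ
  bound : ∃ (N : ℕ) (C : ℝ), ∀ (φ : CircleTest) (M : ℝ),
    (∀ j ≤ N, ∀ t : ℝ, ‖iteratedDeriv j φ.1 t‖ ≤ M) → ‖toLinearMap φ‖ ≤ C * M

instance : CoeFun CircleDistribution (fun _ => CircleTest → ℂ) := ⟨fun Λ => Λ.toLinearMap⟩

/-- Real part of a functional: `⟨Re Λ, φ⟩ = (⟨Λ, φ⟩ + conj ⟨Λ, conj φ⟩) / 2`. -/
def rePart (Λ : CircleTest → ℂ) : CircleTest → ℂ := fun φ =>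
  (Λ φ + conj (Λ (conjTest φ))) / 2

/-- Imaginary part of a functional: `⟨Im Λ, φ⟩ = (⟨Λ, φ⟩ - conj ⟨Λ, conj φ⟩) / (2i)`. -/
def imPart (Λ : CircleTest → ℂ) : CircleTest → ℂ := fun φ =>
  (Λ φ - conj (Λ (conjTest φ))) / (2 * I)

open Classical in
/-- `⟨Λ, φ⟩` for a function `φ` of the angle. It is only used for functions `φ` that are test
functions (see `poisson_mem` and `schwarz_mem`). -/
def pair (Λ : CircleTest → ℂ) (φ : ℝ → ℂ) : ℂ :=
  if h : φ ∈ CircleTest then Λ ⟨φ, h⟩ else 0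

/-! ### Boundary values in the sense of distributions -/

/-- `∫_0^{2π} u(r e^{iθ}) φ(θ) dθ`. -/
def circlePairing (u : ℂ → ℂ) (φ : CircleTest) (r : ℝ) : ℂ :=
  ∫ θ in (0 : ℝ)..(2 * Real.pi), u (circleMap 0 r θ) * φ.1 θ

/-- The circle integrals of `u` against test functions are defined for all radii in `R`, and
they converge to the pairings with the distribution `Λ` as `r → 1`, `r ∈ R`. -/
def HasBoundaryValueAlong (R : Set ℝ) (u : ℂ → ℂ) (Λ : CircleDistribution) : Prop :=
  (∀ r ∈ R, IntervalIntegrable (fun θ => u (circleMap 0 r θ)) volume 0 (2 * Real.pi)) ∧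
    ∀ φ : CircleTest, Tendsto (circlePairing u φ) (𝓝[R] 1) (𝓝 (Λ φ))

/-- The boundary value in the sense of distributions of `u` is `Λ`. -/
def HasBoundaryValue (u : ℂ → ℂ) (Λ : CircleDistribution) : Prop :=
  HasBoundaryValueAlong (Ioo 0 1) u Λ

/-- The functional `⟨u_b, φ⟩ = lim_{r ↗ 1} ∫ u(r e^{iθ}) φ(θ) dθ`, for functions `u` for which
these limits exist. -/
def boundaryValue (u : ℂ → ℂ) : CircleTest → ℂ := fun φ =>
  limUnder (𝓝[Ioo 0 1] 1) (circlePairing u φ)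

/-- `H_b`: holomorphic functions on the disk for which all the limits exist. -/
def Hb : Set (ℂ → ℂ) :=
  {u | DifferentiableOn ℂ u disk ∧
    ∀ φ : CircleTest, ∃ L : ℂ, Tendsto (circlePairing u φ) (𝓝[Ioo 0 1] 1) (𝓝 L)}

/-- The Hardy space `H^p(D)`. -/
def Hardy (p : ℝ) : Set (ℂ → ℂ) :=
  {u | DifferentiableOn ℂ u disk ∧ ∃ C : ℝ, ∀ r ∈ Ioo (0 : ℝ) 1,
    ∫ θ in (0 : ℝ)..(2 * Real.pi), ‖u (circleMap 0 r θ)‖ ^ p ≤ C}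

/-- `Re {(H^p(D))_b}`. -/
def reHardyBoundary (p : ℝ) : Set CircleDistribution :=
  {h | ∃ u ∈ Hardy p, ∃ Λ : CircleDistribution,
    HasBoundaryValue u Λ ∧ (h : CircleTest → ℂ) = rePart Λ}

/-! ### The operator `∂/∂z̄` -/

/-- The pointwise Wirtinger derivative `∂u/∂z̄ = (∂u/∂x + i ∂u/∂y) / 2`. -/
def dbar (u : ℂ → ℂ) : ℂ → ℂ := fun z =>
  (1 / 2) * (fderiv ℝ u z 1 + I * fderiv ℝ u z I)

/-- `∂^m u/∂z̄^m = v` on the disk in the sense of distributions, for locally integrable `u`, `v`. -/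
def IsWeakDbar (m : ℕ) (u v : ℂ → ℂ) : Prop :=
  LocallyIntegrableOn u disk ∧ LocallyIntegrableOn v disk ∧
    ∀ φ : ℂ → ℂ, ContDiff ℝ ∞ φ → HasCompactSupport φ → tsupport φ ⊆ disk →
      ∫ z in disk, u z * dbar^[m] φ z = (-1) ^ m * ∫ z in disk, v z * φ z

/-! ### Kernels and the explicit solution -/

/-- `P_r(θ)`. -/
def P (r θ : ℝ) : ℝ := (1 - r ^ 2) / (1 - 2 * r * Real.cos θ + r ^ 2)

/-- `Q_r(θ)`. -/
def Q (r θ : ℝ) : ℝ := (2 * r * Real.sin θ) / (1 - 2 * r * Real.cos θ + r ^ 2)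

/-- With `z = r e^{iθ}`, the function `t ↦ P_r(θ - t)`. -/
def poissonFun (z : ℂ) : ℝ → ℂ := fun t => (P ‖z‖ (z.arg - t) : ℂ)

/-- With `z = r e^{iθ}`, the function
`t ↦ (P_r(θ - t) + i Q_r(θ - t)) (e^{it} - z + conj (e^{it} - z))^k`. -/
def schwarzFun (k : ℕ) (z : ℂ) : ℝ → ℂ := fun t =>
  ((P ‖z‖ (z.arg - t) : ℂ) + I * (Q ‖z‖ (z.arg - t) : ℂ)) *
    (exp (t * I) - z + conj (exp (t * I) - z)) ^ k

lemma den_ne {r : ℝ} (h0 : 0 ≤ r) (h1 : r < 1) (s : ℝ) :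
    1 - 2 * r * Real.cos s + r ^ 2 ≠ 0 := by
  have := Real.cos_le_one s
  nlinarith [mul_nonneg h0 (sub_nonneg.2 this), mul_pos (sub_pos.2 h1) (sub_pos.2 h1)]

lemma poisson_mem {z : ℂ} (hz : z ∈ disk) : poissonFun z ∈ CircleTest := by
  have h1 : ‖z‖ < 1 := by simpa [disk] using hz
  refine ⟨?_, fun t => ?_⟩
  · refine ofRealCLM.contDiff.comp (g := ofRealCLM) (f := fun t => P ‖z‖ (z.arg - t)) ?_
    refine ContDiff.div (by fun_prop) (by fun_prop) fun t => den_ne (norm_nonneg z) h1 _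
  · simp only [poissonFun, P, ← sub_sub, Real.cos_sub_two_pi]

lemma schwarz_mem (k : ℕ) {z : ℂ} (hz : z ∈ disk) : schwarzFun k z ∈ CircleTest := by
  have h1 : ‖z‖ < 1 := by simpa [disk] using hz
  refine ⟨?_, fun t => ?_⟩
  · refine ContDiff.mul (ContDiff.add (poisson_mem hz).1 (contDiff_const.mul ?_)) ?_
    · refine ofRealCLM.contDiff.comp (g := ofRealCLM) (f := fun t => Q ‖z‖ (z.arg - t)) ?_
      refine ContDiff.div (by fun_prop) (by fun_prop) fun t => den_ne (norm_nonneg z) h1 _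
    · have he : ContDiff ℝ ∞ (fun t : ℝ => exp (t * I) - z) :=
        ((ofRealCLM.contDiff.mul contDiff_const).cexp).sub contDiff_const
      exact (he.add (conjCLE.contDiff.comp he)).pow k
  · have he : exp (((t + 2 * Real.pi : ℝ) : ℂ) * I) = exp (t * I) := by
      rw [← exp_periodic (t * I)]
      push_cast
      ring_nf
    simp only [schwarzFun, P, Q, ← sub_sub, Real.cos_sub_two_pi, Real.sin_sub_two_pi, he]

/-- The integrand
`(f(ζ)/ζ · (ζ+z)/(ζ-z) + conj (f(ζ))/conj ζ · (1+z conj ζ)/(1-z conj ζ)) (ζ-z+conj (ζ-z))^(n-1)`. -/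
def areaIntegrand (n : ℕ) (f : ℂ → ℂ) (z ζ : ℂ) : ℂ :=
  (f ζ / ζ * ((ζ + z) / (ζ - z)) +
    conj (f ζ) / conj ζ * ((1 + z * conj ζ) / (1 - z * conj ζ))) *
      (ζ - z + conj (ζ - z)) ^ (n - 1)

/-- The function that solves the Schwarz problem of order `n` with data `f`, `h₀`, `h k`, `c k`. -/
def schwarzSolution (n : ℕ) (f h₀ : ℂ → ℂ) (h : ℕ → CircleDistribution) (c : ℕ → ℝ) (z : ℂ) : ℂ :=
  I * ∑ k ∈ Finset.range n, (c k : ℂ) / (k.factorial : ℂ) * (z + conj z) ^ k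
    - I / (2 * Real.pi) * pair (imPart (boundaryValue h₀)) (fun _ => 1)
    + 1 / (2 * Real.pi) * pair (boundaryValue h₀) (poissonFun z)
    + ∑ k ∈ Finset.Icc 1 (n - 1), (-1 : ℂ) ^ k / (2 * Real.pi * (k.factorial : ℂ)) *
        pair (h k) (schwarzFun k z)
    + (-1 : ℂ) ^ n / (2 * Real.pi * ((n - 1).factorial : ℂ)) *
        ∫ ζ in disk, areaIntegrand n f z ζ

/-- The radii `0 < r < 1` for which `f(ζ)/(ζ - r e^{iθ})` is integrable in `(θ, ζ)`. -/
def regularRadii (f : ℂ → ℂ) : Set ℝ :=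
  {r | r ∈ Ioo (0 : ℝ) 1 ∧
    IntegrableOn (fun q : ℝ × ℂ => f q.2 / (q.2 - circleMap 0 r q.1))
      (Ioc 0 (2 * Real.pi) ×ˢ disk)}

end DiskSchwarz

end

open DiskSchwarz

/-! The function X(z) = z + z̄ satisfies ∂X/∂z̄ = 1, so it can take the place of z̄: for holomorphic
H_j the sums A_m = Σ_{i+j=m} (X^i/i!) H_j (`appell`) satisfy ∂A_m/∂z̄ = A_{m-1} and ∂A_0/∂z̄ = 0.
The binomial theorem, applied to (2 cos t - X(z))^k in the Schwarz kernels and to (X(ζ) -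
X(z))^{n-1} in the area integral, brings the terms of the formula into this shape. Two properties of
X decouple the side conditions. It vanishes at 0, so A_m(0) = H_m(0). It is real, with boundary
value 2 cos t, so multiplication by it commutes with real parts: if Re (H_j)_b = ((-1)^j/j!) (2 cos
t)^j ρ for all j ≤ m, then Re (A_m)_b = ((2 cos t - 2 cos t)^m/m!) ρ, which is 0 unless m = 0
(`bv_appell`). Hence only the k-th datum is seen by the k-th derivative.

Distributions are handled through their Fourier coefficients. The Schwarz kernel is 1 + 2 Σ_{k≥1}
z^k e^{-ikt}, so the Schwarz transform of a distribution is a power series with coefficients of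
polynomial growth. Such series have boundary values (`PolyBdd.bv_ps`), and for a real distribution L
the real part is 2πL (`rePart_hdist_schwarzCoeff`). For h₀ the existence of the limits already
forces polynomial growth (`polyBdd_taylorCoeff`).

In the area integral, (ζ+z)/(ζ(ζ-z)) = 2/(ζ-z) - 1/ζ separates a potential with kernel `κ m` from a
polyanalytic remainder. As ∂/∂z̄ lowers κ (m+1) (ζ-z) to κ m (ζ-z) and κ 0 is the Cauchy kernel, the
Cauchy–Pompeiu formula (`integral_dbar_mul_inv`) gives the weak derivatives. The estimates
`κ_lipschitz` give the classical ones wherever ζ ↦ f(ζ)/(ζ-z) is integrable, that is, almost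
everywhere and at 0. On regular circles, Fubini and the Fourier expansion of the Cauchy kernel
produce the boundary value of a Cauchy transform (`bv_pot_zero`). Its coefficients are moments of
f/ζ, the remainder carries the conjugate moments, and the real parts cancel (`rePart_area`). Almost
every radius is regular, and below order n-1 continuity extends the limit to all radii (`BV.of_ae`).
-/

noncomputable section

namespace DiskSchwarz

/-! ### Fourier series of test functions -/

/-- The character `t ↦ e^{ijt}`. -/
def e (j : ℤ) : CircleTest :=
  ⟨fun t => exp (j * t * I),
    ((contDiff_const.mul ofRealCLM.contDiff).mul contDiff_const).cexp, fun t => by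
    change exp _ = exp _
    rw [← exp_periodic.int_mul j (j * t * I)]
    push_cast
    ring_nf⟩

lemma e_apply (j : ℤ) (t : ℝ) : (e j).1 t = exp (j * t * I) := rfl

lemma norm_e (j : ℤ) (t : ℝ) : ‖(e j).1 t‖ = 1 := by
  have := norm_exp_ofReal_mul_I (j * t)
  simpa [e_apply] using this

lemma e_mul (j k : ℤ) (t : ℝ) : (e j).1 t * (e k).1 t = (e (j + k)).1 t := by
  simp only [e_apply, ← exp_add]
  push_cast
  ring_nf

lemma conjTest_e (j : ℤ) : conjTest (e j) = e (-j) := by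
  apply Subtype.ext
  funext t
  change conj ((e j).1 t) = _
  simp only [e_apply, ← exp_conj]
  simp

lemma continuous_test (φ : CircleTest) : Continuous φ.1 := φ.2.1.continuous

/-- The Fourier coefficients of a test function. -/
def fc (j : ℤ) : CircleTest →ₗ[ℂ] ℂ where
  toFun φ := 1 / (2 * Real.pi) * ∫ t in (0 : ℝ)..(2 * Real.pi), φ.1 t * (e (-j)).1 t
  map_add' φ ψ := by
    rw [← mul_add, ← intervalIntegral.integral_add]
    · simp [add_mul]
    · exact (((continuous_test φ).mul (continuous_test (e _))).intervalIntegrable _ _)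
    · exact (((continuous_test ψ).mul (continuous_test (e _))).intervalIntegrable _ _)
  map_smul' c φ := by
    have : ∀ t, (c • φ).1 t * (e (-j)).1 t = c * (φ.1 t * (e (-j)).1 t) := fun t => by
      simp [mul_assoc]
    simp only [this, intervalIntegral.integral_const_mul, RingHom.id_apply, smul_eq_mul]
    ring

lemma fc_apply (j : ℤ) (φ : CircleTest) :
    fc j φ = 1 / (2 * Real.pi) * ∫ t in (0 : ℝ)..(2 * Real.pi), φ.1 t * (e (-j)).1 t := rfl

lemma norm_fc_le (j : ℤ) (φ : CircleTest) {M : ℝ} (hM : ∀ t, ‖φ.1 t‖ ≤ M) : ‖fc j φ‖ ≤ M := by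
  have h := intervalIntegral.norm_integral_le_of_norm_le_const (a := 0) (b := 2 * Real.pi)
    (f := fun t => φ.1 t * (e (-j)).1 t) (C := M) fun t _ => by simpa [norm_e] using hM t
  have hp := Real.pi_pos
  rw [fc_apply, norm_mul]
  rw [sub_zero, abs_of_pos (by positivity)] at h
  have : ‖(1 / (2 * Real.pi) : ℂ)‖ = 1 / (2 * Real.pi) := by
    simp [abs_of_pos hp]
  rw [this]
  calc _ ≤ 1 / (2 * Real.pi) * (M * (2 * Real.pi)) := by gcongr
    _ = M := by field_simp

/-- The derivative of a test function. -/
def D : CircleTest →ₗ[ℂ] CircleTest where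
  toFun φ := ⟨deriv φ.1, (contDiff_infty_iff_deriv.1 φ.2.1).2, fun t => by
    rw [← deriv_comp_add_const]
    congr 1
    exact funext φ.2.2⟩
  map_add' φ ψ := by
    apply Subtype.ext
    funext t
    exact deriv_add (φ.2.1.differentiable (by simp)).differentiableAt
      (ψ.2.1.differentiable (by simp)).differentiableAt
  map_smul' c φ := by
    apply Subtype.ext
    funext t
    exact deriv_const_mul c (φ.2.1.differentiable (by simp)).differentiableAt

lemma iteratedDeriv_eq (k : ℕ) (φ : CircleTest) : iteratedDeriv k φ.1 = ((D ^ k) φ).1 := by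
  induction k generalizing φ with
  | zero => simp
  | succ k ih => rw [iteratedDeriv_succ', pow_succ, Module.End.mul_apply, ← ih]; rfl

lemma hasDerivAt_e (j : ℤ) (t : ℝ) : HasDerivAt (e j).1 (j * I * (e j).1 t) t := by
  have h1 : HasDerivAt (fun s : ℝ => (j : ℂ) * s * I) (j * I) t := by
    have := ((ofRealCLM.hasDerivAt (x := t)).const_mul (j : ℂ)).mul_const I
    simpa using this
  have := h1.cexp
  rw [mul_comm] at this
  exact this

lemma hasDerivAt_test (φ : CircleTest) (t : ℝ) : HasDerivAt φ.1 ((D φ).1 t) t :=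
  (φ.2.1.differentiable (by simp)).differentiableAt.hasDerivAt

lemma test_two_pi (φ : CircleTest) : φ.1 (2 * Real.pi) = φ.1 0 := by
  simpa using φ.2.2 0

/-- Integration by parts; the boundary terms cancel by periodicity. -/
lemma fc_D (j : ℤ) (φ : CircleTest) : fc j (D φ) = j * I * fc j φ := by
  have h := intervalIntegral.integral_deriv_mul_eq_sub (a := 0) (b := 2 * Real.pi)
    (u := φ.1) (v := (e (-j)).1) (u' := (D φ).1)
    (v' := fun t => ((-j : ℤ) : ℂ) * I * (e (-j)).1 t)
    (fun t _ => hasDerivAt_test φ t) (fun t _ => hasDerivAt_e (-j) t)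
    ((continuous_test (D φ)).intervalIntegrable _ _)
    ((continuous_const.mul (continuous_test (e (-j)))).intervalIntegrable _ _)
  rw [test_two_pi, test_two_pi, sub_self,
    intervalIntegral.integral_add
      (f := fun t => (D φ).1 t * (e (-j)).1 t)
      (g := fun t => φ.1 t * (((-j : ℤ) : ℂ) * I * (e (-j)).1 t))
      (((continuous_test (D φ)).mul (continuous_test (e (-j)))).intervalIntegrable _ _)
      (((continuous_test φ).mul
        (continuous_const.mul (continuous_test (e (-j))))).intervalIntegrable _ _)] at h
  have h2 : ∀ t, φ.1 t * (((-j : ℤ) : ℂ) * I * (e (-j)).1 t) =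
      -(j * I) * (φ.1 t * (e (-j)).1 t) := fun t => by push_cast; ring
  simp only [h2, intervalIntegral.integral_const_mul] at h
  rw [fc_apply, fc_apply]
  linear_combination (1 / (2 * Real.pi) : ℂ) * h

lemma norm_fc_D_pow (j : ℤ) (k : ℕ) (φ : CircleTest) :
    ‖fc j ((D ^ k) φ)‖ = |(j : ℝ)| ^ k * ‖fc j φ‖ := by
  induction k with
  | zero => simp
  | succ k ih =>
    rw [pow_succ', Module.End.mul_apply, fc_D, norm_mul, ih, norm_mul, norm_I]
    simp only [norm_intCast, mul_one, pow_succ]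
    ring

/-- `M` bounds the first `N` derivatives of the test function `φ`. -/
def DerivBound (N : ℕ) (M : ℝ) (φ : CircleTest) : Prop :=
  ∀ j ≤ N, ∀ t : ℝ, ‖((D ^ j) φ).1 t‖ ≤ M

lemma DerivBound.nonneg {N : ℕ} {M : ℝ} {φ : CircleTest} (h : DerivBound N M φ) : 0 ≤ M :=
  (norm_nonneg _).trans (h 0 bot_le 0)

lemma exists_derivBound (N : ℕ) (φ : CircleTest) : ∃ M, DerivBound N M φ := by
  have h1 : ∀ j, ∃ M, ∀ t, ‖((D ^ j) φ).1 t‖ ≤ M := fun j => by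
    obtain ⟨M, hM⟩ := (((D ^ j) φ).2.2.isBounded_of_continuous
      Real.two_pi_pos.ne' (continuous_test ((D ^ j) φ))).exists_norm_le
    exact ⟨M, fun t => hM _ (mem_range_self t)⟩
  choose M hM using h1
  refine ⟨∑ j ∈ Finset.range (N + 1), |M j|, fun j hj t => (hM j t).trans ((le_abs_self _).trans ?_)⟩
  exact Finset.single_le_sum (f := fun j => |M j|) (fun _ _ => abs_nonneg _)
    (Finset.mem_range.2 (by lia))

/-- Decay of the Fourier coefficients. -/
lemma norm_fc_le_of_derivBound {N : ℕ} {M : ℝ} {φ : CircleTest} (h : DerivBound N M φ) (j : ℤ) :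
    (1 + |(j : ℝ)|) ^ N * ‖fc j φ‖ ≤ 2 ^ N * M := by
  have h0 := norm_fc_le j φ (h 0 bot_le)
  rcases eq_or_ne j 0 with rfl | hj
  · simp only [Int.cast_zero, abs_zero, add_zero, one_pow, one_mul]
    have : (1 : ℝ) ≤ 2 ^ N := one_le_pow₀ (by norm_num)
    nlinarith [h.nonneg]
  · have hN := norm_fc_le j _ (h N le_rfl)
    rw [norm_fc_D_pow] at hN
    have h1 : (1 : ℝ) ≤ |(j : ℝ)| := by exact_mod_cast Int.one_le_abs hj
    -- For j ≠ 0 one has 1 + |j| ≤ 2|j|; this is the source of the factor 2 ^ N.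
    calc (1 + |(j : ℝ)|) ^ N * ‖fc j φ‖ ≤ (2 * |(j : ℝ)|) ^ N * ‖fc j φ‖ := by gcongr; linarith
      _ = 2 ^ N * (|(j : ℝ)| ^ N * ‖fc j φ‖) := by rw [mul_pow]; ring
      _ ≤ 2 ^ N * M := by gcongr

lemma summable_inv_sq : Summable fun j : ℤ => ((1 + |(j : ℝ)|) ^ 2)⁻¹ := by
  refine Summable.of_norm_bounded_eventually (g := fun j : ℤ => 1 / (j : ℝ) ^ 2)
    (Real.summable_one_div_int_pow.2 (by norm_num)) ?_
  refine (Set.finite_singleton (0 : ℤ)).subset fun j hj => ?_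
  by_contra hj0
  apply hj
  change ‖((1 + |(j : ℝ)|) ^ 2)⁻¹‖ ≤ 1 / (j : ℝ) ^ 2
  have : (0 : ℝ) < |(j : ℝ)| := by
    simpa using hj0
  rw [Real.norm_of_nonneg (by positivity), one_div, ← sq_abs (j : ℝ)]
  exact inv_anti₀ (by positivity) (pow_le_pow_left₀ this.le (by linarith) 2)

/-- Sequences of at most polynomial growth. -/
def PolyBdd (b : ℤ → ℂ) : Prop := ∃ (N : ℕ) (C : ℝ), ∀ j, ‖b j‖ ≤ C * (1 + |(j : ℝ)|) ^ N

/-- Of the N + 2 derivatives, N absorb the growth of b and the other two buy a summable factor that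
does not depend on φ. -/
lemma norm_mul_fc_le {b : ℤ → ℂ} {N : ℕ} {C : ℝ} (hb : ∀ j, ‖b j‖ ≤ C * (1 + |(j : ℝ)|) ^ N)
    {M : ℝ} {φ : CircleTest} (h : DerivBound (N + 2) M φ) (j : ℤ) :
    ‖b j * fc j φ‖ ≤ C * 2 ^ (N + 2) * M * ((1 + |(j : ℝ)|) ^ 2)⁻¹ := by
  have hC : 0 ≤ C := by simpa using (norm_nonneg _).trans (hb 0)
  have := norm_fc_le_of_derivBound h j
  rw [norm_mul]
  have h1 : 0 < (1 + |(j : ℝ)|) ^ 2 := by positivity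
  rw [← div_eq_mul_inv, le_div_iff₀ h1]
  calc _ ≤ C * (1 + |(j : ℝ)|) ^ N * ‖fc j φ‖ * (1 + |(j : ℝ)|) ^ 2 := by gcongr; exact hb j
    _ = C * ((1 + |(j : ℝ)|) ^ (N + 2) * ‖fc j φ‖) := by ring
    _ ≤ C * (2 ^ (N + 2) * M) := by gcongr
    _ = _ := by ring

lemma PolyBdd.summable {b : ℤ → ℂ} (hb : PolyBdd b) (φ : CircleTest) :
    Summable fun j => ‖b j * fc j φ‖ := by
  obtain ⟨N, C, hb⟩ := hb
  obtain ⟨M, hM⟩ := exists_derivBound (N + 2) φ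
  exact Summable.of_nonneg_of_le (fun _ => norm_nonneg _) (norm_mul_fc_le hb hM)
    (summable_inv_sq.mul_left _)

lemma polyBdd_of_le {b : ℤ → ℂ} {C : ℝ} (hb : ∀ j, ‖b j‖ ≤ C) : PolyBdd b :=
  ⟨0, C, by simpa using hb⟩

lemma summable_norm_fc (φ : CircleTest) : Summable fun j => ‖fc j φ‖ := by
  have := (polyBdd_of_le (b := fun _ => 1) (C := 1) (by simp)).summable φ
  simpa using this

/-- The Fourier series of a test function converges to it. -/
lemma hasSum_fc (φ : CircleTest) (t : ℝ) : HasSum (fun j => fc j φ * (e j).1 t) (φ.1 t) := by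
  have : Fact (0 < 2 * Real.pi) := ⟨Real.two_pi_pos⟩
  let F : C(AddCircle (2 * Real.pi), ℂ) :=
    ⟨φ.2.2.lift, by
      refine continuous_coinduced_dom.2 ?_
      exact (continuous_test φ)⟩
  have hF : ∀ s : ℝ, F (s : AddCircle (2 * Real.pi)) = φ.1 s := fun s => rfl
  have hfour : ∀ (j : ℤ) (s : ℝ), (fourier j (s : AddCircle (2 * Real.pi)) : ℂ) = (e j).1 s := by
    intro j s
    rw [fourier_coe_apply, e_apply]
    congr 1
    have : (Real.pi : ℂ) ≠ 0 := by exact_mod_cast Real.pi_ne_zero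
    push_cast
    field_simp
  have hco : ∀ j, fourierCoeff F j = fc j φ := by
    intro j
    rw [fourierCoeff_eq_intervalIntegral _ _ 0, fc_apply, zero_add]
    simp only [hfour, hF, smul_eq_mul, real_smul]
    push_cast
    congr 1
    refine intervalIntegral.integral_congr fun s _ => ?_
    exact mul_comm _ _
  have hs : Summable (fourierCoeff F) := by
    have : fourierCoeff F = fun j => fc j φ := funext hco
    rw [this]
    exact (summable_norm_fc φ).of_norm
  have := has_pointwise_sum_fourier_series_of_summable hs (t : AddCircle (2 * Real.pi))
  simpa only [hco, hfour, hF, smul_eq_mul] using this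

/-- Integrals of absolutely convergent trigonometric series against test functions. -/
lemma hasSum_integral_mul {ι : Type*} [Countable ι] {c : ι → ℂ} (hc : Summable fun k => ‖c k‖)
    (m : ι → ℤ) {F : ℝ → ℂ} (hF : ∀ t, HasSum (fun k => c k * (e (m k)).1 t) (F t))
    (φ : CircleTest) :
    HasSum (fun k => 2 * Real.pi * (c k * fc (-m k) φ))
      (∫ t in (0 : ℝ)..(2 * Real.pi), F t * φ.1 t) := by
  obtain ⟨M, hM⟩ := exists_derivBound 0 φ
  have hM' : ∀ t, ‖φ.1 t‖ ≤ M := hM 0 le_rfl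
  have hp : (Real.pi : ℂ) ≠ 0 := by exact_mod_cast Real.pi_ne_zero
  have h := intervalIntegral.hasSum_integral_of_dominated_convergence (μ := volume)
    (a := 0) (b := 2 * Real.pi) (F := fun k t => c k * (e (m k)).1 t * φ.1 t)
    (f := fun t => F t * φ.1 t) (fun k _ => ‖c k‖ * M)
    (fun k => ((continuous_const.mul (continuous_test (e _))).mul (continuous_test φ)).aestronglyMeasurable)
    (fun k => Eventually.of_forall fun t _ => by
      rw [norm_mul, norm_mul, norm_e, mul_one]
      gcongr
      exact hM' t)
    (Eventually.of_forall fun t _ => hc.mul_right M)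
    (by simp) (Eventually.of_forall fun t _ => (hF t).mul_right _)
  -- The sign of the index changes because `fc j` integrates against `e (-j)`.
  have hk : ∀ k, 2 * Real.pi * (c k * fc (-m k) φ) =
      ∫ t in (0 : ℝ)..(2 * Real.pi), c k * (e (m k)).1 t * φ.1 t := by
    intro k
    rw [fc_apply, neg_neg]
    have : ∀ t, c k * (e (m k)).1 t * φ.1 t = c k * (φ.1 t * (e (m k)).1 t) := fun t => by ring
    simp only [this, intervalIntegral.integral_const_mul]
    field_simp
  simpa only [hk] using h

lemma fc_e (j k : ℤ) : fc j (e k) = if k = j then 1 else 0 := by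
  have hp : (Real.pi : ℂ) ≠ 0 := by exact_mod_cast Real.pi_ne_zero
  rw [fc_apply]
  simp only [e_mul]
  split_ifs with h
  · subst h
    simp [e_apply]
    field_simp
  · have hne : ((k + -j : ℤ) : ℂ) * I ≠ 0 := by
      refine mul_ne_zero (Int.cast_ne_zero.2 ?_) I_ne_zero
      lia
    have hd : ∀ t ∈ uIcc 0 (2 * Real.pi), HasDerivAt
        (fun t => (((k + -j : ℤ) : ℂ) * I)⁻¹ * (e (k + -j)).1 t) ((e (k + -j)).1 t) t := by
      intro t _
      have := (hasDerivAt_e (k + -j) t).const_mul ((((k + -j : ℤ) : ℂ) * I)⁻¹)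
      rwa [← mul_assoc, inv_mul_cancel₀ hne, one_mul] at this
    rw [intervalIntegral.integral_eq_sub_of_hasDerivAt hd
      ((continuous_test (e _)).intervalIntegrable _ _), test_two_pi]
    simp

lemma fc_conjTest (j : ℤ) (φ : CircleTest) : fc j (conjTest φ) = conj (fc (-j) φ) := by
  rw [fc_apply, fc_apply, map_mul,
    intervalIntegral.integral_of_le Real.two_pi_pos.le,
    intervalIntegral.integral_of_le Real.two_pi_pos.le, ← integral_conj]
  congr 1
  · simp [map_ofNat (starRingEnd ℂ) 2]
  · refine integral_congr_ae (Eventually.of_forall fun t => ?_)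
    have := congrArg (fun ψ : CircleTest => ψ.1 t) (conjTest_e (-(-j)))
    simp only [neg_neg] at this
    simp only [map_mul, neg_neg, ← this]
    rfl

/-! ### Bounded functionals on the test functions -/

/-- The linear functionals that are distributions. -/
def bdd : Submodule ℂ (CircleTest →ₗ[ℂ] ℂ) where
  carrier := {L | ∃ (N : ℕ) (C : ℝ), 0 ≤ C ∧ ∀ φ M, DerivBound N M φ → ‖L φ‖ ≤ C * M}
  zero_mem' := ⟨0, 0, le_rfl, by simp⟩
  add_mem' := by
    rintro L₁ L₂ ⟨N₁, C₁, h₁, H₁⟩ ⟨N₂, C₂, h₂, H₂⟩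
    refine ⟨max N₁ N₂, C₁ + C₂, add_nonneg h₁ h₂, fun φ M h => (norm_add_le _ _).trans ?_⟩
    rw [add_mul]
    exact add_le_add (H₁ φ M fun j hj => h j (hj.trans (le_max_left _ _)))
      (H₂ φ M fun j hj => h j (hj.trans (le_max_right _ _)))
  smul_mem' := by
    rintro c L ⟨N, C, h, H⟩
    refine ⟨N, ‖c‖ * C, by positivity, fun φ M hM => ?_⟩
    rw [LinearMap.smul_apply, norm_smul, mul_assoc]
    gcongr
    exact H φ M hM

lemma CircleDistribution.mem_bdd (Λ : CircleDistribution) : Λ.toLinearMap ∈ bdd := by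
  obtain ⟨N, C, h⟩ := Λ.bound
  refine ⟨N, |C|, abs_nonneg _, fun φ M hM => (h φ M fun j hj t => ?_).trans ?_⟩
  · rw [iteratedDeriv_eq]
    exact hM j hj t
  · exact mul_le_mul_of_nonneg_right (le_abs_self C) hM.nonneg

/-- The distribution given by a bounded functional. -/
def toDist (L : CircleTest →ₗ[ℂ] ℂ) (hL : L ∈ bdd) : CircleDistribution where
  toLinearMap := L
  bound := by
    obtain ⟨N, C, -, h⟩ := hL
    refine ⟨N, C, fun φ M hM => h φ M fun j hj t => ?_⟩
    rw [← iteratedDeriv_eq]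
    exact hM j hj t

lemma D_pow_e (k : ℕ) (j : ℤ) : (D ^ k) (e j) = (j * I) ^ k • e j := by
  induction k with
  | zero => simp
  | succ k ih =>
    have : D (e j) = (j * I : ℂ) • e j := Subtype.ext (funext fun t => (hasDerivAt_e j t).deriv)
    rw [pow_succ', Module.End.mul_apply, ih, map_smul, this, smul_smul, pow_succ]

lemma polyBdd_of_mem_bdd {L : CircleTest →ₗ[ℂ] ℂ} (hL : L ∈ bdd) : PolyBdd fun j => L (e j) := by
  obtain ⟨N, C, hC, h⟩ := hL
  refine ⟨N, C, fun j => h _ _ fun k hk t => ?_⟩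
  rw [D_pow_e]
  have : ‖(((j * I : ℂ) ^ k) • e j).1 t‖ = |(j : ℝ)| ^ k := by
    change ‖((j * I : ℂ) ^ k) * (e j).1 t‖ = _
    simp [norm_e]
  rw [this]
  calc |(j : ℝ)| ^ k ≤ (1 + |(j : ℝ)|) ^ k := by gcongr; linarith
    _ ≤ _ := pow_le_pow_right₀ (by linarith [abs_nonneg (j : ℝ)]) hk

lemma fc_D_pow (j : ℤ) (k : ℕ) (φ : CircleTest) :
    fc j ((D ^ k) φ) = (j * I) ^ k * fc j φ := by
  induction k with
  | zero => simp
  | succ k ih => rw [pow_succ', Module.End.mul_apply, fc_D, ih]; ring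

lemma D_pow_sub_partial_sum (s : Finset ℤ) (k : ℕ) (φ : CircleTest) :
    (D ^ k) (φ - ∑ j ∈ s, fc j φ • e j) = (D ^ k) φ - ∑ j ∈ s, fc j ((D ^ k) φ) • e j := by
  rw [map_sub, map_sum]
  congr 1
  refine Finset.sum_congr rfl fun j _ => ?_
  rw [map_smul, D_pow_e, smul_smul, fc_D_pow, mul_comm]

lemma sum_smul_apply (s : Finset ℤ) (c : ℤ → ℂ) (t : ℝ) :
    (∑ j ∈ s, c j • e j).1 t = ∑ j ∈ s, c j * (e j).1 t := by
  rw [Submodule.coe_sum, Finset.sum_apply]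
  rfl

lemma norm_sub_partial_sum_le (s : Finset ℤ) (φ : CircleTest) (t : ℝ) :
    ‖φ.1 t - ∑ j ∈ s, fc j φ * (e j).1 t‖ ≤ ∑' j : {j // j ∉ s}, ‖fc j.1 φ‖ := by
  have h5 := hasSum_fc φ t
  have h6 := h5.summable.sum_add_tsum_subtype_compl s
  rw [h5.tsum_eq] at h6
  rw [← h6, add_sub_cancel_left]
  have hs' : Summable fun j : {j // j ∉ s} => ‖fc j.1 φ‖ := (summable_norm_fc φ).subtype _
  refine tsum_of_norm_bounded hs'.hasSum fun j => ?_
  rw [norm_mul, norm_e, mul_one]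

/-- Differentiation commutes with Fourier partial sums, so each derivative of the remainder is
bounded by the tail of an absolutely convergent series. The partial sums thus converge in the
topology for which distributions are continuous. -/
lemma derivBound_sub_partial_sum (N : ℕ) (s : Finset ℤ) (φ : CircleTest) :
    DerivBound N (∑ k ∈ Finset.range (N + 1), ∑' j : {j // j ∉ s}, ‖fc j.1 ((D ^ k) φ)‖)
      (φ - ∑ j ∈ s, fc j φ • e j) := by
  intro k hk t
  rw [D_pow_sub_partial_sum, Submodule.coe_sub, Pi.sub_apply, sum_smul_apply]
  refine (norm_sub_partial_sum_le s ((D ^ k) φ) t).trans ?_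
  exact Finset.single_le_sum
    (f := fun k => ∑' j : {j // j ∉ s}, ‖fc j.1 ((D ^ k) φ)‖)
    (fun _ _ => tsum_nonneg fun _ => norm_nonneg _) (Finset.mem_range.2 (by lia))

/-- A distribution is determined by its Fourier coefficients. -/
lemma hasSum_of_mem_bdd {L : CircleTest →ₗ[ℂ] ℂ} (hL : L ∈ bdd) (φ : CircleTest) :
    HasSum (fun j => fc j φ * L (e j)) (L φ) := by
  obtain ⟨N, C, hC, h⟩ := hL
  -- The error of a finite partial sum is -L applied to the remainder of the Fourier series of φ.
  have key : ∀ s : Finset ℤ, ‖(∑ j ∈ s, fc j φ * L (e j)) - L φ‖ ≤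
      C * ∑ k ∈ Finset.range (N + 1), ∑' j : {j // j ∉ s}, ‖fc j.1 ((D ^ k) φ)‖ := by
    intro s
    have h1 : (∑ j ∈ s, fc j φ * L (e j)) - L φ = -L (φ - ∑ j ∈ s, fc j φ • e j) := by
      rw [map_sub, map_sum, neg_sub]
      congr 1
      exact Finset.sum_congr rfl fun j _ => (L.map_smul _ _).symm
    rw [h1, norm_neg]
    exact h _ _ (derivBound_sub_partial_sum N s φ)
  have hlim : ∀ k, Tendsto (fun s : Finset ℤ => ∑' j : {j // j ∉ s}, ‖fc j.1 ((D ^ k) φ)‖) atTop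
      (𝓝 0) := fun k => tendsto_tsum_compl_atTop_zero fun j => ‖fc j ((D ^ k) φ)‖
  have : Tendsto (fun s : Finset ℤ => C * ∑ k ∈ Finset.range (N + 1),
      ∑' j : {j // j ∉ s}, ‖fc j.1 ((D ^ k) φ)‖) atTop
      (𝓝 (C * ∑ k ∈ Finset.range (N + 1), 0)) :=
    (tendsto_finsetSum _ fun k _ => hlim k).const_mul _
  rw [Finset.sum_const_zero, mul_zero] at this
  rw [HasSum, SummationFilter.unconditional_filter, tendsto_iff_norm_sub_tendsto_zero]
  exact squeeze_zero (fun _ => norm_nonneg _) key this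

/-- The distribution with prescribed Fourier coefficients. -/
def ofCoeff (b : ℤ → ℂ) (hb : PolyBdd b) : CircleTest →ₗ[ℂ] ℂ where
  toFun φ := ∑' j, b j * fc j φ
  map_add' φ ψ := by
    simp only [map_add, mul_add]
    exact (hb.summable φ).of_norm.tsum_add (hb.summable ψ).of_norm
  map_smul' c φ := by
    rw [RingHom.id_apply, smul_eq_mul, ← tsum_mul_left]
    simp only [map_smul, smul_eq_mul]
    exact tsum_congr fun j => by ring

lemma ofCoeff_apply (b : ℤ → ℂ) (hb : PolyBdd b) (φ : CircleTest) :
    ofCoeff b hb φ = ∑' j, b j * fc j φ := rfl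

lemma ofCoeff_mem_bdd (b : ℤ → ℂ) (hb : PolyBdd b) : ofCoeff b hb ∈ bdd := by
  obtain ⟨N, C, h⟩ := id hb
  have hC : 0 ≤ C := by simpa using (norm_nonneg _).trans (h 0)
  refine ⟨N + 2, C * 2 ^ (N + 2) * ∑' j : ℤ, ((1 + |(j : ℝ)|) ^ 2)⁻¹,
    mul_nonneg (by positivity) (tsum_nonneg fun _ => by positivity), fun φ M hM => ?_⟩
  have := tsum_of_norm_bounded (summable_inv_sq.mul_left (C * 2 ^ (N + 2) * M)).hasSum
    (norm_mul_fc_le h hM)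
  rw [tsum_mul_left] at this
  rw [ofCoeff_apply]
  linarith

/-! ### Multiplication by `2 cos` -/

/-- Multiplication of a test function by `2 cos t`. -/
def M : CircleTest →ₗ[ℂ] CircleTest where
  toFun φ := ⟨fun t => (2 * Real.cos t : ℝ) * φ.1 t,
    (ofRealCLM.contDiff.comp (contDiff_const.mul Real.contDiff_cos)).mul φ.2.1,
    fun t => by simp only [φ.2.2 t, Real.cos_add_two_pi]⟩
  map_add' φ ψ := by
    apply Subtype.ext
    funext t
    exact mul_add _ _ _
  map_smul' c φ := by
    apply Subtype.ext
    funext t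
    exact mul_left_comm _ _ _

lemma M_apply (φ : CircleTest) (t : ℝ) : (M φ).1 t = (2 * Real.cos t : ℝ) * φ.1 t := rfl

lemma M_pow_apply (k : ℕ) (φ : CircleTest) (t : ℝ) :
    ((M ^ k) φ).1 t = ((2 * Real.cos t : ℝ) : ℂ) ^ k * φ.1 t := by
  induction k with
  | zero => simp
  | succ k ih => rw [pow_succ', Module.End.mul_apply, M_apply, ih, pow_succ]; ring

lemma conjTest_M (φ : CircleTest) : conjTest (M φ) = M (conjTest φ) := by
  apply Subtype.ext
  funext t
  change conj (((2 * Real.cos t : ℝ) : ℂ) * φ.1 t) = ((2 * Real.cos t : ℝ) : ℂ) * conj (φ.1 t)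
  rw [map_mul, conj_ofReal]

lemma conjTest_M_pow (k : ℕ) (φ : CircleTest) : conjTest ((M ^ k) φ) = (M ^ k) (conjTest φ) := by
  induction k with
  | zero => simp
  | succ k ih => rw [pow_succ', Module.End.mul_apply, conjTest_M, ih]; rfl

/-- Leibniz rule for the product with 2 cos = `M (e 0)`, whose derivatives are bounded by B. The
binomial coefficients add up to at most 2 ^ N. -/
lemma comp_M_mem_bdd {L : CircleTest →ₗ[ℂ] ℂ} (hL : L ∈ bdd) : L ∘ₗ M ∈ bdd := by
  obtain ⟨N, C, hC, h⟩ := hL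
  obtain ⟨B, hB⟩ := exists_derivBound N (M (e 0))
  refine ⟨N, C * (2 ^ N * B), by have := hB.nonneg; positivity, fun φ A hA => ?_⟩
  rw [mul_assoc]
  refine h _ _ fun k hk t => ?_
  have hprod : (M φ).1 = fun t => (M (e 0)).1 t * φ.1 t := by
    funext t
    simp [M_apply, e_apply]
  rw [← iteratedDeriv_eq, ← norm_iteratedFDeriv_eq_norm_iteratedDeriv, hprod]
  refine (norm_iteratedFDeriv_mul_le (M (e 0)).2.1 φ.2.1 t (n := k) (by exact_mod_cast le_top)).trans ?_
  have hA0 := hA.nonneg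
  have hB0 := hB.nonneg
  calc _ ≤ ∑ i ∈ Finset.range (k + 1), (k.choose i : ℝ) * B * A := by
        refine Finset.sum_le_sum fun i hi => ?_
        have hi' := Finset.mem_range.1 hi
        rw [norm_iteratedFDeriv_eq_norm_iteratedDeriv, norm_iteratedFDeriv_eq_norm_iteratedDeriv,
          iteratedDeriv_eq, iteratedDeriv_eq]
        gcongr
        · exact hB i (by lia) t
        · exact hA (k - i) (by lia) t
    _ = 2 ^ k * B * A := by
        rw [← Finset.sum_mul, ← Finset.sum_mul]
        congr 2
        exact_mod_cast Nat.sum_range_choose k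
    _ ≤ 2 ^ N * B * A := by gcongr; norm_num

lemma comp_M_pow_mem_bdd {L : CircleTest →ₗ[ℂ] ℂ} (hL : L ∈ bdd) (k : ℕ) :
    L ∘ₗ (M ^ k) ∈ bdd := by
  induction k with
  | zero => simpa [Module.End.one_eq_id] using hL
  | succ k ih =>
    have := comp_M_mem_bdd ih
    rwa [LinearMap.comp_assoc, ← Module.End.mul_eq_comp, ← pow_succ] at this

/-! ### Boundary values of power series -/

/-- The function `2 Re`. -/
def X (z : ℂ) : ℂ := z + conj z

lemma X_circleMap (r θ : ℝ) : X (circleMap 0 r θ) = r * (2 * Real.cos θ : ℝ) := by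
  simp only [X, circleMap, zero_add, map_mul, conj_ofReal, ← exp_conj, conj_I]
  push_cast
  rw [Complex.two_cos]
  ring_nf

lemma continuous_X : Continuous X := continuous_id.add continuous_conj

/-- The boundary value of `u` along the radii in `R` is the distribution `L`. -/
def BV (R : Set ℝ) (u : ℂ → ℂ) (L : CircleTest →ₗ[ℂ] ℂ) : Prop :=
  L ∈ bdd ∧
    (∀ r ∈ R, IntervalIntegrable (fun θ => u (circleMap 0 r θ)) volume 0 (2 * Real.pi)) ∧
    ∀ φ : CircleTest, Tendsto (circlePairing u φ) (𝓝[R] 1) (𝓝 (L φ))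

lemma BV.hasBoundaryValueAlong {R : Set ℝ} {u : ℂ → ℂ} {L : CircleTest →ₗ[ℂ] ℂ} (h : BV R u L) :
    HasBoundaryValueAlong R u (toDist L h.1) := ⟨h.2.1, h.2.2⟩

lemma intervalIntegrable_mul_test {u : ℝ → ℂ}
    (hu : IntervalIntegrable u volume 0 (2 * Real.pi)) (φ : CircleTest) :
    IntervalIntegrable (fun θ => u θ * φ.1 θ) volume 0 (2 * Real.pi) :=
  hu.mul_continuousOn (continuous_test φ).continuousOn

lemma BV.add {R : Set ℝ} {u v : ℂ → ℂ} {L L' : CircleTest →ₗ[ℂ] ℂ} (h : BV R u L)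
    (h' : BV R v L') : BV R (fun z => u z + v z) (L + L') := by
  refine ⟨bdd.add_mem h.1 h'.1, fun r hr => (h.2.1 r hr).add (h'.2.1 r hr), fun φ => ?_⟩
  refine ((h.2.2 φ).add (h'.2.2 φ)).congr' ?_
  filter_upwards [self_mem_nhdsWithin] with r hr
  rw [circlePairing, circlePairing, circlePairing, ← intervalIntegral.integral_add
    (intervalIntegrable_mul_test (h.2.1 r hr) φ) (intervalIntegrable_mul_test (h'.2.1 r hr) φ)]
  simp only [add_mul]

lemma BV.const_mul {R : Set ℝ} {u : ℂ → ℂ} {L : CircleTest →ₗ[ℂ] ℂ} (h : BV R u L) (c : ℂ) :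
    BV R (fun z => c * u z) (c • L) := by
  refine ⟨bdd.smul_mem c h.1, fun r hr => (h.2.1 r hr).const_mul c, fun φ => ?_⟩
  refine ((h.2.2 φ).const_mul c).congr fun r => ?_
  simp only [circlePairing, mul_assoc, intervalIntegral.integral_const_mul]

lemma BV.zero (R : Set ℝ) : BV R (fun _ => 0) 0 :=
  ⟨bdd.zero_mem, by simp, fun φ => by
    have : circlePairing (fun _ => 0) φ = fun _ => 0 := funext fun r => by simp [circlePairing]
    rw [this]
    exact tendsto_const_nhds⟩

lemma BV.sum {R : Set ℝ} {ι : Type*} (s : Finset ι) {u : ι → ℂ → ℂ}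
    {L : ι → CircleTest →ₗ[ℂ] ℂ} (h : ∀ i ∈ s, BV R (u i) (L i)) :
    BV R (fun z => ∑ i ∈ s, u i z) (∑ i ∈ s, L i) := by
  classical
  induction s using Finset.induction_on with
  | empty => simpa using BV.zero R
  | insert i s hi ih =>
    simp only [Finset.sum_insert hi]
    exact (h i (Finset.mem_insert_self _ _)).add
      (ih fun j hj => h j (Finset.mem_insert_of_mem hj))

/-- On |z| = r the function X is 2r cos θ, so the factor X moves to the test function as `M`, up to
the scalar r → 1. -/
lemma BV.X_mul {R : Set ℝ} {u : ℂ → ℂ} {L : CircleTest →ₗ[ℂ] ℂ} (h : BV R u L) :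
    BV R (fun z => X z * u z) (L ∘ₗ M) := by
  refine ⟨comp_M_mem_bdd h.1, fun r hr => ?_, fun φ => ?_⟩
  · refine (h.2.1 r hr).continuousOn_mul ?_
    exact (continuous_X.comp (continuous_circleMap 0 r)).continuousOn
  · have h1 : Tendsto (fun r : ℝ => (r : ℂ)) (𝓝[R] 1) (𝓝 1) := by
      have := (continuous_ofReal.tendsto 1).mono_left (nhdsWithin_le_nhds (s := R))
      simpa using this
    have h2 := h1.mul (h.2.2 (M φ))
    rw [one_mul] at h2
    refine h2.congr fun r => ?_
    rw [circlePairing, circlePairing, ← intervalIntegral.integral_const_mul]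
    refine intervalIntegral.integral_congr fun θ _ => ?_
    simp only [X_circleMap, M_apply]
    ring

lemma BV.X_pow_mul {R : Set ℝ} {u : ℂ → ℂ} {L : CircleTest →ₗ[ℂ] ℂ} (h : BV R u L) (k : ℕ) :
    BV R (fun z => X z ^ k * u z) (L ∘ₗ M ^ k) := by
  induction k with
  | zero => simpa [Module.End.one_eq_id] using h
  | succ k ih =>
    have := ih.X_mul
    rw [LinearMap.comp_assoc, ← Module.End.mul_eq_comp, ← pow_succ] at this
    simpa only [pow_succ', mul_assoc] using this

/-- Agreement at almost every angle suffices. This matters for the derivative of top order, which is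
controlled only almost everywhere on a regular circle. -/
lemma BV.congr {R : Set ℝ} {u v : ℂ → ℂ} {L : CircleTest →ₗ[ℂ] ℂ} (h : BV R u L)
    (huv : ∀ r ∈ R, ∀ᵐ θ ∂(volume.restrict (Ioc 0 (2 * Real.pi))),
      u (circleMap 0 r θ) = v (circleMap 0 r θ)) : BV R v L := by
  have hI : uIoc 0 (2 * Real.pi) = Ioc 0 (2 * Real.pi) := uIoc_of_le Real.two_pi_pos.le
  refine ⟨h.1, fun r hr => ?_, fun φ => (h.2.2 φ).congr' ?_⟩
  · refine (h.2.1 r hr).congr_ae ?_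
    rw [hI]
    exact huv r hr
  · filter_upwards [self_mem_nhdsWithin] with r hr
    refine intervalIntegral.integral_congr_ae ?_
    rw [hI, ← ae_restrict_iff' measurableSet_Ioc]
    filter_upwards [huv r hr] with θ hθ
    rw [hθ]

lemma BV.mono {R R' : Set ℝ} {u : ℂ → ℂ} {L : CircleTest →ₗ[ℂ] ℂ} (h : BV R u L)
    (hR : R' ⊆ R) : BV R' u L :=
  ⟨h.1, fun r hr => h.2.1 r (hR hr), fun φ => (h.2.2 φ).mono_left (nhdsWithin_mono _ hR)⟩

lemma circleMap_mem_disk {r : ℝ} (hr : r ∈ Ioo (0 : ℝ) 1) (θ : ℝ) : circleMap 0 r θ ∈ disk := by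
  simp [disk, abs_of_pos hr.1, hr.2]

lemma circleMap_pow (r : ℝ) (k : ℕ) (θ : ℝ) : circleMap 0 r θ ^ k = r ^ k * (e k).1 θ := by
  rw [circleMap, zero_add, mul_pow, ← exp_nat_mul, e_apply]
  push_cast
  ring_nf

/-- The power series with coefficients `b 0, b 1, …`. -/
def ps (b : ℤ → ℂ) (z : ℂ) : ℂ := ∑' k : ℕ, b k * z ^ k

lemma summable_polyBdd_mul_geometric (N : ℕ) {ρ : ℝ} (h0 : 0 ≤ ρ) (h1 : ρ < 1) :
    Summable fun k : ℕ => (1 + (k : ℝ)) ^ N * ρ ^ k := by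
  have h2 := summable_pow_mul_geometric_of_norm_lt_one N (r := ρ) (by
    rwa [Real.norm_of_nonneg h0])
  have h3 := summable_geometric_of_lt_one h0 h1
  refine Summable.of_nonneg_of_le (fun k => by positivity) (fun k => ?_)
    ((h2.mul_left (2 ^ N)).add h3)
  rcases Nat.eq_zero_or_pos k with rfl | hk
  · have : (0 : ℝ) ≤ 2 ^ N * ((0 : ℕ) ^ N * ρ ^ 0) := by positivity
    simp only [CharP.cast_eq_zero, add_zero, one_pow, pow_zero, mul_one] at this ⊢
    linarith
  · have hk' : (1 : ℝ) ≤ k := by exact_mod_cast hk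
    have : (1 + (k : ℝ)) ^ N ≤ 2 ^ N * (k : ℝ) ^ N := by
      rw [← mul_pow]
      gcongr
      linarith
    have h4 : 0 ≤ ρ ^ k := by positivity
    nlinarith

lemma PolyBdd.summable_ps {b : ℤ → ℂ} (hb : PolyBdd b) {z : ℂ} (hz : z ∈ disk) :
    Summable fun k : ℕ => ‖b k * z ^ k‖ := by
  obtain ⟨N, C, h⟩ := hb
  have hz' : ‖z‖ < 1 := by simpa [disk] using hz
  refine Summable.of_nonneg_of_le (fun k => norm_nonneg _) (fun k => ?_)
    ((summable_polyBdd_mul_geometric N (norm_nonneg z) hz').mul_left C)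
  rw [norm_mul, norm_pow, ← mul_assoc]
  gcongr
  simpa using h k

lemma PolyBdd.hasSum_ps {b : ℤ → ℂ} (hb : PolyBdd b) {z : ℂ} (hz : z ∈ disk) :
    HasSum (fun k : ℕ => b k * z ^ k) (ps b z) :=
  (hb.summable_ps hz).of_norm.hasSum

lemma isOpen_disk : IsOpen disk := Metric.isOpen_ball

lemma PolyBdd.differentiableOn_ps {b : ℤ → ℂ} (hb : PolyBdd b) :
    DifferentiableOn ℂ (ps b) disk := by
  obtain ⟨N, C, h⟩ := hb
  intro z hz
  have hz' : ‖z‖ < 1 := by simpa [disk] using hz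
  obtain ⟨ρ, h1, h2⟩ := exists_between hz'
  have h0 : 0 ≤ ρ := (norm_nonneg z).trans h1.le
  refine DifferentiableAt.differentiableWithinAt ?_
  have : DifferentiableOn ℂ (ps b) (Metric.ball 0 ρ) := by
    refine differentiableOn_tsum_of_summable_norm (F := fun (k : ℕ) z => b k * z ^ k)
      ((summable_polyBdd_mul_geometric N h0 h2).mul_left C) (fun k => by fun_prop)
      Metric.isOpen_ball fun k w hw => ?_
    have hw' : ‖w‖ ≤ ρ := by simpa using (mem_ball_zero_iff.1 hw).le
    have hC : 0 ≤ C := by simpa using (norm_nonneg _).trans (h 0)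
    rw [norm_mul, norm_pow, ← mul_assoc]
    gcongr
    simpa using h k
  exact this.differentiableAt (Metric.isOpen_ball.mem_nhds (by simpa using h1))

/-- The Fourier coefficients of the boundary value of the power series `ps b`, reflected. -/
def hcoef (b : ℤ → ℂ) (j : ℤ) : ℂ := if j ≤ 0 then 2 * Real.pi * b (-j) else 0

lemma PolyBdd.hcoef {b : ℤ → ℂ} (hb : PolyBdd b) : PolyBdd (hcoef b) := by
  obtain ⟨N, C, h⟩ := hb
  have hC : 0 ≤ C := by simpa using (norm_nonneg _).trans (h 0)
  refine ⟨N, 2 * Real.pi * C, fun j => ?_⟩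
  have hp := Real.pi_pos
  rw [DiskSchwarz.hcoef]
  split_ifs
  · rw [norm_mul, mul_assoc]
    have : ‖(2 * Real.pi : ℂ)‖ = 2 * Real.pi := by simp [abs_of_pos hp]
    rw [this]
    gcongr
    simpa using h (-j)
  · rw [norm_zero]
    positivity

/-- The boundary value of the power series `ps b`. -/
def hdist (b : ℤ → ℂ) (hb : PolyBdd b) : CircleTest →ₗ[ℂ] ℂ := ofCoeff (hcoef b) hb.hcoef

/-- Integrating e^{ikθ} against φ gives 2π `fc (-k) φ`, so a power series only sees the coefficients
of φ at frequencies -k ≤ 0. -/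
lemma hdist_apply (b : ℤ → ℂ) (hb : PolyBdd b) (φ : CircleTest) :
    hdist b hb φ = ∑' k : ℕ, 2 * Real.pi * (b k * fc (-k) φ) := by
  rw [hdist, ofCoeff_apply]
  have hinj : Function.Injective fun k : ℕ => -(k : ℤ) := fun a b h => by simpa using h
  rw [← hinj.tsum_eq]
  · refine tsum_congr fun k => ?_
    simp [hcoef, mul_assoc]
  · intro j hj
    by_cases h : j ≤ 0
    · exact ⟨j.natAbs, by simp only; lia⟩
    · simp [hcoef, h] at hj

lemma summable_mul_fc_neg {b : ℤ → ℂ} (hb : PolyBdd b) (φ : CircleTest) :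
    Summable fun k : ℕ => ‖b k * fc (-k) φ‖ := by
  have hinj : Function.Injective fun k : ℕ => -(k : ℤ) := fun a b h => by simpa using h
  have hb' : PolyBdd fun j => b (-j) := by
    obtain ⟨N, C, h⟩ := hb
    exact ⟨N, C, fun j => by simpa using h (-j)⟩
  have := (hb'.summable φ).comp_injective hinj
  simpa [Function.comp_def] using this

/-- Termwise integration leaves a factor r^k in each term. Since the coefficients of φ decay
rapidly, the terms with r^k replaced by 1 are an absolutely summable majorant, and r → 1 is taken
under the sum. -/
lemma PolyBdd.bv_ps {b : ℤ → ℂ} (hb : PolyBdd b) : BV (Ioo 0 1) (ps b) (hdist b hb) := by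
  refine ⟨ofCoeff_mem_bdd _ _, fun r hr => ?_, fun φ => ?_⟩
  · refine Continuous.intervalIntegrable ?_ _ _
    exact hb.differentiableOn_ps.continuousOn.comp_continuous (continuous_circleMap 0 r)
      (circleMap_mem_disk hr)
  · have hpair : ∀ r ∈ Ioo (0 : ℝ) 1, circlePairing (ps b) φ r =
        ∑' k : ℕ, 2 * Real.pi * (b k * r ^ k * fc (-k) φ) := by
      intro r hr
      refine (HasSum.tsum_eq ?_).symm
      refine hasSum_integral_mul (c := fun k : ℕ => b k * (r : ℂ) ^ k) ?_ (fun k => k) ?_ φ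
      · refine hb.summable_ps (z := (r : ℂ)) ?_
        simp [disk, abs_of_pos hr.1, hr.2]
      · intro t
        simpa only [circleMap_pow, mul_assoc] using hb.hasSum_ps (circleMap_mem_disk hr t)
    have hlim : Tendsto (fun r : ℝ => ∑' k : ℕ, 2 * Real.pi * (b k * (r : ℂ) ^ k * fc (-k) φ))
        (𝓝[Ioo 0 1] 1) (𝓝 (hdist b hb φ)) := by
      rw [hdist_apply]
      refine tendsto_tsum_of_dominated_convergence
        ((summable_mul_fc_neg hb φ).mul_left (2 * Real.pi)) (fun k => ?_) ?_
      · have : Tendsto (fun r : ℝ => 2 * Real.pi * (b k * (r : ℂ) ^ k * fc (-k) φ)) (𝓝 1)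
            (𝓝 (2 * Real.pi * (b k * ((1 : ℝ) : ℂ) ^ k * fc (-k) φ))) :=
          Continuous.tendsto (by fun_prop) 1
        simpa using this.mono_left nhdsWithin_le_nhds
      · filter_upwards [self_mem_nhdsWithin] with r hr k
        have hp := Real.pi_pos
        have : ‖(2 * Real.pi : ℂ)‖ = 2 * Real.pi := by simp [abs_of_pos hp]
        rw [norm_mul, this]
        gcongr 2 * Real.pi * ?_
        rw [norm_mul, norm_mul, norm_mul, norm_pow, norm_real, Real.norm_of_nonneg hr.1.le]
        gcongr
        exact mul_le_of_le_one_right (norm_nonneg _) (pow_le_one₀ hr.1.le hr.2.le)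
    refine hlim.congr' ?_
    filter_upwards [self_mem_nhdsWithin] with r hr
    rw [hpair r hr]

lemma neBot_nhdsWithin_Ioo : (𝓝[Ioo (0 : ℝ) 1] 1).NeBot := by
  rw [nhdsWithin_Ioo_eq_nhdsLT zero_lt_one]
  infer_instance

/-- Uniqueness of Fourier coefficients. -/
lemma fc_eq_of_hasSum {ι : Type*} [Countable ι] {c : ι → ℂ} (hc : Summable fun k => ‖c k‖)
    {m : ι → ℤ} (hm : Function.Injective m) {φ : CircleTest}
    (hF : ∀ t, HasSum (fun k => c k * (e (m k)).1 t) (φ.1 t)) (k : ι) : fc (m k) φ = c k := by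
  have hp : (Real.pi : ℂ) ≠ 0 := by exact_mod_cast Real.pi_ne_zero
  have h := hasSum_integral_mul hc m hF (e (-m k))
  rw [fc_apply, h.unique (hasSum_single k fun i hi => ?_), fc_e, if_pos rfl]
  · field_simp
  · rw [fc_e, if_neg (by simpa using fun h => hi (hm h.symm))]
    ring

lemma fc_eq_zero_of_hasSum {ι : Type*} [Countable ι] {c : ι → ℂ} (hc : Summable fun k => ‖c k‖)
    {m : ι → ℤ} {φ : CircleTest}
    (hF : ∀ t, HasSum (fun k => c k * (e (m k)).1 t) (φ.1 t)) {j : ℤ} (hj : j ∉ range m) :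
    fc j φ = 0 := by
  have h := hasSum_integral_mul hc m hF (e (-j))
  have h0 : ∀ k, 2 * Real.pi * (c k * fc (-m k) (e (-j))) = 0 := fun k => by
    rw [fc_e, if_neg (by simpa using fun h => hj ⟨k, h.symm⟩)]
    ring
  simp only [h0] at h
  rw [fc_apply, h.unique hasSum_zero, mul_zero]

/-! ### Holomorphic functions with boundary values -/

/-- The function `t ↦ h (r e^{it})` for `h` holomorphic. -/
lemma circle_mem_test {h : ℂ → ℂ} (hh : DifferentiableOn ℂ h disk) {r : ℝ}
    (hr : r ∈ Ioo (0 : ℝ) 1) : (fun t => h (circleMap 0 r t)) ∈ CircleTest := by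
  refine ⟨?_, fun t => by simp only [periodic_circleMap 0 r t]⟩
  have h1 : ContDiffOn ℝ ∞ h disk := (hh.contDiffOn isOpen_disk).restrict_scalars ℝ
  exact contDiffOn_univ.1 (h1.comp (contDiff_circleMap 0 r).contDiffOn
    fun t _ => circleMap_mem_disk hr t)

/-- The Taylor coefficients at the origin. -/
def taylorCoeff (h : ℂ → ℂ) (j : ℤ) : ℂ :=
  if 0 ≤ j then (j.toNat.factorial : ℂ)⁻¹ * iteratedDeriv j.toNat h 0 else 0

lemma hasSum_taylorCoeff {h : ℂ → ℂ} (hh : DifferentiableOn ℂ h disk) {z : ℂ} (hz : z ∈ disk) :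
    HasSum (fun k : ℕ => taylorCoeff h k * z ^ k) (h z) := by
  have := Complex.hasSum_taylorSeries_on_ball hh hz
  refine this.congr_fun fun k => ?_
  simp [taylorCoeff]
  ring

lemma fc_circle {h : ℂ → ℂ} (hh : DifferentiableOn ℂ h disk) {r : ℝ}
    (hr : r ∈ Ioo (0 : ℝ) 1) (k : ℕ) :
    fc k ⟨_, circle_mem_test hh hr⟩ = taylorCoeff h k * r ^ k := by
  have hs : Summable fun k : ℕ => ‖taylorCoeff h k * (r : ℂ) ^ k‖ :=
    (hasSum_taylorCoeff hh (z := (r : ℂ)) (by simp [disk, abs_of_pos hr.1, hr.2])).summable.norm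
  refine fc_eq_of_hasSum hs (m := fun k : ℕ => (k : ℤ)) Nat.cast_injective (fun t => ?_) k
  have := hasSum_taylorCoeff hh (circleMap_mem_disk hr t)
  simpa only [circleMap_pow, mul_assoc] using this

lemma contDiff_trig_series {c : ℕ → ℂ} {m : ℕ → ℤ}
    (hc : ∀ k : ℕ, Summable fun i => ‖c i‖ * |(m i : ℝ)| ^ k) :
    ContDiff ℝ ∞ fun t => ∑' i, c i * (e (m i)).1 t := by
  refine contDiff_tsum (v := fun k i => ‖c i‖ * |(m i : ℝ)| ^ k)
    (fun i => contDiff_const.mul (e (m i)).2.1) (fun k _ => hc k) fun k i t _ => ?_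
  have h1 : (fun t => c i * (e (m i)).1 t) = (c i • e (m i)).1 := rfl
  rw [norm_iteratedFDeriv_eq_norm_iteratedDeriv, h1, iteratedDeriv_eq, map_smul, D_pow_e]
  change ‖c i * (((m i : ℂ) * I) ^ k * (e (m i)).1 t)‖ ≤ _
  simp [norm_e]

/-- If all the limits in the definition of the boundary value exist, then the Taylor coefficients
have at most polynomial growth. -/
lemma polyBdd_taylorCoeff {h : ℂ → ℂ} (hh : h ∈ Hb) : PolyBdd (taylorCoeff h) := by
  obtain ⟨hd, hlim⟩ := hh
  by_contra hcon
  -- Failure of polynomial growth gives a sequence of indices m i with coefficients above (1 + m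
  -- i)^i. Requiring m i ≥ 1 makes the base at least 2; the m i need not be distinct.
  have hex : ∀ i : ℕ, ∃ m : ℕ, 1 ≤ m ∧ (1 + (m : ℝ)) ^ i < ‖taylorCoeff h m‖ := by
    intro i
    by_contra! hi
    refine hcon ⟨i, max 1 ‖taylorCoeff h 0‖, fun j => ?_⟩
    have h0 : (0 : ℝ) ≤ max 1 ‖taylorCoeff h 0‖ := zero_le_one.trans (le_max_left _ _)
    by_cases hj : 0 ≤ j
    · obtain ⟨m, rfl⟩ := Int.eq_ofNat_of_zero_le hj
      rcases Nat.eq_zero_or_pos m with rfl | hm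
      · simp
      · have := hi m hm
        simp only [Int.cast_natCast, Nat.abs_cast]
        refine this.trans (le_mul_of_one_le_left (by positivity) (le_max_left _ _))
    · rw [taylorCoeff, if_neg hj, norm_zero]
      positivity
  choose m hm1 hm using hex
  have ha : ∀ i, taylorCoeff h (m i) ≠ 0 := fun i h0 => by
    have := hm i
    rw [h0, norm_zero] at this
    exact absurd this (not_lt.2 (by positivity))
  -- The reciprocal coefficients, placed at the frequencies -m i, decay so fast that they define a
  -- smooth test function. Against it, h pairs to 2π Σ r^{m i}, a series of positive terms.
  let c : ℕ → ℂ := fun i => (taylorCoeff h (m i))⁻¹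
  have hc : ∀ k : ℕ, Summable fun i => ‖c i‖ * |((-(m i : ℤ) : ℤ) : ℝ)| ^ k := by
    intro k
    refine Summable.of_norm_bounded_eventually_nat (g := fun i => 2 ^ k * (1 / 2 : ℝ) ^ i)
      (summable_geometric_two.mul_left _) ?_
    filter_upwards [eventually_ge_atTop k] with i hi
    rw [Real.norm_of_nonneg (by positivity)]
    obtain ⟨d, rfl⟩ := Nat.exists_eq_add_of_le hi
    have h2 : (2 : ℝ) ≤ 1 + m (k + d) := by
      have : (1 : ℝ) ≤ m (k + d) := by exact_mod_cast hm1 _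
      linarith
    have h3 : ‖c (k + d)‖ ≤ ((1 + (m (k + d) : ℝ)) ^ (k + d))⁻¹ := by
      rw [norm_inv]
      exact inv_anti₀ (by positivity) (hm _).le
    have h4 : |((-(m (k + d) : ℤ) : ℤ) : ℝ)| ^ k ≤ (1 + (m (k + d) : ℝ)) ^ k := by
      push_cast
      rw [abs_neg, Nat.abs_cast]
      gcongr
      linarith
    calc _ ≤ ((1 + (m (k + d) : ℝ)) ^ (k + d))⁻¹ * (1 + (m (k + d) : ℝ)) ^ k := by gcongr
      _ = ((1 + (m (k + d) : ℝ)) ^ d)⁻¹ := by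
        rw [pow_add]
        field_simp
      _ ≤ (2 ^ d)⁻¹ := inv_anti₀ (by positivity) (by gcongr)
      _ = 2 ^ k * (1 / 2) ^ (k + d) := by
        rw [pow_add, ← mul_assoc, ← mul_pow, one_div, mul_inv_cancel₀ two_ne_zero, one_pow,
          one_mul, inv_pow]
  have hc0 : Summable fun i => ‖c i‖ := by simpa using hc 0
  let φ : CircleTest := ⟨fun t => ∑' i, c i * (e (-(m i : ℤ))).1 t, contDiff_trig_series hc,
    fun t => by simp only [(e _).2.2 t]⟩
  have hφ : ∀ t, HasSum (fun i => c i * (e (-(m i : ℤ))).1 t) (φ.1 t) := fun t => by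
    refine Summable.hasSum (Summable.of_norm ?_)
    simpa [norm_e] using hc0
  have hpair : ∀ r ∈ Ioo (0 : ℝ) 1, HasSum (fun i => 2 * Real.pi * (r : ℂ) ^ m i)
      (circlePairing h φ r) := by
    intro r hr
    have h1 := hasSum_integral_mul hc0 (fun i => -(m i : ℤ)) hφ ⟨_, circle_mem_test hd hr⟩
    simp only [neg_neg, fc_circle hd hr] at h1
    have h2 : ∀ i, c i * (taylorCoeff h (m i) * (r : ℂ) ^ m i) = (r : ℂ) ^ m i := fun i => by
      rw [← mul_assoc, inv_mul_cancel₀ (ha i), one_mul]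
    simp only [h2] at h1
    have h3 : circlePairing h φ r =
        ∫ t in (0 : ℝ)..(2 * Real.pi), φ.1 t * h (circleMap 0 r t) :=
      intervalIntegral.integral_congr fun t _ => mul_comm _ _
    rw [h3]
    exact h1
  obtain ⟨L, hL⟩ := hlim φ
  have := neBot_nhdsWithin_Ioo
  -- Every finite partial sum of that series tends to 2πn as r → 1, so no finite limit L is
  -- possible.
  have hbig : ∀ n : ℕ, 2 * Real.pi * n ≤ L.re := by
    intro n
    have h1 : Tendsto (fun r : ℝ => ∑ i ∈ Finset.range n, 2 * Real.pi * r ^ m i) (𝓝[Ioo 0 1] 1)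
        (𝓝 (2 * Real.pi * n)) := by
      have : Tendsto (fun r : ℝ => ∑ i ∈ Finset.range n, 2 * Real.pi * r ^ m i) (𝓝 1)
          (𝓝 (∑ i ∈ Finset.range n, 2 * Real.pi * (1 : ℝ) ^ m i)) :=
        Continuous.tendsto (by fun_prop) 1
      simp only [one_pow, Finset.sum_const, Finset.card_range, nsmul_eq_mul, mul_one] at this
      rw [mul_comm (n : ℝ)] at this
      exact this.mono_left nhdsWithin_le_nhds
    refine le_of_tendsto_of_tendsto h1 ((continuous_re.tendsto L).comp hL) ?_
    filter_upwards [self_mem_nhdsWithin] with r hr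
    have h2 := Complex.hasSum_re (hpair r hr)
    have h3 : ∀ i, (2 * Real.pi * (r : ℂ) ^ m i).re = 2 * Real.pi * r ^ m i := fun i => by
      rw [← ofReal_re (2 * Real.pi * r ^ m i)]
      push_cast
      rfl
    simp only [h3] at h2
    have := Real.pi_pos
    have := hr.1
    exact sum_le_hasSum _ (fun i _ => by positivity) h2
  obtain ⟨n, hn⟩ := exists_nat_gt L.re
  have h5 := hbig n
  have h6 := Real.pi_gt_three
  have h7 : (0 : ℝ) ≤ n := n.cast_nonneg
  nlinarith

lemma eq_ps_taylorCoeff {h : ℂ → ℂ} (hh : DifferentiableOn ℂ h disk) {z : ℂ} (hz : z ∈ disk) :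
    h z = ps (taylorCoeff h) z := (hasSum_taylorCoeff hh hz).tsum_eq.symm

lemma bv_of_mem_Hb {h : ℂ → ℂ} (hh : h ∈ Hb) :
    BV (Ioo 0 1) h (hdist (taylorCoeff h) (polyBdd_taylorCoeff hh)) :=
  (polyBdd_taylorCoeff hh).bv_ps.congr fun _ hr => Eventually.of_forall fun θ =>
    (eq_ps_taylorCoeff hh.1 (circleMap_mem_disk hr θ)).symm

lemma boundaryValue_eq {h : ℂ → ℂ} {L : CircleTest →ₗ[ℂ] ℂ} (hL : BV (Ioo 0 1) h L) :
    boundaryValue h = L :=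
  have := neBot_nhdsWithin_Ioo
  funext fun φ => (hL.2.2 φ).limUnder_eq

/-! ### The Schwarz kernel -/

/-- The Schwarz kernel `(e^{it} + z) / (e^{it} - z)` as a test function. -/
def schwarzTest {z : ℂ} (hz : z ∈ disk) : CircleTest := ⟨schwarzFun 0 z, schwarz_mem 0 hz⟩

/-- The coefficients `1, 2, 2, …`. -/
def oneTwo (j : ℤ) : ℂ := if j = 0 then 1 else 2

lemma polyBdd_oneTwo : PolyBdd oneTwo := polyBdd_of_le (C := 2) fun j => by
  rw [oneTwo]
  split_ifs <;> simp

lemma hasSum_oneTwo {z : ℂ} (hz : ‖z‖ < 1) :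
    HasSum (fun k : ℕ => oneTwo k * z ^ k) ((1 + z) / (1 - z)) := by
  have h1 := (hasSum_geometric_of_norm_lt_one hz).mul_left 2
  have h2 := h1.sub (hasSum_ite_eq (0 : ℕ) (1 : ℂ))
  have hz1 : 1 - z ≠ 0 := by
    intro h
    rw [← sub_eq_zero.1 h, norm_one] at hz
    exact lt_irrefl _ hz
  have h3 : 2 * (1 - z)⁻¹ - 1 = (1 + z) / (1 - z) := by
    field_simp
    ring
  rw [h3] at h2
  refine h2.congr_fun fun k => ?_
  rcases eq_or_ne k 0 with rfl | hk
  · norm_num [oneTwo]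
  · simp [oneTwo, hk]

/-- With w = r e^{is}, extend (1 + w)/(1 - w) by the conjugate of 1 - w; then |1 - w|² is the common
denominator of P and Q. -/
lemma PQ_eq {r : ℝ} (h0 : 0 ≤ r) (h1 : r < 1) (s : ℝ) :
    (P r s : ℂ) + I * Q r s = (1 + r * exp (s * I)) / (1 - r * exp (s * I)) := by
  have hden : ((1 - 2 * r * Real.cos s + r ^ 2 : ℝ) : ℂ) ≠ 0 :=
    ofReal_ne_zero.2 (den_ne h0 h1 s)
  have hcs : ((Real.sin s : ℝ) : ℂ) ^ 2 + ((Real.cos s : ℝ) : ℂ) ^ 2 = 1 := by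
    exact_mod_cast Real.sin_sq_add_cos_sq s
  have hI := I_sq
  have hprod : (1 - r * exp (s * I)) * (1 - r * (Real.cos s - Real.sin s * I)) =
      ((1 - 2 * r * Real.cos s + r ^ 2 : ℝ) : ℂ) := by
    rw [exp_mul_I, ← ofReal_cos, ← ofReal_sin]
    push_cast at hcs ⊢
    linear_combination (r : ℂ) ^ 2 * hcs - (r : ℂ) ^ 2 * Complex.sin s ^ 2 * hI
  have hne : 1 - r * exp (s * I) ≠ 0 := fun h => hden (by rw [← hprod, h, zero_mul])
  rw [P, Q, ofReal_div, ofReal_div, mul_div_assoc', ← add_div, div_eq_div_iff hden hne, ← hprod,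
    exp_mul_I, ← ofReal_cos, ← ofReal_sin]
  push_cast at hcs ⊢
  linear_combination (1 - r * (Complex.cos s + Complex.sin s * I)) *
    ((r : ℂ) ^ 2 * hcs - (r : ℂ) ^ 2 * Complex.sin s ^ 2 * hI)

lemma schwarzFun_zero_eq {z : ℂ} (hz : z ∈ disk) (t : ℝ) :
    schwarzFun 0 z t = (1 + z * (e (-1)).1 t) / (1 - z * (e (-1)).1 t) := by
  have hz' : ‖z‖ < 1 := by simpa [disk] using hz
  have h1 : (‖z‖ : ℂ) * exp (((z.arg - t : ℝ) : ℂ) * I) = z * (e (-1)).1 t := by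
    conv_rhs => rw [← norm_mul_exp_arg_mul_I z]
    rw [e_apply, mul_assoc, ← exp_add]
    push_cast
    ring_nf
  have h2 := PQ_eq (norm_nonneg z) hz' (z.arg - t)
  rw [h1] at h2
  rw [← h2, schwarzFun, pow_zero, mul_one]

lemma hasSum_schwarzTest {z : ℂ} (hz : z ∈ disk) (t : ℝ) :
    HasSum (fun k : ℕ => oneTwo k * z ^ k * (e (-(k : ℤ))).1 t) ((schwarzTest hz).1 t) := by
  have hz' : ‖z‖ < 1 := by simpa [disk] using hz
  have h := hasSum_oneTwo (z := z * (e (-1)).1 t) (by rw [norm_mul, norm_e, mul_one]; exact hz')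
  have h2 : ∀ k : ℕ, (z * (e (-1)).1 t) ^ k = z ^ k * (e (-(k : ℤ))).1 t := fun k => by
    rw [mul_pow, e_apply, e_apply, ← exp_nat_mul]
    push_cast
    ring_nf
  rw [← schwarzFun_zero_eq hz] at h
  simp only [h2, ← mul_assoc] at h
  exact h

lemma summable_schwarzTest {z : ℂ} (hz : z ∈ disk) :
    Summable fun k : ℕ => ‖oneTwo k * z ^ k‖ := polyBdd_oneTwo.summable_ps hz

lemma fc_schwarzTest {z : ℂ} (hz : z ∈ disk) (k : ℕ) :
    fc (-(k : ℤ)) (schwarzTest hz) = oneTwo k * z ^ k :=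
  fc_eq_of_hasSum (summable_schwarzTest hz) (m := fun k : ℕ => -(k : ℤ))
    (fun a b h => by simpa using h) (hasSum_schwarzTest hz) k

lemma fc_schwarzTest_of_pos {z : ℂ} (hz : z ∈ disk) {j : ℤ} (hj : 0 < j) :
    fc j (schwarzTest hz) = 0 :=
  fc_eq_zero_of_hasSum (summable_schwarzTest hz) (m := fun k : ℕ => -(k : ℤ))
    (hasSum_schwarzTest hz) (by
      rintro ⟨k, hk⟩
      simp only at hk
      lia)

/-- The Taylor coefficients of the Schwarz transform of `L`. -/
def schwarzCoeff (L : CircleTest →ₗ[ℂ] ℂ) (j : ℤ) : ℂ := oneTwo j * L (e (-j))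

lemma polyBdd_schwarzCoeff {L : CircleTest →ₗ[ℂ] ℂ} (hL : L ∈ bdd) :
    PolyBdd (schwarzCoeff L) := by
  obtain ⟨N, C, h⟩ := polyBdd_of_mem_bdd hL
  have hC : 0 ≤ C := by simpa using (norm_nonneg _).trans (h 0)
  refine ⟨N, 2 * C, fun j => ?_⟩
  rw [schwarzCoeff, norm_mul, mul_assoc]
  have h1 : ‖oneTwo j‖ ≤ 2 := by
    rw [oneTwo]
    split_ifs <;> simp
  gcongr
  simpa using h (-j)

/-- The Schwarz transform of a distribution is a power series. -/
lemma apply_schwarzTest {L : CircleTest →ₗ[ℂ] ℂ} (hL : L ∈ bdd) {z : ℂ} (hz : z ∈ disk) :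
    L (schwarzTest hz) = ps (schwarzCoeff L) z := by
  have h := hasSum_of_mem_bdd hL (schwarzTest hz)
  have hinj : Function.Injective fun k : ℕ => -(k : ℤ) := fun a b h => by simpa using h
  rw [← h.tsum_eq, ← hinj.tsum_eq, ps]
  · refine tsum_congr fun k => ?_
    rw [fc_schwarzTest, schwarzCoeff]
    ring
  · intro j hj
    by_cases h : j ≤ 0
    · exact ⟨j.natAbs, by simp only; lia⟩
    · rw [Function.mem_support, fc_schwarzTest_of_pos hz (not_le.1 h), zero_mul] at hj
      exact absurd rfl hj

lemma rePart_apply (L : CircleTest → ℂ) (φ : CircleTest) :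
    rePart L φ = (L φ + conj (L (conjTest φ))) / 2 := rfl

lemma conjTest_conjTest (φ : CircleTest) : conjTest (conjTest φ) = φ :=
  Subtype.ext (funext fun _ => conj_conj _)

lemma rePart_rePart (L : CircleTest → ℂ) : rePart (rePart L) = rePart L := by
  funext φ
  simp only [rePart_apply, conjTest_conjTest, map_div₀, map_add, conj_conj, map_ofNat]
  ring

/-- The real part of the boundary value of the Schwarz transform of a real distribution. -/
lemma rePart_hdist_schwarzCoeff {L : CircleTest →ₗ[ℂ] ℂ} (hL : L ∈ bdd) (hre : rePart L = L) :
    rePart (hdist (schwarzCoeff L) (polyBdd_schwarzCoeff hL)) = fun φ => 2 * Real.pi * L φ := by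
  have hconj : ∀ φ, conj (L (conjTest φ)) = L φ := fun φ => by
    have := congrFun hre φ
    rw [rePart_apply] at this
    linear_combination 2 * this
  have hconj' : ∀ j, conj (L (e j)) = L (e (-j)) := fun j => by
    rw [← hconj (e (-j)), conjTest_e, neg_neg]
  funext φ
  have h1 : HasSum (fun k : ℕ => 2 * Real.pi * (schwarzCoeff L k * fc (-k) φ))
      (hdist (schwarzCoeff L) (polyBdd_schwarzCoeff hL) φ) := by
    rw [hdist_apply]
    exact ((summable_mul_fc_neg (polyBdd_schwarzCoeff hL) φ).of_norm.mul_left _).hasSum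
  have h2 : HasSum (fun k : ℕ => 2 * Real.pi * (schwarzCoeff L k * fc (-k) (conjTest φ)))
      (hdist (schwarzCoeff L) (polyBdd_schwarzCoeff hL) (conjTest φ)) := by
    rw [hdist_apply]
    exact ((summable_mul_fc_neg (polyBdd_schwarzCoeff hL) _).of_norm.mul_left _).hasSum
  have h3 := (h1.add (hasSum_conj'.2 h2)).mul_left (1 / (4 * Real.pi) : ℂ)
  have hp : (Real.pi : ℂ) ≠ 0 := by exact_mod_cast Real.pi_ne_zero
  have h4 := (hasSum_of_mem_bdd hL φ).nat_add_neg
  -- The conjugate term supplies the frequency k that the power series lacks, and the coefficient 2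
  -- for k ≥ 1 makes up for the halving in the real part. Folding the sum over ℤ at 0 counts the
  -- index 0 twice, hence the subtracted term.
  have h6 : ∀ k : ℕ, 1 / (4 * Real.pi) * (2 * Real.pi * (schwarzCoeff L k * fc (-k) φ) +
      conj (2 * Real.pi * (schwarzCoeff L k * fc (-k) (conjTest φ)))) =
      (fc k φ * L (e k) + fc (-k) φ * L (e (-k))) -
        if k = 0 then fc 0 φ * L (e 0) else 0 := by
    intro k
    rw [schwarzCoeff, fc_conjTest, neg_neg]
    simp only [map_mul, conj_conj, hconj', neg_neg, map_ofNat, conj_ofReal]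
    rcases eq_or_ne k 0 with rfl | hk
    · simp [oneTwo]
      field_simp
      ring
    · simp [oneTwo, hk, map_ofNat (starRingEnd ℂ) 2]
      field_simp
      ring
  simp only [h6] at h3
  have h7 := h3.unique (h4.sub (hasSum_ite_eq (0 : ℕ) (fc 0 φ * L (e 0))))
  rw [add_sub_cancel_right] at h7
  rw [rePart_apply, ← h7]
  field_simp
  norm_num

lemma poisson_eq {z : ℂ} (hz : z ∈ disk) :
    (⟨poissonFun z, poisson_mem hz⟩ : CircleTest) =
      (1 / 2 : ℂ) • (schwarzTest hz + conjTest (schwarzTest hz)) := by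
  apply Subtype.ext
  funext t
  change (P ‖z‖ (z.arg - t) : ℂ) = 1 / 2 * (schwarzFun 0 z t + conj (schwarzFun 0 z t))
  simp only [schwarzFun, pow_zero, mul_one, map_add, map_mul, conj_ofReal, conj_I]
  ring

lemma fc_poisson {z : ℂ} (hz : z ∈ disk) (k : ℕ) :
    fc (-(k : ℤ)) ⟨poissonFun z, poisson_mem hz⟩ = z ^ k := by
  rw [poisson_eq hz, map_smul, map_add, fc_conjTest, neg_neg, fc_schwarzTest hz]
  rcases Nat.eq_zero_or_pos k with rfl | hk
  · have := fc_schwarzTest hz 0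
    simp only [CharP.cast_eq_zero, neg_zero] at this ⊢
    rw [this]
    norm_num [oneTwo]
  · rw [fc_schwarzTest_of_pos hz (by exact_mod_cast hk)]
    simp [oneTwo, hk.ne']

/-- The Poisson integral of the boundary value of a holomorphic function. -/
lemma hdist_poisson {b : ℤ → ℂ} (hb : PolyBdd b) {z : ℂ} (hz : z ∈ disk) :
    hdist b hb ⟨poissonFun z, poisson_mem hz⟩ = 2 * Real.pi * ps b z := by
  rw [hdist_apply, tsum_mul_left, ps]
  simp only [fc_poisson hz]

lemma pair_of_mem (Λ : CircleTest → ℂ) {φ : ℝ → ℂ} (h : φ ∈ CircleTest) :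
    pair Λ φ = Λ ⟨φ, h⟩ := dif_pos h

/-! ### Calculus of `∂/∂z̄` -/

lemma dbar_congr {u v : ℂ → ℂ} {z : ℂ} (h : u =ᶠ[𝓝 z] v) : dbar u z = dbar v z := by
  rw [dbar, dbar, h.fderiv_eq]

lemma dbar_eq_of_eqOn {u v : ℂ → ℂ} (h : EqOn u v disk) {z : ℂ} (hz : z ∈ disk) :
    dbar u z = dbar v z := dbar_congr (h.eventuallyEq_of_mem (isOpen_disk.mem_nhds hz))

lemma dbar_of_hasFDerivAt {u : ℂ → ℂ} {u' : ℂ →L[ℝ] ℂ} {z : ℂ} (h : HasFDerivAt u u' z) :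
    dbar u z = (1 / 2) * (u' 1 + I * u' I) := by rw [dbar, h.fderiv]

lemma dbar_add {u v : ℂ → ℂ} {z : ℂ} (hu : DifferentiableAt ℝ u z)
    (hv : DifferentiableAt ℝ v z) : dbar (fun z => u z + v z) z = dbar u z + dbar v z := by
  rw [dbar_of_hasFDerivAt (hu.hasFDerivAt.fun_add hv.hasFDerivAt), dbar, dbar]
  simp only [_root_.add_apply]
  ring

lemma dbar_mul {u v : ℂ → ℂ} {z : ℂ} (hu : DifferentiableAt ℝ u z)
    (hv : DifferentiableAt ℝ v z) :
    dbar (fun z => u z * v z) z = dbar u z * v z + u z * dbar v z := by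
  rw [dbar_of_hasFDerivAt (hu.hasFDerivAt.fun_mul hv.hasFDerivAt), dbar, dbar]
  simp only [_root_.add_apply, _root_.smul_apply, smul_eq_mul]
  ring

lemma dbar_const (c z : ℂ) : dbar (fun _ => c) z = 0 := by
  simp [dbar]

lemma dbar_const_mul {u : ℂ → ℂ} {z : ℂ} (c : ℂ) (hu : DifferentiableAt ℝ u z) :
    dbar (fun z => c * u z) z = c * dbar u z := by
  rw [dbar_mul (differentiableAt_const c) hu, dbar_const]
  ring

lemma dbar_sum {ι : Type*} (s : Finset ι) {u : ι → ℂ → ℂ} {z : ℂ}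
    (hu : ∀ i ∈ s, DifferentiableAt ℝ (u i) z) :
    dbar (fun z => ∑ i ∈ s, u i z) z = ∑ i ∈ s, dbar (u i) z := by
  classical
  induction s using Finset.induction_on with
  | empty => simpa using dbar_const 0 z
  | insert i s hi ih =>
    simp only [Finset.sum_insert hi]
    have h := fun j hj => hu j (Finset.mem_insert_of_mem hj)
    rw [dbar_add (hu i (Finset.mem_insert_self _ _)) (DifferentiableAt.fun_sum h), ih h]

lemma dbar_of_differentiableAt {u : ℂ → ℂ} {z : ℂ} (hu : DifferentiableAt ℂ u z) :
    dbar u z = 0 := by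
  rw [dbar_of_hasFDerivAt (hu.hasFDerivAt.restrictScalars ℝ)]
  have h := (fderiv ℂ u z).map_smul I 1
  simp only [smul_eq_mul, mul_one] at h
  simp only [ContinuousLinearMap.coe_restrictScalars', h]
  linear_combination (1 / 2) * (fderiv ℂ u z) 1 * I_sq

lemma hasFDerivAt_X (z : ℂ) :
    HasFDerivAt X (ContinuousLinearMap.id ℝ ℂ + (conjCLE : ℂ →L[ℝ] ℂ)) z :=
  (hasFDerivAt_id z).add conjCLE.hasFDerivAt

lemma contDiff_X : ContDiff ℝ ∞ X := contDiff_id.add conjCLE.contDiff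

/-- This lets the real function X replace z̄ in polyanalytic expansions. -/
lemma dbar_X (z : ℂ) : dbar X z = 1 := by
  rw [dbar_of_hasFDerivAt (hasFDerivAt_X z)]
  simp
  linear_combination -(1 / 2) * I_sq + 1 / 2 * I_sq

lemma differentiableAt_X_pow (k : ℕ) (z : ℂ) : DifferentiableAt ℝ (fun z => X z ^ k) z :=
  (hasFDerivAt_X z).differentiableAt.pow k

lemma dbar_X_pow_succ (k : ℕ) (z : ℂ) :
    dbar (fun z => X z ^ (k + 1)) z = (k + 1) * X z ^ k := by
  induction k with
  | zero => simpa using dbar_X z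
  | succ k ih =>
    have : (fun z => X z ^ (k + 1 + 1)) = fun z => X z ^ (k + 1) * X z :=
      funext fun z => pow_succ _ _
    rw [this, dbar_mul (differentiableAt_X_pow _ z) (hasFDerivAt_X z).differentiableAt, ih, dbar_X]
    push_cast
    ring

/-- The function `X ^ i / i!`. -/
def Xf (i : ℕ) (z : ℂ) : ℂ := (i.factorial : ℂ)⁻¹ * X z ^ i

lemma differentiableAt_Xf (i : ℕ) (z : ℂ) : DifferentiableAt ℝ (Xf i) z :=
  (differentiableAt_X_pow i z).const_mul _

lemma dbar_Xf_zero (z : ℂ) : dbar (Xf 0) z = 0 := by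
  have : Xf 0 = fun _ => 1 := funext fun z => by simp [Xf]
  rw [this, dbar_const]

lemma dbar_Xf_succ (i : ℕ) (z : ℂ) : dbar (Xf (i + 1)) z = Xf i z := by
  have h := dbar_const_mul ((i + 1).factorial : ℂ)⁻¹ (differentiableAt_X_pow (i + 1) z)
  rw [dbar_X_pow_succ] at h
  change dbar (fun z => ((i + 1).factorial : ℂ)⁻¹ * X z ^ (i + 1)) z = _
  rw [h, Xf, Nat.factorial_succ]
  have h1 : (i.factorial : ℂ) ≠ 0 := by exact_mod_cast i.factorial_ne_zero
  have h2 : (i + 1 : ℂ) ≠ 0 := by exact_mod_cast i.succ_ne_zero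
  push_cast
  field_simp

/-! ### Polyanalytic functions -/

/-- `∑_{i + j = m} X^i / i! · H j`. -/
def appell (H : ℕ → ℂ → ℂ) (m : ℕ) (z : ℂ) : ℂ :=
  ∑ p ∈ Finset.HasAntidiagonal.antidiagonal m, Xf p.1 z * H p.2 z

lemma appell_zero (H : ℕ → ℂ → ℂ) (z : ℂ) : appell H 0 z = H 0 z := by
  simp [appell, Xf]

/-- Every term with i > 0 contains a positive power of X(0) = 0. This decouples the conditions at
the origin. -/
lemma appell_at_zero (H : ℕ → ℂ → ℂ) (m : ℕ) : appell H m 0 = H m 0 := by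
  rw [appell, Finset.sum_eq_single (0, m)]
  · simp [Xf]
  · rintro ⟨i, j⟩ hp hne
    have h1 := Finset.HasAntidiagonal.mem_antidiagonal.1 hp
    have h2 : i ≠ 0 := by
      rintro rfl
      exact hne (by simpa using h1)
    simp [Xf, X, h2]
  · simp

lemma appell_add (H H' : ℕ → ℂ → ℂ) (m : ℕ) (z : ℂ) :
    appell (fun j z => H j z + H' j z) m z = appell H m z + appell H' m z := by
  simp only [appell, mul_add, Finset.sum_add_distrib]

lemma appell_const_mul (c : ℂ) (H : ℕ → ℂ → ℂ) (m : ℕ) (z : ℂ) :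
    appell (fun j z => c * H j z) m z = c * appell H m z := by
  simp only [appell, Finset.mul_sum]
  exact Finset.sum_congr rfl fun p _ => by ring

lemma appell_congr {H H' : ℕ → ℂ → ℂ} {z : ℂ} {m : ℕ} (h : ∀ j ≤ m, H j z = H' j z) :
    appell H m z = appell H' m z :=
  Finset.sum_congr rfl fun p hp => by
    rw [h p.2 (by have := Finset.HasAntidiagonal.mem_antidiagonal.1 hp; lia)]

lemma differentiableAt_appell {H : ℕ → ℂ → ℂ} {z : ℂ} (hH : ∀ j, DifferentiableAt ℂ (H j) z)
    (m : ℕ) : DifferentiableAt ℝ (appell H m) z :=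
  DifferentiableAt.fun_sum fun p _ =>
    (differentiableAt_Xf p.1 z).mul ((hH p.2).restrictScalars ℝ)

lemma dbar_appell_zero {H : ℕ → ℂ → ℂ} {z : ℂ} (hH : ∀ j, DifferentiableAt ℂ (H j) z) :
    dbar (appell H 0) z = 0 := by
  have : appell H 0 = H 0 := funext (appell_zero H)
  rw [this, dbar_of_differentiableAt (hH 0)]

/-- The operator does not see the holomorphic factors and lowers X^i/i! to X^(i-1)/(i-1)!; the term
i = 0 drops out. -/
lemma dbar_appell_succ {H : ℕ → ℂ → ℂ} {z : ℂ} (hH : ∀ j, DifferentiableAt ℂ (H j) z) (m : ℕ) :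
    dbar (appell H (m + 1)) z = appell H m z := by
  have hd : ∀ p : ℕ × ℕ, DifferentiableAt ℝ (fun z => Xf p.1 z * H p.2 z) z := fun p =>
    (differentiableAt_Xf p.1 z).mul ((hH p.2).restrictScalars ℝ)
  have hp : ∀ p : ℕ × ℕ, dbar (fun z => Xf p.1 z * H p.2 z) z = dbar (Xf p.1) z * H p.2 z := by
    intro p
    rw [dbar_mul (differentiableAt_Xf p.1 z) ((hH p.2).restrictScalars ℝ),
      dbar_of_differentiableAt (hH p.2), mul_zero, add_zero]
  have h1 := dbar_sum (Finset.HasAntidiagonal.antidiagonal (m + 1)) (u := fun p z => Xf p.1 z * H p.2 z)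
    fun p _ => hd p
  change dbar (fun z => ∑ p ∈ Finset.HasAntidiagonal.antidiagonal (m + 1), Xf p.1 z * H p.2 z) z = _
  rw [h1, Finset.Nat.antidiagonal_succ, Finset.sum_cons, Finset.sum_map, hp, dbar_Xf_zero, zero_mul,
    zero_add, appell]
  refine Finset.sum_congr rfl fun p _ => ?_
  have := hp (p.1 + 1, p.2)
  rw [dbar_Xf_succ] at this
  exact this

lemma contDiffOn_appell {H : ℕ → ℂ → ℂ} (hH : ∀ j, DifferentiableOn ℂ (H j) disk) (m : ℕ) :
    ContDiffOn ℝ ∞ (appell H m) disk :=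
  ContDiffOn.sum fun p _ => (contDiff_const.mul (contDiff_X.pow p.1)).contDiffOn.mul
    (((hH p.2).contDiffOn isOpen_disk).restrict_scalars ℝ)

/-- The binomial theorem in terms of divided powers. -/
lemma divided_pow_sub (m : ℕ) (x y : ℂ) :
    (-1) ^ m / (m.factorial : ℂ) * (y - x) ^ m = ∑ p ∈ Finset.HasAntidiagonal.antidiagonal m,
      (p.1.factorial : ℂ)⁻¹ * x ^ p.1 * ((-1) ^ p.2 / (p.2.factorial : ℂ) * y ^ p.2) := by
  have h := (Commute.all x (-y)).add_pow' m
  have h1 : (-1) ^ m * (y - x) ^ m = (x + -y) ^ m := by rw [← mul_pow]; ring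
  rw [div_mul_eq_mul_div, h1, h, Finset.sum_div]
  refine Finset.sum_congr rfl fun p hp => ?_
  have h2 := Finset.HasAntidiagonal.mem_antidiagonal.1 hp
  have h3 := Nat.add_choose_mul_factorial_mul_factorial p.1 p.2
  rw [h2, ← Nat.choose_symm_of_eq_add h2.symm] at h3
  have h4 : (m.choose p.1 : ℂ) * p.1.factorial * p.2.factorial = m.factorial := by
    exact_mod_cast h3
  have f1 : (p.1.factorial : ℂ) ≠ 0 := by exact_mod_cast p.1.factorial_ne_zero
  have f2 : (p.2.factorial : ℂ) ≠ 0 := by exact_mod_cast p.2.factorial_ne_zero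
  have f3 : (m.factorial : ℂ) ≠ 0 := by exact_mod_cast m.factorial_ne_zero
  rw [nsmul_eq_mul, neg_pow y]
  field_simp
  rw [← h4]
  ring

lemma rePart_sum {ι : Type*} (s : Finset ι) (L : ι → CircleTest →ₗ[ℂ] ℂ) (φ : CircleTest) :
    rePart (∑ i ∈ s, L i : CircleTest →ₗ[ℂ] ℂ) φ = ∑ i ∈ s, rePart (L i) φ := by
  simp only [rePart_apply, LinearMap.sum_apply, map_sum, ← Finset.sum_add_distrib, Finset.sum_div]

lemma rePart_add (L L' : CircleTest →ₗ[ℂ] ℂ) (φ : CircleTest) :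
    rePart (L + L' : CircleTest →ₗ[ℂ] ℂ) φ = rePart L φ + rePart L' φ := by
  simp only [rePart_apply, LinearMap.add_apply, map_add]
  ring

lemma rePart_smul {c : ℂ} (hc : conj c = c) (L : CircleTest →ₗ[ℂ] ℂ) (φ : CircleTest) :
    rePart (c • L : CircleTest →ₗ[ℂ] ℂ) φ = c * rePart L φ := by
  simp only [rePart_apply, LinearMap.smul_apply, smul_eq_mul, map_mul, hc]
  ring

lemma rePart_comp_M_pow (L : CircleTest →ₗ[ℂ] ℂ) (k : ℕ) (φ : CircleTest) :
    rePart (L ∘ₗ M ^ k : CircleTest →ₗ[ℂ] ℂ) φ = rePart L ((M ^ k) φ) := by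
  simp only [rePart_apply, LinearMap.comp_apply, conjTest_M_pow]

/-- Boundary values of polyanalytic functions. -/
lemma bv_appell {R : Set ℝ} {H : ℕ → ℂ → ℂ} {ρ : CircleTest → ℂ} {m : ℕ}
    (hH : ∀ j ≤ m, ∃ L, BV R (H j) L ∧
      ∀ φ, rePart L φ = (-1) ^ j / (j.factorial : ℂ) * ρ ((M ^ j) φ)) :
    ∃ L, BV R (appell H m) L ∧ ∀ φ, rePart L φ = if m = 0 then ρ φ else 0 := by
  choose! L hL hre using hH
  have hle : ∀ p ∈ Finset.HasAntidiagonal.antidiagonal m, p.2 ≤ m := fun p hp => by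
    have := Finset.HasAntidiagonal.mem_antidiagonal.1 hp
    lia
  refine ⟨∑ p ∈ Finset.HasAntidiagonal.antidiagonal m, (p.1.factorial : ℂ)⁻¹ • (L p.2 ∘ₗ M ^ p.1), ?_, ?_⟩
  · refine BV.sum _ fun p hp => ?_
    simp only [Xf, mul_assoc]
    exact ((hL p.2 (hle p hp)).X_pow_mul p.1).const_mul _
  · intro φ
    -- All the multiplications by 2 cos combine to `M ^ m`. The remaining scalars are written with
    -- powers of 1 so that they match the binomial expansion of (1 - 1)^m up to the factor
    -- (-1)^m/m!.
    have h1 : ∀ p ∈ Finset.HasAntidiagonal.antidiagonal m,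
        rePart ((p.1.factorial : ℂ)⁻¹ • (L p.2 ∘ₗ M ^ p.1) : CircleTest →ₗ[ℂ] ℂ) φ =
        (p.1.factorial : ℂ)⁻¹ * 1 ^ p.1 * ((-1) ^ p.2 / (p.2.factorial : ℂ) * 1 ^ p.2) *
          ρ ((M ^ m) φ) := by
      intro p hp
      rw [rePart_smul (by simp), rePart_comp_M_pow, hre p.2 (hle p hp), ← Module.End.mul_apply,
        ← pow_add, add_comm p.2, Finset.HasAntidiagonal.mem_antidiagonal.1 hp]
      ring
    rw [rePart_sum, Finset.sum_congr rfl h1, ← Finset.sum_mul, ← divided_pow_sub]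
    split_ifs with hm
    · subst hm
      simp
    · simp [hm]

/-- The Schwarz transform of order `l` of a distribution. -/
lemma apply_schwarzFun (L : CircleTest →ₗ[ℂ] ℂ) (l : ℕ) {z : ℂ} (hz : z ∈ disk) :
    (-1) ^ l / (l.factorial : ℂ) * L ⟨schwarzFun l z, schwarz_mem l hz⟩ =
      appell (fun j z => (-1) ^ j / (j.factorial : ℂ) *
        pair (L ∘ₗ M ^ j : CircleTest →ₗ[ℂ] ℂ) (schwarzFun 0 z)) l z := by
  -- Expand (2 cos t - X z)^l inside the kernel: powers of 2 cos t become powers of `M`, and powers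
  -- of X z are constants in t.
  have h1 : ((-1) ^ l / (l.factorial : ℂ)) • (⟨schwarzFun l z, schwarz_mem l hz⟩ : CircleTest) =
      ∑ p ∈ Finset.HasAntidiagonal.antidiagonal l, ((p.1.factorial : ℂ)⁻¹ * X z ^ p.1 *
        ((-1) ^ p.2 / (p.2.factorial : ℂ))) • (M ^ p.2) (schwarzTest hz) := by
    apply Subtype.ext
    funext t
    rw [Submodule.coe_sum, Finset.sum_apply]
    change (-1) ^ l / (l.factorial : ℂ) * schwarzFun l z t =
      ∑ p ∈ Finset.HasAntidiagonal.antidiagonal l, ((p.1.factorial : ℂ)⁻¹ * X z ^ p.1 *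
        ((-1) ^ p.2 / (p.2.factorial : ℂ))) * ((M ^ p.2) (schwarzTest hz)).1 t
    have h2 : schwarzFun l z t = schwarzFun 0 z t * ((2 * Real.cos t : ℝ) - X z) ^ l := by
      have h3 : exp (t * I) - z + conj (exp (t * I) - z) = (2 * Real.cos t : ℝ) - X z := by
        have := X_circleMap 1 t
        simp only [X, circleMap, zero_add, ofReal_one, one_mul] at this
        rw [← this, X, map_sub]
        ring
      rw [schwarzFun, schwarzFun, pow_zero, mul_one, h3]
    rw [h2, mul_left_comm, divided_pow_sub, Finset.mul_sum]
    refine Finset.sum_congr rfl fun p _ => ?_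
    rw [M_pow_apply]
    change schwarzFun 0 z t * _ = _ * (_ * schwarzFun 0 z t)
    ring
  have h2 := congrArg L h1
  rw [map_smul, map_sum, smul_eq_mul] at h2
  rw [h2, appell]
  refine Finset.sum_congr rfl fun p _ => ?_
  rw [map_smul, smul_eq_mul, pair_of_mem _ (schwarz_mem 0 hz), Xf, mul_assoc]
  rfl

/-! ### Weak derivatives -/

lemma integrableOn_mul_test {u φ : ℂ → ℂ} (hu : LocallyIntegrableOn u disk) (hφ : Continuous φ)
    (hc : HasCompactSupport φ) (hs : tsupport φ ⊆ disk) :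
    IntegrableOn (fun z => u z * φ z) disk := by
  have h1 : IntegrableOn (fun z => u z * φ z) (tsupport φ) :=
    (hu.integrableOn_compact_subset hs hc.isCompact).mul_continuousOn hφ.continuousOn hc.isCompact
  have h2 : Function.support (fun z => u z * φ z) ⊆ tsupport φ := fun z hz =>
    subset_tsupport φ (fun h => hz (by simp [h]))
  exact ((integrableOn_iff_integrable_of_support_subset h2).1 h1).integrableOn

lemma contDiff_dbar {φ : ℂ → ℂ} (hφ : ContDiff ℝ ∞ φ) : ContDiff ℝ ∞ (dbar φ) := by
  have h : ContDiff ℝ ∞ (fderiv ℝ φ) := hφ.fderiv_right (by simp)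
  exact contDiff_const.mul ((h.clm_apply contDiff_const).add
    (contDiff_const.mul (h.clm_apply contDiff_const)))

lemma tsupport_dbar_subset (φ : ℂ → ℂ) : tsupport (dbar φ) ⊆ tsupport φ := by
  refine closure_minimal (fun z hz => ?_) (isClosed_tsupport φ)
  by_contra h
  apply hz
  have h1 : φ =ᶠ[𝓝 z] fun _ => 0 := notMem_tsupport_iff_eventuallyEq.1 h
  rw [dbar_congr h1, dbar_const]

lemma hasCompactSupport_dbar {φ : ℂ → ℂ} (hφ : HasCompactSupport φ) :
    HasCompactSupport (dbar φ) := hφ.mono' ((subset_tsupport _).trans (tsupport_dbar_subset φ))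

lemma dbar_iterate_test {φ : ℂ → ℂ} (h1 : ContDiff ℝ ∞ φ) (h2 : HasCompactSupport φ)
    (h3 : tsupport φ ⊆ disk) (m : ℕ) :
    ContDiff ℝ ∞ (dbar^[m] φ) ∧ HasCompactSupport (dbar^[m] φ) ∧ tsupport (dbar^[m] φ) ⊆ disk := by
  induction m with
  | zero => exact ⟨h1, h2, h3⟩
  | succ m ih =>
    rw [Function.iterate_succ_apply']
    exact ⟨contDiff_dbar ih.1, hasCompactSupport_dbar ih.2.1,
      (tsupport_dbar_subset _).trans ih.2.2⟩

lemma IsWeakDbar.trans {m : ℕ} {u v w : ℂ → ℂ} (h : IsWeakDbar m u v) (h' : IsWeakDbar 1 v w) :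
    IsWeakDbar (m + 1) u w := by
  refine ⟨h.1, h'.2.1, fun φ h1 h2 h3 => ?_⟩
  obtain ⟨k1, k2, k3⟩ := dbar_iterate_test h1 h2 h3 1
  have e1 := h.2.2 _ k1 k2 k3
  have e2 := h'.2.2 φ h1 h2 h3
  rw [Function.iterate_one] at e1 e2
  rw [Function.iterate_succ_apply, e1, e2]
  ring

lemma IsWeakDbar.zero_refl {u : ℂ → ℂ} (h : LocallyIntegrableOn u disk) : IsWeakDbar 0 u u :=
  ⟨h, h, fun φ _ _ _ => by simp⟩

lemma IsWeakDbar.add {m : ℕ} {u v u' v' : ℂ → ℂ} (h : IsWeakDbar m u v)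
    (h' : IsWeakDbar m u' v') : IsWeakDbar m (fun z => u z + u' z) (fun z => v z + v' z) := by
  refine ⟨h.1.add h'.1, h.2.1.add h'.2.1, fun φ h1 h2 h3 => ?_⟩
  obtain ⟨k1, k2, k3⟩ := dbar_iterate_test h1 h2 h3 m
  simp only [add_mul]
  rw [integral_add (integrableOn_mul_test h.1 k1.continuous k2 k3)
    (integrableOn_mul_test h'.1 k1.continuous k2 k3),
    integral_add (integrableOn_mul_test h.2.1 h1.continuous h2 h3)
    (integrableOn_mul_test h'.2.1 h1.continuous h2 h3), h.2.2 φ h1 h2 h3, h'.2.2 φ h1 h2 h3]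
  ring

lemma locallyIntegrableOn_congr_ae {u v : ℂ → ℂ} (h : LocallyIntegrableOn u disk)
    (huv : u =ᵐ[volume.restrict disk] v) : LocallyIntegrableOn v disk := by
  rw [locallyIntegrableOn_iff isOpen_disk.isLocallyClosed] at h ⊢
  intro k hk hc
  exact (h k hk hc).congr (ae_restrict_of_ae_restrict_of_subset hk huv)

lemma IsWeakDbar.congr {m : ℕ} {u v u' v' : ℂ → ℂ} (h : IsWeakDbar m u v)
    (hu : u =ᵐ[volume.restrict disk] u') (hv : v =ᵐ[volume.restrict disk] v') :
    IsWeakDbar m u' v' := by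
  refine ⟨locallyIntegrableOn_congr_ae h.1 hu, locallyIntegrableOn_congr_ae h.2.1 hv,
    fun φ h1 h2 h3 => ?_⟩
  have e := h.2.2 φ h1 h2 h3
  have e1 : ∫ z in disk, u z * dbar^[m] φ z = ∫ z in disk, u' z * dbar^[m] φ z :=
    integral_congr_ae (by filter_upwards [hu] with z hz; rw [hz])
  have e2 : ∫ z in disk, v z * φ z = ∫ z in disk, v' z * φ z :=
    integral_congr_ae (by filter_upwards [hv] with z hz; rw [hz])
  rw [← e1, ← e2, e]

lemma integral_dbar_eq_zero {ψ : ℂ → ℂ} (h1 : ContDiff ℝ 1 ψ) (h2 : HasCompactSupport ψ) :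
    ∫ z, dbar ψ z = 0 := by
  have hd : Continuous (fderiv ℝ ψ) := h1.continuous_fderiv one_ne_zero
  have hint : ∀ v : ℂ, Integrable fun z => fderiv ℝ ψ z v := fun v =>
    Continuous.integrable_of_hasCompactSupport (hd.clm_apply continuous_const)
      ((h2.fderiv ℝ).comp_left (g := fun A : ℂ →L[ℝ] ℂ => A v) (by simp))
  have hz : ∀ v : ℂ, ∫ z, fderiv ℝ ψ z v = 0 := fun v => by
    have := integral_mul_fderiv_eq_neg_fderiv_mul_of_integrable (μ := volume)
      (f := ψ) (g := fun _ => (1 : ℂ)) (v := v) (by simpa using hint v) (by simp)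
      (by simpa using h1.continuous.integrable_of_hasCompactSupport h2)
      (fun x _ => (h1.differentiable one_ne_zero).differentiableAt) (fun _ _ => by fun_prop)
    simpa using this
  simp only [dbar]
  rw [integral_const_mul, integral_add (hint 1) ((hint I).const_mul I), integral_const_mul, hz, hz]
  simp

lemma isWeakDbar_of_contDiffOn {u : ℂ → ℂ} (hu : ContDiffOn ℝ ∞ u disk) :
    IsWeakDbar 1 u (dbar u) := by
  have hfd : ContinuousOn (fderiv ℝ u) disk := hu.continuousOn_fderiv_of_isOpen isOpen_disk (by simp)
  have hdb : ContinuousOn (dbar u) disk := continuousOn_const.mul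
    ((hfd.clm_apply continuousOn_const).add
      (continuousOn_const.mul (hfd.clm_apply continuousOn_const)))
  have l1 : LocallyIntegrableOn u disk :=
    hu.continuousOn.locallyIntegrableOn isOpen_disk.measurableSet
  have l2 : LocallyIntegrableOn (dbar u) disk := hdb.locallyIntegrableOn isOpen_disk.measurableSet
  refine ⟨l1, l2, fun φ h1 h2 h3 => ?_⟩
  -- Although u is smooth only on the disk, u φ is smooth on the plane since φ vanishes near every
  -- point outside. The integral of its ∂̄-derivative is therefore 0, and the product rule finishes.
  have hψ : ContDiff ℝ 1 fun z => u z * φ z := by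
    rw [contDiff_iff_contDiffAt]
    intro z
    by_cases hz : z ∈ disk
    · exact ((hu.contDiffAt (isOpen_disk.mem_nhds hz)).of_le (by simp)).mul
        (h1.contDiffAt.of_le (by simp))
    · have h4 : φ =ᶠ[𝓝 z] fun _ => 0 :=
        notMem_tsupport_iff_eventuallyEq.1 fun h => hz (h3 h)
      refine contDiffAt_const (c := (0 : ℂ)) |>.congr_of_eventuallyEq ?_
      filter_upwards [h4] with w hw
      rw [hw, mul_zero]
  have hc : HasCompactSupport fun z => u z * φ z := h2.mul_left
  have h0 := integral_dbar_eq_zero hψ hc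
  have hsupp : Function.support (dbar fun z => u z * φ z) ⊆ disk := by
    refine (subset_tsupport _).trans ((tsupport_dbar_subset _).trans ?_)
    exact (tsupport_mul_subset_right).trans h3
  rw [← setIntegral_eq_integral_of_forall_compl_eq_zero (s := disk) fun z hz => by
    by_contra h
    exact hz (hsupp h)] at h0
  have h5 : ∫ z in disk, dbar (fun z => u z * φ z) z =
      ∫ z in disk, (dbar u z * φ z + u z * dbar φ z) := by
    refine setIntegral_congr_fun isOpen_disk.measurableSet fun z hz => ?_
    exact dbar_mul ((hu.contDiffAt (isOpen_disk.mem_nhds hz)).differentiableAt (by simp))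
      (h1.differentiable (by simp)).differentiableAt
  rw [h5, integral_add (integrableOn_mul_test l2 h1.continuous h2 h3)
    (integrableOn_mul_test l1 (contDiff_dbar h1).continuous (hasCompactSupport_dbar h2)
      ((tsupport_dbar_subset _).trans h3))] at h0
  rw [Function.iterate_one, pow_one]
  linear_combination h0

/-! ### The Cauchy–Pompeiu formula -/

lemma integrableOn_inv_ball (r : ℝ) : IntegrableOn (fun u : ℂ => u⁻¹) (Metric.ball 0 r) := by
  refine integrableOn_ball_of_norm_le_rpow (C := 1) (α := 1) (by simp) (by simp)
    (Eventually.of_forall fun u => ?_) (by fun_prop)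
  rw [norm_inv, Real.rpow_neg_one, one_mul]

/-- The polar representation of a point of the plane. -/
lemma polarCoord_symm_eq (p : ℝ × ℝ) :
    Complex.polarCoord.symm p = p.1 * exp (p.2 * I) := by
  rw [Complex.polarCoord_symm_apply, exp_mul_I, ofReal_cos, ofReal_sin]

lemma integrableOn_polar_of_support {a : ℝ × ℝ → ℂ} (ha : Continuous a) {r : ℝ}
    (hr : ∀ p : ℝ × ℝ, r < p.1 → a p = 0) :
    IntegrableOn a (Ioi (0 : ℝ) ×ˢ Ioo (-Real.pi) Real.pi) := by
  have h1 : IntegrableOn a (Icc 0 r ×ˢ Icc (-Real.pi) Real.pi) :=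
    ha.continuousOn.integrableOn_compact (isCompact_Icc.prod isCompact_Icc)
  refine h1.of_forall_sdiff_eq_zero (measurableSet_Ioi.prod measurableSet_Ioo) fun p hp => ?_
  refine hr p ?_
  by_contra! h
  exact hp.2 ⟨⟨(mem_Ioi.1 hp.1.1).le, h⟩, Ioo_subset_Icc_self hp.1.2⟩

/-- The polar form 2∂/∂z̄ = e^{iα}(∂_ρ + (i/ρ)∂_α). The combination A v + i A(i v) isolates the
antilinear part of A, which turns v = e^{iα} into a factor e^{-iα}. -/
lemma fderiv_polar (A : ℂ →L[ℝ] ℂ) (α : ℝ) :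
    A (exp (α * I)) + I * A (I * exp (α * I)) = exp (-(α * I)) * (A 1 + I * A I) := by
  have h1 : exp (α * I) = Real.cos α • (1 : ℂ) + Real.sin α • I := by
    rw [exp_mul_I, real_smul, real_smul]
    push_cast
    ring
  have h2 : I * exp (α * I) = Real.cos α • I - Real.sin α • (1 : ℂ) := by
    rw [h1, real_smul, real_smul, real_smul, real_smul]
    linear_combination (Real.sin α : ℂ) * I_sq
  have h3 : exp (-(α * I)) = Real.cos α - Real.sin α * I := by
    rw [← neg_mul, exp_mul_I, Complex.cos_neg, Complex.sin_neg]
    push_cast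
    ring
  rw [h2, h1, h3, map_sub, map_add, map_smul, map_smul, map_smul, map_smul]
  simp only [real_smul]
  linear_combination (Real.sin α : ℂ) * A I * I_sq

/-- The Cauchy–Pompeiu formula for functions with compact support, at the origin. -/
lemma integral_dbar_mul_inv {ψ : ℂ → ℂ} (h1 : ContDiff ℝ 1 ψ) (h2 : HasCompactSupport ψ) :
    ∫ u, dbar ψ u * u⁻¹ = -(Real.pi * ψ 0) := by
  have hd : Continuous (fderiv ℝ ψ) := h1.continuous_fderiv one_ne_zero
  obtain ⟨r, hr⟩ := h2.isBounded.subset_closedBall 0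
  have hfz : ∀ u : ℂ, r < ‖u‖ → fderiv ℝ ψ u = 0 := fun u hu => by
    have : ψ =ᶠ[𝓝 u] fun _ => 0 := notMem_tsupport_iff_eventuallyEq.1 fun h => by
      have := hr h
      rw [mem_closedBall_zero_iff] at this
      linarith
    rw [this.fderiv_eq]
    simp
  let q : ℝ × ℝ → ℂ := fun p => p.1 * exp (p.2 * I)
  have hq : Continuous q := by fun_prop
  have hqn : ∀ p : ℝ × ℝ, ‖q p‖ = |p.1| := fun p => by
    simp [q, norm_exp_ofReal_mul_I]
  -- Here a is the radial derivative of ψ and b is 1/ρ times the angular one.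
  let a : ℝ × ℝ → ℂ := fun p => fderiv ℝ ψ (q p) (exp (p.2 * I))
  let b : ℝ × ℝ → ℂ := fun p => fderiv ℝ ψ (q p) (I * exp (p.2 * I))
  have hac : Continuous a := (hd.comp hq).clm_apply (by fun_prop)
  have hbc : Continuous b := (hd.comp hq).clm_apply (by fun_prop)
  have hai := integrableOn_polar_of_support hac (r := r) fun p hp => by
    simp only [a, hfz (q p) (by rw [hqn]; exact hp.trans_le (le_abs_self _))]
    simp
  have hbi := integrableOn_polar_of_support hbc (r := r) fun p hp => by
    simp only [b, hfz (q p) (by rw [hqn]; exact hp.trans_le (le_abs_self _))]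
    simp
  have hqr : ∀ (α ρ : ℝ), HasDerivAt (fun ρ : ℝ => q (ρ, α)) (exp (α * I)) ρ := fun α ρ => by
    simpa using (ofRealCLM.hasDerivAt (x := ρ)).mul_const (exp (α * I))
  have hqα : ∀ (ρ α : ℝ), HasDerivAt (fun α : ℝ => q (ρ, α)) (ρ * (I * exp (α * I))) α := by
    intro ρ α
    have h3 := (((ofRealCLM.hasDerivAt (x := α)).mul_const I).cexp).const_mul (ρ : ℂ)
    exact h3.congr_deriv (by
      rw [ofRealCLM_apply, ofRealCLM_apply]
      push_cast
      ring)
  have hψd : ∀ u, HasFDerivAt ψ (fderiv ℝ ψ u) u := fun u =>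
    (h1.differentiable one_ne_zero).differentiableAt.hasFDerivAt
  -- On each ray the fundamental theorem gives -ψ(0), because ψ vanishes far out; the angles
  -- contribute the length 2π.
  have hA : ∫ p in Ioi (0 : ℝ) ×ˢ Ioo (-Real.pi) Real.pi, a p = -(2 * Real.pi * ψ 0) := by
    rw [Measure.volume_eq_prod, IntegrableOn, ← Measure.prod_restrict] at *
    rw [integral_prod_symm _ hai]
    have hin : ∀ᵐ α ∂(volume.restrict (Ioo (-Real.pi) Real.pi)),
        ∫ ρ in Ioi (0 : ℝ), a (ρ, α) = -ψ 0 := by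
      filter_upwards [hai.prod_left_ae] with α hα
      have hder : ∀ ρ : ℝ, HasDerivAt (fun ρ : ℝ => ψ (q (ρ, α))) (a (ρ, α)) ρ := fun ρ =>
        (hψd (q (ρ, α))).comp_hasDerivAt ρ (hqr α ρ)
      have hlim : Tendsto (fun ρ : ℝ => ψ (q (ρ, α))) atTop (𝓝 0) := by
        refine tendsto_const_nhds.congr' ?_
        filter_upwards [eventually_gt_atTop r] with ρ hρ
        refine (image_eq_zero_of_notMem_tsupport fun h => ?_).symm
        have := hr h
        rw [mem_closedBall_zero_iff, hqn] at this
        exact absurd (this.trans_lt hρ) (not_lt.2 (le_abs_self _))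
      rw [integral_Ioi_of_hasDerivAt_of_tendsto (hder 0).continuousAt.continuousWithinAt
        (fun ρ _ => hder ρ) hα hlim]
      simp [q]
    rw [integral_congr_ae hin, integral_const]
    have hp := Real.pi_pos
    simp only [measureReal_restrict_apply_univ, Real.volume_real_Ioo_of_le (neg_le_self hp.le),
      real_smul]
    push_cast
    ring
  -- On each circle the angular derivative integrates to 0 over a full period.
  have hB : ∫ p in Ioi (0 : ℝ) ×ˢ Ioo (-Real.pi) Real.pi, b p = 0 := by
    rw [Measure.volume_eq_prod, IntegrableOn, ← Measure.prod_restrict] at *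
    rw [integral_prod _ hbi]
    refine integral_eq_zero_of_ae ?_
    filter_upwards [ae_restrict_mem measurableSet_Ioi] with ρ hρ
    have hρ0 : (ρ : ℂ) ≠ 0 := by exact_mod_cast (mem_Ioi.1 hρ).ne'
    have hder : ∀ α : ℝ, HasDerivAt (fun α : ℝ => (ρ : ℂ)⁻¹ * ψ (q (ρ, α))) (b (ρ, α)) α := by
      intro α
      have h3 := ((hψd (q (ρ, α))).comp_hasDerivAt α (hqα ρ α)).const_mul (ρ : ℂ)⁻¹
      have h4 : fderiv ℝ ψ (q (ρ, α)) (ρ * (I * exp (α * I))) = ρ * b (ρ, α) := by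
        have := (fderiv ℝ ψ (q (ρ, α))).map_smul ρ (I * exp (α * I))
        simpa [real_smul] using this
      rw [h4, ← mul_assoc, inv_mul_cancel₀ hρ0, one_mul] at h3
      exact h3
    have hcont : Continuous fun α : ℝ => b (ρ, α) := hbc.comp (by fun_prop)
    have h5 := intervalIntegral.integral_eq_sub_of_hasDerivAt (a := -Real.pi) (b := Real.pi)
      (fun α _ => hder α) (hcont.intervalIntegrable _ _)
    have h6 : q (ρ, Real.pi) = q (ρ, -Real.pi) := by
      simp only [q]
      push_cast
      rw [neg_mul, exp_neg, exp_pi_mul_I]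
      norm_num
    rw [h6, sub_self, intervalIntegral.integral_of_le (by linarith [Real.pi_pos]),
      integral_Ioc_eq_integral_Ioo] at h5
    exact h5
  rw [← Complex.integral_comp_polarCoord_symm, polarCoord_target]
  -- The Jacobian ρ cancels the modulus of 1/u, and the phase of 1/u cancels that of the polar form
  -- of ∂/∂z̄.
  have hcongr : ∀ p ∈ Ioi (0 : ℝ) ×ˢ Ioo (-Real.pi) Real.pi,
      p.1 • (dbar ψ (Complex.polarCoord.symm p) * (Complex.polarCoord.symm p)⁻¹) =
        (1 / 2 : ℂ) * (a p + I * b p) := by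
    intro p hp
    have hp0 : (p.1 : ℂ) ≠ 0 := by exact_mod_cast (mem_Ioi.1 hp.1).ne'
    rw [polarCoord_symm_eq, dbar, fderiv_polar, real_smul, mul_inv, ← exp_neg]
    field_simp
    rfl
  rw [setIntegral_congr_fun (measurableSet_Ioi.prod measurableSet_Ioo) hcongr, integral_const_mul,
    integral_add hai (hbi.const_mul I), integral_const_mul, hA, hB]
  ring

/-- The Cauchy–Pompeiu formula for functions with compact support. -/
lemma integral_dbar_div_sub {ψ : ℂ → ℂ} (h1 : ContDiff ℝ 1 ψ) (h2 : HasCompactSupport ψ) (ζ : ℂ) :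
    ∫ z, dbar ψ z / (ζ - z) = Real.pi * ψ ζ := by
  have h3 := integral_dbar_mul_inv (ψ := fun u => ψ (u + ζ))
    (h1.comp (contDiff_id.add contDiff_const)) (h2.comp_homeomorph (Homeomorph.addRight ζ))
  have h4 : ∀ u, dbar (fun u => ψ (u + ζ)) u = dbar ψ (u + ζ) := fun u => by
    simp only [dbar, fderiv_comp_add_right]
  simp only [h4, zero_add] at h3
  rw [← integral_add_right_eq_self (fun z => dbar ψ z / (ζ - z)) ζ]
  have h5 : ∀ u, dbar ψ (u + ζ) / (ζ - (u + ζ)) = -(dbar ψ (u + ζ) * u⁻¹) := fun u => by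
    rw [show ζ - (u + ζ) = -u by ring, div_neg, div_eq_mul_inv]
  simp only [h5, integral_neg, h3, neg_neg]

/-! ### Integrability of the Cauchy kernel -/

/-- The measure on the disk. -/
abbrev μD : Measure ℂ := volume.restrict disk

/-- Differences of points of the disk lie in the ball of radius 2, where 1/u is integrable. Up to
sign the integrand is that of a convolution of two integrable functions. -/
lemma integrable_cauchy_prod {g : ℂ → ℂ} (hg : IntegrableOn g disk) :
    Integrable (fun p : ℂ × ℂ => g p.2 / (p.2 - p.1)) (μD.prod μD) := by
  have hg' : Integrable (disk.indicator g) := hg.integrable_indicator isOpen_disk.measurableSet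
  have hk : Integrable ((Metric.ball (0 : ℂ) 2).indicator fun u : ℂ => u⁻¹) :=
    (integrableOn_inv_ball 2).integrable_indicator Metric.isOpen_ball.measurableSet
  have h := (hg'.convolution_integrand (ContinuousLinearMap.mul ℝ ℂ) hk).neg
  have h1 := h.integrableOn (s := disk ×ˢ disk)
  rw [IntegrableOn, ← Measure.prod_restrict] at h1
  refine h1.congr ?_
  rw [Measure.prod_restrict]
  filter_upwards [ae_restrict_mem (isOpen_disk.measurableSet.prod isOpen_disk.measurableSet)]
    with p hp
  have h2 : p.1 - p.2 ∈ Metric.ball (0 : ℂ) 2 := by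
    have e1 : ‖p.1‖ < 1 := by simpa [disk] using hp.1
    have e2 : ‖p.2‖ < 1 := by simpa [disk] using hp.2
    rw [mem_ball_zero_iff]
    linarith [norm_sub_le p.1 p.2]
  simp only [Pi.neg_apply, ContinuousLinearMap.mul_apply', indicator_of_mem hp.2,
    indicator_of_mem h2]
  rw [← neg_sub p.1 p.2, div_neg, div_eq_mul_inv]

/-- The kernels `(-1)^m / m! · (2 Re u)^m / u`. -/
def κ (m : ℕ) (u : ℂ) : ℂ := (-1) ^ m / (m.factorial : ℂ) * X u ^ m * u⁻¹

/-- The potential of `f` with kernel `κ m`. -/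
def pot (f : ℂ → ℂ) (m : ℕ) (z : ℂ) : ℂ := ∫ ζ in disk, f ζ * κ m (ζ - z)

lemma norm_X_le (u : ℂ) : ‖X u‖ ≤ 2 * ‖u‖ := by
  refine (norm_add_le _ _).trans ?_
  rw [norm_conj]
  linarith

lemma norm_sub_lt_two {z ζ : ℂ} (hz : z ∈ disk) (hζ : ζ ∈ disk) : ‖ζ - z‖ < 2 := by
  have e1 : ‖z‖ < 1 := by simpa [disk] using hz
  have e2 : ‖ζ‖ < 1 := by simpa [disk] using hζ
  linarith [norm_sub_le ζ z]

lemma measurable_X : Measurable X := continuous_X.measurable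

lemma measurable_κ (m : ℕ) : Measurable (κ m) :=
  ((measurable_X.pow_const m).const_mul _).mul measurable_inv

lemma norm_κ_coeff_le (m : ℕ) {u : ℂ} (hu : ‖u‖ ≤ 2) :
    ‖(-1) ^ m / (m.factorial : ℂ) * X u ^ m‖ ≤ 4 ^ m := by
  have h1 : ‖X u‖ ≤ 4 := (norm_X_le u).trans (by linarith)
  have h2 : ‖(-1 : ℂ) ^ m / (m.factorial : ℂ)‖ ≤ 1 := by
    rw [norm_div, norm_pow, norm_neg, norm_one, one_pow, norm_natCast]
    exact div_le_one_of_le₀ (by exact_mod_cast m.factorial_pos) (by positivity)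
  rw [norm_mul, norm_pow]
  calc ‖(-1) ^ m / (m.factorial : ℂ)‖ * ‖X u‖ ^ m ≤ 1 * 4 ^ m := by gcongr
    _ = 4 ^ m := one_mul _

lemma integrable_κ_prod {f : ℂ → ℂ} (hf : IntegrableOn f disk) (m : ℕ) :
    Integrable (fun p : ℂ × ℂ => f p.2 * κ m (p.2 - p.1)) (μD.prod μD) := by
  have h := (integrable_cauchy_prod hf).bdd_mul (c := 4 ^ m)
    (f := fun p : ℂ × ℂ => (-1) ^ m / (m.factorial : ℂ) * X (p.2 - p.1) ^ m)
    (Continuous.aestronglyMeasurable (continuous_const.mul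
      ((continuous_X.comp (continuous_snd.sub continuous_fst)).pow m))) (by
    rw [Measure.prod_restrict]
    filter_upwards [ae_restrict_mem (isOpen_disk.measurableSet.prod isOpen_disk.measurableSet)]
      with p hp
    exact norm_κ_coeff_le m (norm_sub_lt_two hp.1 hp.2).le)
  refine h.congr (Eventually.of_forall fun p => ?_)
  simp only [κ, div_eq_mul_inv]
  ring

lemma integrableOn_pot {f : ℂ → ℂ} (hf : IntegrableOn f disk) (m : ℕ) :
    IntegrableOn (pot f m) disk := (integrable_κ_prod hf m).integral_prod_left

lemma integral_pot_mul {f : ℂ → ℂ} (hf : IntegrableOn f disk) (m : ℕ) {ψ : ℂ → ℂ}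
    (h1 : Continuous ψ) (h2 : HasCompactSupport ψ) :
    ∫ z in disk, pot f m z * ψ z = ∫ ζ in disk, f ζ * ∫ z in disk, κ m (ζ - z) * ψ z := by
  obtain ⟨C, hC⟩ := h1.bounded_above_of_compact_support h2
  have h := (integrable_κ_prod hf m).mul_bdd (c := C) (g := fun p : ℂ × ℂ => ψ p.1)
    (h1.comp continuous_fst).aestronglyMeasurable (Eventually.of_forall fun p => hC p.1)
  have h3 := integral_integral_swap (f := fun z ζ => f ζ * κ m (ζ - z) * ψ z) h
  simp only [mul_assoc, integral_const_mul] at h3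
  rw [← h3]
  refine integral_congr_ae (Eventually.of_forall fun z => ?_)
  simp only [pot, ← integral_mul_const, mul_assoc]

/-! ### Derivatives of the potentials -/

/-- The functions `(-1)^m / m! · (2 Re (ζ - z))^m`. -/
def shiftX (m : ℕ) (ζ z : ℂ) : ℂ := (-1) ^ m / (m.factorial : ℂ) * X (ζ - z) ^ m

lemma X_sub (ζ z : ℂ) : X (ζ - z) = X ζ - X z := by
  simp only [X, map_sub]
  ring

/-- As a function of z this is an `appell` sum with constant coefficients, so the rules for `appell`
give its derivatives. The same expansion later pulls the powers of X z out of the area integrals. -/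
lemma shiftX_eq (m : ℕ) (ζ : ℂ) :
    shiftX m ζ = appell (fun j _ => (-1) ^ j / (j.factorial : ℂ) * X ζ ^ j) m := by
  funext z
  rw [shiftX, X_sub, divided_pow_sub]
  rfl

lemma contDiff_shiftX (m : ℕ) (ζ : ℂ) : ContDiff ℝ ∞ (shiftX m ζ) :=
  contDiff_const.mul ((contDiff_X.comp (contDiff_const.sub contDiff_id)).pow m)

lemma dbar_shiftX_zero (ζ z : ℂ) : dbar (shiftX 0 ζ) z = 0 := by
  rw [shiftX_eq, dbar_appell_zero fun j => differentiableAt_const _]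

lemma dbar_shiftX_succ (m : ℕ) (ζ z : ℂ) : dbar (shiftX (m + 1) ζ) z = shiftX m ζ z := by
  rw [shiftX_eq, dbar_appell_succ fun j => differentiableAt_const _, shiftX_eq]

lemma shiftX_self_zero (ζ : ℂ) : shiftX 0 ζ ζ = 1 := by simp [shiftX]

/-- The vanishing on the diagonal removes the point mass from the Cauchy–Pompeiu formula; only κ 0
produces the term with f itself. -/
lemma shiftX_self_succ (m : ℕ) (ζ : ℂ) : shiftX (m + 1) ζ ζ = 0 := by simp [shiftX, X]

lemma κ_sub (m : ℕ) (ζ z : ℂ) : κ m (ζ - z) = shiftX m ζ z * (ζ - z)⁻¹ := rfl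

lemma integrable_κ_mul (m : ℕ) (ζ : ℂ) {ψ : ℂ → ℂ} (h1 : Continuous ψ)
    (h2 : HasCompactSupport ψ) : Integrable fun z => κ m (ζ - z) * ψ z := by
  have hc : Continuous fun z => shiftX m ζ z * ψ z := (contDiff_shiftX m ζ).continuous.mul h1
  have hs : HasCompactSupport fun z => shiftX m ζ z * ψ z := h2.mul_left
  obtain ⟨C, hC⟩ := hc.bounded_above_of_compact_support hs
  obtain ⟨r, hr⟩ := h2.isBounded.subset_ball ζ
  have hk : Integrable ((Metric.ball (0 : ℂ) r).indicator fun u : ℂ => u⁻¹) :=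
    (integrableOn_inv_ball r).integrable_indicator Metric.isOpen_ball.measurableSet
  refine ((hk.comp_sub_left ζ).bdd_mul (c := C) hc.aestronglyMeasurable
    (Eventually.of_forall hC)).congr (Eventually.of_forall fun z => ?_)
  by_cases hz : ψ z = 0
  · simp [hz]
  · have h3 : ζ - z ∈ Metric.ball (0 : ℂ) r := by
      have := hr (subset_tsupport ψ hz)
      rw [Metric.mem_ball, dist_comm, dist_eq_norm] at this
      simpa using this
    simp only [indicator_of_mem h3, κ_sub]
    ring

lemma setIntegral_disk_eq {u : ℂ → ℂ} {φ : ℂ → ℂ} (hs : tsupport φ ⊆ disk) :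
    ∫ z in disk, u z * φ z = ∫ z, u z * φ z :=
  setIntegral_eq_integral_of_forall_compl_eq_zero fun z hz => by
    rw [image_eq_zero_of_notMem_tsupport fun h => hz (hs h), mul_zero]

/-- The Cauchy–Pompeiu formula for the kernels `κ m`. -/
lemma integral_κ_mul_dbar (m : ℕ) (ζ : ℂ) {φ : ℂ → ℂ} (h1 : ContDiff ℝ ∞ φ)
    (h2 : HasCompactSupport φ) :
    ∫ z, κ m (ζ - z) * dbar φ z =
      Real.pi * (shiftX m ζ ζ * φ ζ) - ∫ z, dbar (shiftX m ζ) z * (ζ - z)⁻¹ * φ z := by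
  have hψ := integral_dbar_div_sub (ψ := fun z => shiftX m ζ z * φ z)
    (((contDiff_shiftX m ζ).mul h1).of_le (by simp)) h2.mul_left ζ
  rw [← hψ, ← integral_sub]
  · refine integral_congr_ae (Eventually.of_forall fun z => ?_)
    simp only
    rw [dbar_mul ((contDiff_shiftX m ζ).differentiable (by simp)).differentiableAt
      (h1.differentiable (by simp)).differentiableAt, κ_sub]
    ring
  · have hc : Continuous (dbar fun z => shiftX m ζ z * φ z) :=
      (contDiff_dbar ((contDiff_shiftX m ζ).mul h1)).continuous
    refine (integrable_κ_mul 0 ζ hc (hasCompactSupport_dbar h2.mul_left)).congr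
      (Eventually.of_forall fun z => ?_)
    simp [κ_sub, shiftX, div_eq_mul_inv, mul_comm]
  · rcases m with _ | m
    · simp only [dbar_shiftX_zero, zero_mul]
      exact integrable_zero _ _ _
    · simp only [dbar_shiftX_succ, ← κ_sub]
      exact integrable_κ_mul m ζ h1.continuous h2

lemma isWeakDbar_pot_zero {f : ℂ → ℂ} (hf : IntegrableOn f disk) :
    IsWeakDbar 1 (pot f 0) (fun z => -Real.pi * f z) := by
  refine ⟨(integrableOn_pot hf 0).locallyIntegrableOn, 
    IntegrableOn.locallyIntegrableOn (hf.const_mul _),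
    fun φ h1 h2 h3 => ?_⟩
  rw [Function.iterate_one, integral_pot_mul hf 0 (contDiff_dbar h1).continuous
    (hasCompactSupport_dbar h2)]
  simp only [setIntegral_disk_eq ((tsupport_dbar_subset φ).trans h3), integral_κ_mul_dbar 0 _ h1 h2,
    dbar_shiftX_zero, zero_mul, integral_zero, shiftX_self_zero, one_mul, sub_zero]
  simp only [mul_assoc, neg_mul, integral_neg, integral_const_mul]
  simp only [mul_left_comm (_ : ℂ) (Real.pi : ℂ), integral_const_mul]
  ring

lemma isWeakDbar_pot_succ {f : ℂ → ℂ} (hf : IntegrableOn f disk) (m : ℕ) :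
    IsWeakDbar 1 (pot f (m + 1)) (pot f m) := by
  refine ⟨(integrableOn_pot hf _).locallyIntegrableOn, (integrableOn_pot hf _).locallyIntegrableOn,
    fun φ h1 h2 h3 => ?_⟩
  rw [Function.iterate_one, integral_pot_mul hf _ (contDiff_dbar h1).continuous
    (hasCompactSupport_dbar h2), integral_pot_mul hf _ h1.continuous h2]
  simp only [setIntegral_disk_eq ((tsupport_dbar_subset φ).trans h3), setIntegral_disk_eq h3,
    integral_κ_mul_dbar _ _ h1 h2, dbar_shiftX_succ, ← κ_sub, shiftX_self_succ, zero_mul, mul_zero,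
    zero_sub, mul_neg, integral_neg, pow_one, one_mul, neg_mul]

/-- The Lipschitz estimates for the kernels: `κ m` for `m ≥ 1`, and a better one for `m ≥ 2`. -/
lemma κ_succ_eq (m : ℕ) (u : ℂ) : κ (m + 1) u = -(1 / (m + 1 : ℂ)) * (X u * κ m u) := by
  rw [κ, κ, Nat.factorial_succ]
  have h1 : (m.factorial : ℂ) ≠ 0 := by exact_mod_cast m.factorial_ne_zero
  have h2 : (m + 1 : ℂ) ≠ 0 := by exact_mod_cast m.succ_ne_zero
  push_cast
  field_simp
  ring

/-- One factor X compensates the singularity, as |X u / u| ≤ 2. -/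
lemma norm_κ_succ_le (m : ℕ) {u : ℂ} (hu : ‖u‖ ≤ 2) : ‖κ (m + 1) u‖ ≤ 2 * 4 ^ m := by
  have h0 := norm_κ_coeff_le m hu
  have h1 : ‖(-(1 / (m + 1 : ℂ)))‖ ≤ 1 := by
    rw [norm_neg, norm_div, norm_one]
    have : ‖(m + 1 : ℂ)‖ = m + 1 := by exact_mod_cast norm_natCast (m + 1)
    rw [this]
    exact div_le_one_of_le₀ (by linarith [m.cast_nonneg (α := ℝ)]) (by positivity)
  have h2 : ‖X u * u⁻¹‖ ≤ 2 := by
    rw [norm_mul, norm_inv]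
    rcases eq_or_ne u 0 with rfl | hu0
    · simp
    · rw [← div_eq_mul_inv, div_le_iff₀ (norm_pos_iff.2 hu0)]
      exact norm_X_le u
  have h3 : κ (m + 1) u = -(1 / (m + 1 : ℂ)) * ((X u * u⁻¹) *
      ((-1) ^ m / (m.factorial : ℂ) * X u ^ m)) := by
    rw [κ_succ_eq, κ]
    ring
  rw [h3, norm_mul, norm_mul]
  calc ‖(-(1 / (m + 1 : ℂ)))‖ * (‖X u * u⁻¹‖ * ‖(-1) ^ m / (m.factorial : ℂ) * X u ^ m‖)
      ≤ 1 * (2 * 4 ^ m) := by gcongr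
    _ = 2 * 4 ^ m := one_mul _

/-- Away from 0, κ 1 u = -1 - ū/u is homogeneous of degree 0, so a Lipschitz bound can hold only
with the weight |v|. After multiplication by v the difference is (ū(u - v) - u conj(u - v))/u. -/
lemma κ_one_lipschitz (u v : ℂ) : ‖κ 1 u - κ 1 v‖ * ‖v‖ ≤ 2 * ‖u - v‖ := by
  have h : ∀ u : ℂ, κ 1 u = -(X u * u⁻¹) := fun u => by simp [κ]
  rcases eq_or_ne v 0 with rfl | hv
  · simp
  rcases eq_or_ne u 0 with rfl | hu
  -- Here κ 1 0 = 0 by the convention 0⁻¹ = 0, and boundedness of κ 1 is enough.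
  · have e1 : ‖κ 1 0 - κ 1 v‖ ≤ 2 := by
      rw [h, h, inv_zero, mul_zero, neg_zero, zero_sub, neg_neg, norm_mul, norm_inv,
        ← div_eq_mul_inv, div_le_iff₀ (norm_pos_iff.2 hv)]
      exact norm_X_le v
    rw [zero_sub, norm_neg]
    gcongr
  · have e1 : (κ 1 u - κ 1 v) * v = (conj u * (u - v) - u * conj (u - v)) * u⁻¹ := by
      rw [h, h, X, X, map_sub]
      field_simp
      ring
    rw [← norm_mul, e1, norm_mul, norm_inv, ← div_eq_mul_inv, div_le_iff₀ (norm_pos_iff.2 hu)]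
    refine (norm_sub_le _ _).trans (le_of_eq ?_)
    rw [norm_mul, norm_mul, norm_conj, norm_conj]
    ring

/-- Up to a constant κ (m+2) is X · κ (m+1), and X u κ(u) - X v κ(v) = X(u - v) κ(u) + X v (κ(u) -
κ(v)), where κ stands for κ (m+1). Since |X v| ≤ 2|v|, the weight in the first estimate is absorbed
and the second follows; for |v| ≤ 2 the second implies the first one for the next index. -/
lemma κ_lipschitz (m : ℕ) : ∃ C : ℝ, ∀ u v : ℂ, ‖u‖ ≤ 2 → ‖v‖ ≤ 2 →
    ‖κ (m + 1) u - κ (m + 1) v‖ * ‖v‖ ≤ C * ‖u - v‖ ∧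
      ‖κ (m + 2) u - κ (m + 2) v‖ ≤ C * ‖u - v‖ := by
  have step : ∀ (m : ℕ) (C : ℝ) (u v : ℂ), ‖u‖ ≤ 2 →
      ‖κ (m + 1) u - κ (m + 1) v‖ * ‖v‖ ≤ C * ‖u - v‖ →
      ‖κ (m + 2) u - κ (m + 2) v‖ ≤ (4 * 4 ^ m + 2 * C) * ‖u - v‖ := by
    intro m C u v hu h
    have h1 : ‖(-(1 / ((m + 1 : ℕ) + 1 : ℂ)))‖ ≤ 1 := by
      rw [norm_neg, norm_div, norm_one]
      have : ‖((m + 1 : ℕ) + 1 : ℂ)‖ = (m + 1 : ℕ) + 1 := by exact_mod_cast norm_natCast (m + 1 + 1)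
      rw [this]
      exact div_le_one_of_le₀ (by linarith [(m + 1).cast_nonneg (α := ℝ)]) (by positivity)
    have h2 : κ (m + 2) u - κ (m + 2) v = -(1 / ((m + 1 : ℕ) + 1 : ℂ)) *
        (X (u - v) * κ (m + 1) u + X v * (κ (m + 1) u - κ (m + 1) v)) := by
      rw [κ_succ_eq (m + 1) u, κ_succ_eq (m + 1) v, X_sub]
      ring
    rw [h2, norm_mul]
    have h3 : ‖X (u - v) * κ (m + 1) u‖ ≤ 2 * ‖u - v‖ * (2 * 4 ^ m) := by
      rw [norm_mul]
      gcongr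
      · exact norm_X_le _
      · exact norm_κ_succ_le m hu
    have h4 : ‖X v * (κ (m + 1) u - κ (m + 1) v)‖ ≤ 2 * (C * ‖u - v‖) := by
      rw [norm_mul]
      calc ‖X v‖ * ‖κ (m + 1) u - κ (m + 1) v‖ ≤ 2 * ‖v‖ * ‖κ (m + 1) u - κ (m + 1) v‖ := by
            gcongr
            exact norm_X_le v
        _ = 2 * (‖κ (m + 1) u - κ (m + 1) v‖ * ‖v‖) := by ring
        _ ≤ _ := by gcongr
    calc _ ≤ 1 * (‖X (u - v) * κ (m + 1) u‖ + ‖X v * (κ (m + 1) u - κ (m + 1) v)‖) := by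
          gcongr
          exact norm_add_le _ _
      _ ≤ 1 * (2 * ‖u - v‖ * (2 * 4 ^ m) + 2 * (C * ‖u - v‖)) := by gcongr
      _ = _ := by ring
  have main : ∃ C : ℝ, 0 ≤ C ∧ ∀ u v : ℂ, ‖u‖ ≤ 2 → ‖v‖ ≤ 2 →
      ‖κ (m + 1) u - κ (m + 1) v‖ * ‖v‖ ≤ C * ‖u - v‖ := by
    induction m with
    | zero => exact ⟨2, by norm_num, fun u v _ _ => κ_one_lipschitz u v⟩
    | succ m ih =>
      obtain ⟨C, hC, h⟩ := ih
      refine ⟨(4 * 4 ^ m + 2 * C) * 2, by positivity, fun u v hu hv => ?_⟩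
      calc _ ≤ (4 * 4 ^ m + 2 * C) * ‖u - v‖ * 2 := by
            gcongr
            exact step m C u v hu (h u v hu hv)
        _ = _ := by ring
  obtain ⟨C, hC, h⟩ := main
  refine ⟨4 * 4 ^ m + 2 * C, fun u v hu hv => ⟨(h u v hu hv).trans ?_, step m C u v hu (h u v hu hv)⟩⟩
  gcongr
  have : (0 : ℝ) ≤ 4 * 4 ^ m := by positivity
  linarith

lemma contDiffAt_κ (m : ℕ) {u : ℂ} (hu : u ≠ 0) : ContDiffAt ℝ ∞ (κ m) u :=
  (contDiff_const.mul (contDiff_X.pow m)).contDiffAt.mul (contDiffAt_id.inv hu)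

lemma dbar_κ_sub (m : ℕ) {ζ z : ℂ} (h : z ≠ ζ) :
    dbar (fun z => κ (m + 1) (ζ - z)) z = κ m (ζ - z) := by
  have h0 : ζ - z ≠ 0 := sub_ne_zero.2 h.symm
  have hd : DifferentiableAt ℂ (fun z => (ζ - z)⁻¹) z :=
    ((differentiableAt_const ζ).sub differentiableAt_id).inv h0
  simp only [κ_sub]
  rw [dbar_mul ((contDiff_shiftX _ ζ).differentiable (by simp)).differentiableAt
    (hd.restrictScalars ℝ), dbar_of_differentiableAt hd, dbar_shiftX_succ, mul_zero, add_zero]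

/-- Fréchet differentiability of the potentials, in terms of a Lipschitz bound on the kernel. -/
lemma dbar_pot_of_bound {f : ℂ → ℂ} (hf : IntegrableOn f disk) (m : ℕ) {z₀ : ℂ} (hz₀ : z₀ ∈ disk)
    {b : ℂ → ℝ} (hb : IntegrableOn b disk)
    (hlip : ∀ ζ ∈ disk, ζ ≠ z₀ → ∀ z ∈ disk,
      ‖f ζ * κ (m + 1) (ζ - z) - f ζ * κ (m + 1) (ζ - z₀)‖ ≤ b ζ * ‖z - z₀‖) :
    DifferentiableAt ℝ (pot f (m + 1)) z₀ ∧ dbar (pot f (m + 1)) z₀ = pot f m z₀ := by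
  have hne : ∀ᵐ ζ ∂μD, ζ ∈ disk ∧ ζ ≠ z₀ := by
    filter_upwards [ae_restrict_mem isOpen_disk.measurableSet,
      ae_restrict_of_ae (compl_mem_ae_iff.2 (measure_singleton z₀))] with ζ h1 h2
    exact ⟨h1, h2⟩
  have hmeas : ∀ z, AEStronglyMeasurable (fun ζ => f ζ * κ (m + 1) (ζ - z)) μD := fun z =>
    hf.1.mul ((measurable_κ (m + 1)).comp (measurable_id.sub_const z)).aestronglyMeasurable
  have hint : Integrable (fun ζ => f ζ * κ (m + 1) (ζ - z₀)) μD := by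
    refine Integrable.mul_bdd (c := 2 * 4 ^ m) hf
      ((measurable_κ (m + 1)).comp (measurable_id.sub_const z₀)).aestronglyMeasurable ?_
    filter_upwards [hne] with ζ hζ
    exact norm_κ_succ_le m (norm_sub_lt_two hz₀ hζ.1).le
  let F' : ℂ → ℂ →L[ℝ] ℂ := fun ζ => f ζ • -(fderiv ℝ (κ (m + 1)) (ζ - z₀))
  have hF' : AEStronglyMeasurable F' μD := hf.1.smul
    ((measurable_fderiv ℝ (κ (m + 1))).comp (measurable_id.sub_const z₀)).neg.aestronglyMeasurable
  have hder : ∀ ζ, ζ ≠ z₀ → HasFDerivAt (fun z => f ζ * κ (m + 1) (ζ - z)) (F' ζ) z₀ := by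
    intro ζ hζ
    have h1 := ((contDiffAt_κ (m + 1) (sub_ne_zero.2 hζ)).differentiableAt (by simp)).hasFDerivAt
    have h2 := (h1.comp z₀ ((hasFDerivAt_const ζ z₀).sub (hasFDerivAt_id z₀))).const_mul (f ζ)
    convert! h2 using 1
    ext v
    simp [F']
  -- Differentiation under the integral needs the increments bounded only relative to the fixed
  -- point z₀; the one singular point ζ = z₀ is a null set.
  obtain ⟨hFi, hF⟩ := hasFDerivAt_integral_of_dominated_loc_of_lip' (𝕜 := ℝ)
    (F := fun z ζ => f ζ * κ (m + 1) (ζ - z)) (F' := F') (μ := μD) (bound := b)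
    (isOpen_disk.mem_nhds hz₀) (fun z _ => hmeas z) hint hF'
    (by filter_upwards [hne] with ζ hζ using hlip ζ hζ.1 hζ.2) hb
    (by filter_upwards [hne] with ζ hζ using hder ζ hζ.2)
  refine ⟨hF.differentiableAt, ?_⟩
  change dbar (fun z => ∫ ζ in disk, f ζ * κ (m + 1) (ζ - z)) z₀ = _
  rw [dbar_of_hasFDerivAt hF, ContinuousLinearMap.integral_apply hFi,
    ContinuousLinearMap.integral_apply hFi, ← integral_const_mul, ← integral_add
    (hFi.apply_continuousLinearMap 1) ((hFi.apply_continuousLinearMap I).const_mul I),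
    ← integral_const_mul]
  refine integral_congr_ae ?_
  filter_upwards [hne] with ζ hζ
  have h1 : DifferentiableAt ℝ (fun z => κ (m + 1) (ζ - z)) z₀ :=
    ((contDiffAt_κ (m + 1) (sub_ne_zero.2 hζ.2)).differentiableAt (by simp)).comp z₀
      ((differentiableAt_const ζ).sub differentiableAt_id)
  have h2 := dbar_const_mul (f ζ) h1
  rw [dbar_of_hasFDerivAt (hder ζ hζ.2), dbar_κ_sub m hζ.2.symm] at h2
  exact h2

/-- From κ 2 on the kernel is Lipschitz without weight, so C|f| dominates and no condition on z is
needed. -/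
lemma dbar_pot_succ_succ {f : ℂ → ℂ} (hf : IntegrableOn f disk) (m : ℕ) {z : ℂ} (hz : z ∈ disk) :
    DifferentiableAt ℝ (pot f (m + 2)) z ∧ dbar (pot f (m + 2)) z = pot f (m + 1) z := by
  obtain ⟨C, hC⟩ := κ_lipschitz m
  refine dbar_pot_of_bound hf (m + 1) hz (b := fun ζ => C * ‖f ζ‖) (hf.norm.const_mul C) ?_
  intro ζ hζ _ w hw
  have h1 := (hC (ζ - w) (ζ - z) (norm_sub_lt_two hw hζ).le (norm_sub_lt_two hz hζ).le).2
  rw [← mul_sub, norm_mul]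
  have h2 : ‖ζ - w - (ζ - z)‖ = ‖w - z‖ := by
    rw [← norm_neg]
    congr 1
    ring
  rw [h2] at h1
  calc _ ≤ ‖f ζ‖ * (C * ‖w - z‖) := by gcongr
    _ = _ := by ring

/-- The weighted Lipschitz bound leads to the majorant C|f(ζ)/(ζ - z)|. Its integrability is the
condition that singles out the good points z. -/
lemma dbar_pot_succ {f : ℂ → ℂ} (hf : IntegrableOn f disk) (m : ℕ) {z : ℂ} (hz : z ∈ disk)
    (hfz : IntegrableOn (fun ζ => f ζ / (ζ - z)) disk) :
    DifferentiableAt ℝ (pot f (m + 1)) z ∧ dbar (pot f (m + 1)) z = pot f m z := by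
  obtain ⟨C, hC⟩ := κ_lipschitz m
  refine dbar_pot_of_bound hf m hz (b := fun ζ => C * ‖f ζ / (ζ - z)‖) (hfz.norm.const_mul C) ?_
  intro ζ hζ hne w hw
  have h1 := (hC (ζ - w) (ζ - z) (norm_sub_lt_two hw hζ).le (norm_sub_lt_two hz hζ).le).1
  have h0 : 0 < ‖ζ - z‖ := norm_pos_iff.2 (sub_ne_zero.2 hne)
  have h2 : ‖ζ - w - (ζ - z)‖ = ‖w - z‖ := by
    rw [← norm_neg]
    congr 1
    ring
  rw [h2, ← le_div_iff₀ h0] at h1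
  rw [← mul_sub, norm_mul, norm_div]
  calc _ ≤ ‖f ζ‖ * (C * ‖w - z‖ / ‖ζ - z‖) := by gcongr
    _ = _ := by ring

/-- Dominated convergence: the kernel is bounded, and continuous except at the single point ζ = z₀.
-/
lemma continuousOn_pot_succ {f : ℂ → ℂ} (hf : IntegrableOn f disk) (m : ℕ) :
    ContinuousOn (pot f (m + 1)) disk := by
  intro z₀ hz₀
  refine ContinuousAt.continuousWithinAt ?_
  refine continuousAt_of_dominated (bound := fun ζ => ‖f ζ‖ * (2 * 4 ^ m))
    (Eventually.of_forall fun z => hf.1.mul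
      ((measurable_κ (m + 1)).comp (measurable_id.sub_const z)).aestronglyMeasurable) ?_
    (hf.norm.mul_const _) ?_
  · filter_upwards [isOpen_disk.mem_nhds hz₀] with z hz
    filter_upwards [ae_restrict_mem isOpen_disk.measurableSet] with ζ hζ
    rw [norm_mul]
    gcongr
    exact norm_κ_succ_le m (norm_sub_lt_two hz hζ).le
  · filter_upwards [ae_restrict_of_ae (compl_mem_ae_iff.2 (measure_singleton z₀))] with ζ hζ
    have h1 : ContinuousAt (κ (m + 1)) (ζ - z₀) :=
      (contDiffAt_κ (m + 1) (sub_ne_zero.2 hζ)).continuousAt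
    exact continuousAt_const.mul
      (ContinuousAt.comp (f := fun z => ζ - z) h1 (by fun_prop))

/-! ### Boundary values of Cauchy transforms -/

/-- The measure on the angles. -/
abbrev μT : Measure ℝ := volume.restrict (Ioc 0 (2 * Real.pi))

lemma mem_regularRadii {f : ℂ → ℂ} {r : ℝ} : r ∈ regularRadii f ↔ r ∈ Ioo (0 : ℝ) 1 ∧
    Integrable (fun q : ℝ × ℂ => f q.2 / (q.2 - circleMap 0 r q.1)) (μT.prod μD) := by
  rw [Measure.prod_restrict]
  rfl

/-- The product of `f` with a power of `2 Re`. -/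
def mulX (f : ℂ → ℂ) (j : ℕ) (ζ : ℂ) : ℂ := f ζ * X ζ ^ j

lemma norm_X_pow_le {ζ : ℂ} (hζ : ζ ∈ disk) (j : ℕ) : ‖X ζ ^ j‖ ≤ 2 ^ j := by
  have h1 : ‖ζ‖ < 1 := by simpa [disk] using hζ
  rw [norm_pow]
  have := norm_X_le ζ
  gcongr
  linarith

lemma integrableOn_mulX {f : ℂ → ℂ} (hf : IntegrableOn f disk) (j : ℕ) :
    IntegrableOn (mulX f j) disk := by
  refine Integrable.mul_bdd (c := 2 ^ j) hf (continuous_X.pow j).aestronglyMeasurable ?_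
  filter_upwards [ae_restrict_mem isOpen_disk.measurableSet] with ζ hζ using norm_X_pow_le hζ j

lemma integrableOn_mulX_div {f d : ℂ → ℂ} (hf : IntegrableOn (fun ζ => f ζ / d ζ) disk) (j : ℕ) :
    IntegrableOn (fun ζ => mulX f j ζ / d ζ) disk :=
  (integrableOn_mulX hf j).congr (Eventually.of_forall fun ζ => by simp only [mulX]; ring)

lemma regularRadii_subset (f : ℂ → ℂ) (j : ℕ) : regularRadii f ⊆ regularRadii (mulX f j) := by
  intro r hr
  rw [mem_regularRadii] at hr ⊢
  refine ⟨hr.1, ?_⟩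
  refine (hr.2.mul_bdd (c := 2 ^ j) (g := fun q : ℝ × ℂ => X q.2 ^ j)
    ((continuous_X.comp continuous_snd).pow j).aestronglyMeasurable ?_).congr
    (Eventually.of_forall fun q => by simp only [mulX]; ring)
  rw [Measure.prod_restrict]
  filter_upwards [ae_restrict_mem (measurableSet_Ioc.prod isOpen_disk.measurableSet)] with q hq
  exact norm_X_pow_le hq.2 j

lemma κ_zero (u : ℂ) : κ 0 u = u⁻¹ := by simp [κ]

lemma pot_zero (g : ℂ → ℂ) (z : ℂ) : pot g 0 z = ∫ ζ in disk, g ζ / (ζ - z) := by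
  simp only [pot, κ_zero, div_eq_mul_inv]

/-- At points where the Cauchy integral converges absolutely, the potentials are polyanalytic
expressions in Cauchy integrals. -/
lemma pot_eq_appell {f : ℂ → ℂ} {z : ℂ} (hfz : IntegrableOn (fun ζ => f ζ / (ζ - z)) disk)
    (m : ℕ) : pot f m z =
      appell (fun j z => (-1) ^ j / (j.factorial : ℂ) * pot (mulX f j) 0 z) m z := by
  have h1 : ∀ ζ, f ζ * κ m (ζ - z) = ∑ p ∈ Finset.HasAntidiagonal.antidiagonal m,
      Xf p.1 z * ((-1) ^ p.2 / (p.2.factorial : ℂ)) * (mulX f p.2 ζ / (ζ - z)) := by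
    intro ζ
    rw [κ_sub, shiftX_eq, appell, Finset.sum_mul, Finset.mul_sum]
    refine Finset.sum_congr rfl fun p _ => ?_
    rw [mulX]
    ring
  simp only [pot_zero]
  rw [pot]
  simp only [h1]
  rw [integral_finsetSum _ fun p _ => (integrableOn_mulX_div hfz p.2).const_mul _]
  refine Finset.sum_congr rfl fun p _ => ?_
  rw [integral_const_mul, mul_assoc]

/-- The angular integral of the Cauchy kernel against a test function. -/
def cauchyPairing (φ : CircleTest) (r : ℝ) (ζ : ℂ) : ℂ :=
  ∫ θ in (0 : ℝ)..(2 * Real.pi), (ζ - circleMap 0 r θ)⁻¹ * φ.1 θ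

lemma circleMap_eq_e (r θ : ℝ) : circleMap 0 r θ = r * (e 1).1 θ := by
  simpa using circleMap_pow r 1 θ

lemma e_natCast (k : ℕ) (t : ℝ) : (e k).1 t = (e 1).1 t ^ k := by
  rw [e_apply, e_apply, ← exp_nat_mul]
  push_cast
  ring_nf

lemma e_neg (j : ℤ) (t : ℝ) : (e (-j)).1 t = ((e j).1 t)⁻¹ := by
  rw [e_apply, e_apply, ← exp_neg]
  push_cast
  ring_nf

/-- For |ζ| < r, expand 1/(ζ - r e^{iθ}) in powers of ζ/(r e^{iθ}). Only the frequencies -(k+1)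
occur, hence the coefficients `fc (k + 1) φ`. -/
lemma hasSum_cauchyPairing_lt (φ : CircleTest) {r : ℝ} {ζ : ℂ} (hr : 0 < r) (hζ : ‖ζ‖ < r) :
    HasSum (fun k : ℕ => 2 * Real.pi * (-(ζ ^ k / r ^ (k + 1)) * fc (k + 1) φ))
      (cauchyPairing φ r ζ) := by
  have hr0 : (r : ℂ) ≠ 0 := by exact_mod_cast hr.ne'
  have hlt : ‖ζ‖ / r < 1 := (div_lt_one hr).2 hζ
  have hnorm : ∀ k : ℕ, ‖-(ζ ^ k / (r : ℂ) ^ (k + 1))‖ = r⁻¹ * (‖ζ‖ / r) ^ k := fun k => by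
    rw [norm_neg, norm_div, norm_pow, norm_pow, norm_real, Real.norm_of_nonneg hr.le, div_pow, pow_succ]
    field_simp
  have h := hasSum_integral_mul (c := fun k : ℕ => -(ζ ^ k / (r : ℂ) ^ (k + 1)))
    (m := fun k : ℕ => -((k : ℤ) + 1)) (F := fun θ => (ζ - circleMap 0 r θ)⁻¹) (by
      simp only [hnorm]
      exact (summable_geometric_of_lt_one (by positivity) hlt).mul_left _) (fun t => ?_) φ
  · simp only [neg_neg] at h
    exact h
  · have he : (e 1).1 t ≠ 0 := exp_ne_zero _
    have h1 := (hasSum_geometric_of_norm_lt_one (ξ := ζ / (r * (e 1).1 t)) (by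
      rwa [norm_div, norm_mul, norm_e, mul_one, norm_real,
        Real.norm_of_nonneg hr.le])).mul_left (-(r * (e 1).1 t)⁻¹)
    have hne : r * (e 1).1 t - ζ ≠ 0 := fun h0 => by
      have : ‖ζ‖ = r := by
        rw [← sub_eq_zero.1 h0, norm_mul, norm_e, mul_one, norm_real, Real.norm_of_nonneg hr.le]
      exact hζ.ne this
    have h2 : -(r * (e 1).1 t)⁻¹ * (1 - ζ / (r * (e 1).1 t))⁻¹ = (ζ - circleMap 0 r t)⁻¹ := by
      rw [circleMap_eq_e, ← neg_sub (r * (e 1).1 t) ζ, inv_neg, neg_mul, ← mul_inv]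
      congr 2
      field_simp
    rw [h2] at h1
    refine h1.congr_fun fun k => ?_
    have h3 : (e (-((k : ℤ) + 1))).1 t = ((e 1).1 t ^ (k + 1))⁻¹ := by
      rw [e_neg, ← e_natCast]
      norm_cast
    rw [h3, div_pow, mul_pow, pow_succ, pow_succ]
    field_simp

lemma hasSum_cauchyPairing_gt (φ : CircleTest) {r : ℝ} {ζ : ℂ} (hr : 0 < r) (hζ : r < ‖ζ‖) :
    HasSum (fun k : ℕ => 2 * Real.pi * ((r ^ k / ζ ^ (k + 1)) * fc (-k) φ))
      (cauchyPairing φ r ζ) := by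
  have hpos : 0 < ‖ζ‖ := hr.trans hζ
  have hζ0 : ζ ≠ 0 := norm_pos_iff.1 hpos
  have hlt : r / ‖ζ‖ < 1 := (div_lt_one hpos).2 hζ
  have hnorm : ∀ k : ℕ, ‖((r : ℂ) ^ k / ζ ^ (k + 1))‖ = ‖ζ‖⁻¹ * (r / ‖ζ‖) ^ k := fun k => by
    rw [norm_div, norm_pow, norm_pow, norm_real, Real.norm_of_nonneg hr.le, div_pow, pow_succ]
    field_simp
  refine hasSum_integral_mul (c := fun k : ℕ => ((r : ℂ) ^ k / ζ ^ (k + 1)))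
    (m := fun k : ℕ => (k : ℤ)) (F := fun θ => (ζ - circleMap 0 r θ)⁻¹) ?_ (fun t => ?_) φ
  · simp only [hnorm]
    exact (summable_geometric_of_lt_one (by positivity) hlt).mul_left _
  · have h1 := (hasSum_geometric_of_norm_lt_one (ξ := r * (e 1).1 t / ζ) (by
      rwa [norm_div, norm_mul, norm_e, mul_one, norm_real,
        Real.norm_of_nonneg hr.le])).mul_left ζ⁻¹
    have h2 : ζ⁻¹ * (1 - r * (e 1).1 t / ζ)⁻¹ = (ζ - circleMap 0 r t)⁻¹ := by
      rw [circleMap_eq_e, ← mul_inv]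
      congr 1
      field_simp
    rw [h2] at h1
    refine h1.congr_fun fun k => ?_
    rw [e_natCast, div_pow, mul_pow, pow_succ]
    field_simp

lemma norm_two_pi : ‖(2 * Real.pi : ℂ)‖ = 2 * Real.pi := by
  simp [abs_of_pos Real.pi_pos]

/-- In both geometric expansions, inside and outside the circle, the coefficients are at most 1/r.
Smoothness of φ thus gives a bound uniform in ζ up to the circle, although the kernel is singular
there. -/
lemma norm_cauchyPairing_le (φ : CircleTest) {r : ℝ} {ζ : ℂ} (hr : 0 < r) (hζ : ‖ζ‖ ≠ r) :
    ‖cauchyPairing φ r ζ‖ ≤ 2 * Real.pi * (r⁻¹ * ∑' j : ℤ, ‖fc j φ‖) := by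
  have hp := Real.pi_pos
  have hsub : ∀ (m : ℕ → ℤ), Function.Injective m →
      Summable (fun k => ‖fc (m k) φ‖) ∧ ∑' k, ‖fc (m k) φ‖ ≤ ∑' j : ℤ, ‖fc j φ‖ := fun m hm =>
    ⟨(summable_norm_fc φ).comp_injective hm,
      tsum_comp_le_tsum_of_inj (summable_norm_fc φ) (fun _ => norm_nonneg _) hm⟩
  have key : ∀ (c : ℕ → ℂ) (m : ℕ → ℤ), Function.Injective m → (∀ k, ‖c k‖ ≤ r⁻¹) →
      HasSum (fun k : ℕ => 2 * Real.pi * (c k * fc (m k) φ)) (cauchyPairing φ r ζ) →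
      ‖cauchyPairing φ r ζ‖ ≤ 2 * Real.pi * (r⁻¹ * ∑' j : ℤ, ‖fc j φ‖) := by
    intro c m hm hc h
    obtain ⟨hs, hle⟩ := hsub m hm
    rw [← h.tsum_eq]
    refine (tsum_of_norm_bounded ((hs.mul_left r⁻¹).mul_left (2 * Real.pi)).hasSum fun k => ?_).trans
      ?_
    · rw [norm_mul, norm_two_pi, norm_mul]
      gcongr
      exact hc k
    · rw [tsum_mul_left, tsum_mul_left]
      gcongr
  rcases lt_or_gt_of_ne hζ with h | h
  · refine key _ (fun k : ℕ => (k : ℤ) + 1) (fun a b h => by simpa using h) (fun k => ?_)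
      (hasSum_cauchyPairing_lt φ hr h)
    rw [norm_neg, norm_div, norm_pow, norm_pow, norm_real, Real.norm_of_nonneg hr.le, pow_succ,
      ← div_div, ← div_pow, div_eq_mul_inv _ r]
    exact mul_le_of_le_one_left (by positivity) (pow_le_one₀ (by positivity)
      ((div_le_one hr).2 h.le))
  · have hpos : 0 < ‖ζ‖ := hr.trans h
    refine key _ (fun k : ℕ => -(k : ℤ)) (fun a b h => by simpa using h) (fun k => ?_)
      (hasSum_cauchyPairing_gt φ hr h)
    rw [norm_div, norm_pow, norm_pow, norm_real, Real.norm_of_nonneg hr.le, pow_succ,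
      ← div_div, ← div_pow, div_eq_mul_inv _ ‖ζ‖]
    calc _ ≤ 1 * ‖ζ‖⁻¹ := by
          gcongr
          exact pow_le_one₀ (by positivity) ((div_le_one hpos).2 h.le)
      _ ≤ r⁻¹ := by
          rw [one_mul]
          exact inv_anti₀ hr h.le

/-- The limit of `cauchyPairing φ r ζ` as `r → 1`. -/
def cauchyLimit (φ : CircleTest) (ζ : ℂ) : ℂ := ∑' k : ℕ, 2 * Real.pi * (-ζ ^ k * fc (k + 1) φ)

lemma summable_fc_succ (φ : CircleTest) : Summable fun k : ℕ => ‖fc (k + 1) φ‖ :=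
  (summable_norm_fc φ).comp_injective (i := fun k : ℕ => (k : ℤ) + 1) fun a b h => by simpa using h

/-- For fixed ζ in the disk, r eventually exceeds |ζ|, so only the inner expansion matters. The
condition r > 1/2 bounds 1/r by 2 and makes the series uniformly dominated. -/
lemma tendsto_cauchyPairing (φ : CircleTest) {R : Set ℝ} {ζ : ℂ}
    (hζ : ζ ∈ disk) :
    Tendsto (fun r => cauchyPairing φ r ζ) (𝓝[R] 1) (𝓝 (cauchyLimit φ ζ)) := by
  have hζ1 : ‖ζ‖ < 1 := by simpa [disk] using hζ
  have hev : ∀ᶠ r in 𝓝[R] (1 : ℝ), ‖ζ‖ < r ∧ 1 / 2 < r ∧ r ∈ R := by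
    have h1 : ∀ᶠ r in 𝓝[R] (1 : ℝ), ‖ζ‖ < r := nhdsWithin_le_nhds (lt_mem_nhds hζ1)
    have h2 : ∀ᶠ r in 𝓝[R] (1 : ℝ), 1 / 2 < r := nhdsWithin_le_nhds (lt_mem_nhds (by norm_num))
    filter_upwards [h1, h2, self_mem_nhdsWithin] with r a b c using ⟨a, b, c⟩
  have hlim : Tendsto (fun r : ℝ => ∑' k : ℕ, 2 * Real.pi *
      (-(ζ ^ k / (r : ℂ) ^ (k + 1)) * fc (k + 1) φ)) (𝓝[R] 1) (𝓝 (cauchyLimit φ ζ)) := by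
    refine tendsto_tsum_of_dominated_convergence
      (((summable_fc_succ φ).mul_left 2).mul_left (2 * Real.pi)) (fun k => ?_) ?_
    · have h1 : Tendsto (fun r : ℝ => (r : ℂ) ^ (k + 1)) (𝓝[R] 1) (𝓝 1) := by
        have : Tendsto (fun r : ℝ => (r : ℂ) ^ (k + 1)) (𝓝 1) (𝓝 (((1 : ℝ) : ℂ) ^ (k + 1))) :=
          Continuous.tendsto (by fun_prop) 1
        simpa using this.mono_left nhdsWithin_le_nhds
      have h2 := (((tendsto_const_nhds (x := ζ ^ k)).div h1 one_ne_zero).neg.mul_const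
        (fc (k + 1) φ)).const_mul (2 * Real.pi : ℂ)
      simpa using h2
    · filter_upwards [hev] with r hr k
      have hp := Real.pi_pos
      have hr0 : 0 < r := by linarith [hr.2.1]
      rw [norm_mul, norm_two_pi, norm_mul, norm_neg, norm_div, norm_pow, norm_pow, norm_real,
        Real.norm_of_nonneg hr0.le, pow_succ, ← div_div, ← div_pow, div_eq_mul_inv _ r]
      gcongr
      calc _ ≤ 1 * (1 / 2 : ℝ)⁻¹ := by
            gcongr
            · exact pow_le_one₀ (by positivity) ((div_le_one hr0).2 hr.1.le)
            · exact hr.2.1.le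
        _ = 2 := by norm_num
  refine hlim.congr' ?_
  filter_upwards [hev] with r hr
  exact (hasSum_cauchyPairing_lt φ (by linarith [hr.2.1]) hr.1).tsum_eq

/-- The moments of an integrable function on the disk. -/
def moment (q : ℂ → ℂ) (k : ℤ) : ℂ := ∫ ζ in disk, q ζ * ζ ^ k.toNat

lemma norm_moment_le (q : ℂ → ℂ) (k : ℤ) (hq : IntegrableOn q disk) :
    ‖moment q k‖ ≤ ∫ ζ in disk, ‖q ζ‖ := by
  refine norm_integral_le_of_norm_le hq.norm ?_
  filter_upwards [ae_restrict_mem isOpen_disk.measurableSet] with ζ hζ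
  have h1 : ‖ζ‖ < 1 := by simpa [disk] using hζ
  rw [norm_mul, norm_pow]
  exact mul_le_of_le_one_right (norm_nonneg _) (pow_le_one₀ (norm_nonneg _) h1.le)

/-- The Fourier coefficients of the boundary value of the Cauchy transform of `ζ q(ζ)`. -/
def cauchyCoeff (q : ℂ → ℂ) (j : ℤ) : ℂ := if 1 ≤ j then -(2 * Real.pi) * moment q j else 0

lemma polyBdd_cauchyCoeff {q : ℂ → ℂ} (hq : IntegrableOn q disk) : PolyBdd (cauchyCoeff q) := by
  refine polyBdd_of_le (C := 2 * Real.pi * ∫ ζ in disk, ‖q ζ‖) fun j => ?_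
  have hp := Real.pi_pos
  have h0 : 0 ≤ ∫ ζ in disk, ‖q ζ‖ := integral_nonneg fun _ => norm_nonneg _
  rw [cauchyCoeff]
  split_ifs
  · rw [norm_mul, norm_neg, norm_two_pi]
    gcongr
    exact norm_moment_le q j hq
  · rw [norm_zero]
    positivity

lemma hasSum_cauchyCoeff {q : ℂ → ℂ} (hq : IntegrableOn q disk) (φ : CircleTest) :
    HasSum (fun k : ℕ => -(2 * Real.pi) * (moment q (k + 1) * fc (k + 1) φ))
      (ofCoeff _ (polyBdd_cauchyCoeff hq) φ) := by
  have h := ((polyBdd_cauchyCoeff hq).summable φ).of_norm.hasSum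
  have hinj : Function.Injective fun k : ℕ => (k : ℤ) + 1 := fun a b h => by simpa using h
  rw [ofCoeff_apply]
  rw [← hinj.hasSum_iff] at h
  · refine h.congr_fun fun k => ?_
    simp only [Function.comp_apply, cauchyCoeff]
    rw [if_pos (by lia)]
    ring
  · intro j hj
    rw [cauchyCoeff, if_neg, zero_mul]
    intro h1
    exact hj ⟨(j - 1).toNat, by simp only; lia⟩

/-- Termwise integration; the extra factor ζ raises ζ^k to ζ^(k+1), so that the moments of q start
at index 1. -/
lemma integral_cauchyLimit {q : ℂ → ℂ} (hq : IntegrableOn q disk) (φ : CircleTest) :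
    ∫ ζ in disk, q ζ * ζ * cauchyLimit φ ζ = ofCoeff _ (polyBdd_cauchyCoeff hq) φ := by
  have hp := Real.pi_pos
  have h := hasSum_integral_of_dominated_convergence (μ := μD)
    (F := fun (k : ℕ) ζ => q ζ * ζ * (2 * Real.pi * (-ζ ^ k * fc (k + 1) φ)))
    (f := fun ζ => q ζ * ζ * cauchyLimit φ ζ)
    (fun k ζ => ‖q ζ‖ * (2 * Real.pi * ‖fc (k + 1) φ‖))
    (fun k => (hq.1.mul (by fun_prop)).mul (by fun_prop)) (fun k => ?_) ?_ ?_ ?_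
  · refine h.unique ((hasSum_cauchyCoeff hq φ).congr_fun fun k => ?_)
    rw [moment, ← integral_mul_const, ← integral_const_mul]
    refine integral_congr_ae (Eventually.of_forall fun ζ => ?_)
    have : ((k : ℤ) + 1).toNat = k + 1 := by lia
    simp only [this]
    ring
  · filter_upwards [ae_restrict_mem isOpen_disk.measurableSet] with ζ hζ
    have h1 : ‖ζ‖ < 1 := by simpa [disk] using hζ
    rw [norm_mul, norm_mul, norm_mul, norm_two_pi, norm_mul, norm_neg, norm_pow]
    calc _ ≤ ‖q ζ‖ * 1 * (2 * Real.pi * (1 * ‖fc (k + 1) φ‖)) := by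
          gcongr
          exact pow_le_one₀ (norm_nonneg _) h1.le
      _ = _ := by ring
  · exact Eventually.of_forall fun ζ => ((summable_fc_succ φ).mul_left _).mul_left _
  · simp only [tsum_mul_left]
    exact hq.norm.mul_const _
  · filter_upwards [ae_restrict_mem isOpen_disk.measurableSet] with ζ hζ
    have h1 : ‖ζ‖ < 1 := by simpa [disk] using hζ
    refine (Summable.hasSum ?_).mul_left _
    refine Summable.of_norm_bounded ((summable_fc_succ φ).mul_left (2 * Real.pi)) fun k => ?_
    rw [norm_mul, norm_two_pi, norm_mul, norm_neg, norm_pow]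
    gcongr
    exact mul_le_of_le_one_left (norm_nonneg _) (pow_le_one₀ (norm_nonneg _) h1.le)

/-- The boundary value of a Cauchy transform along the regular radii. -/
lemma bv_pot_zero {g q : ℂ → ℂ} (hg : IntegrableOn g disk) (hq : IntegrableOn q disk)
    (hgq : ∀ᵐ ζ ∂μD, g ζ = q ζ * ζ) :
    BV (regularRadii g) (pot g 0) (ofCoeff _ (polyBdd_cauchyCoeff hq)) := by
  have hp := Real.pi_pos
  refine ⟨ofCoeff_mem_bdd _ _, fun r hr => ?_, fun φ => ?_⟩
  · rw [intervalIntegrable_iff, uIoc_of_le Real.two_pi_pos.le]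
    simp only [pot_zero]
    exact (mem_regularRadii.1 hr).2.integral_prod_left
  · obtain ⟨B, hB⟩ := exists_derivBound 0 φ
    have hprod : ∀ r ∈ regularRadii g, Integrable
        (fun p : ℝ × ℂ => g p.2 / (p.2 - circleMap 0 r p.1) * φ.1 p.1) (μT.prod μD) := fun r hr =>
      (mem_regularRadii.1 hr).2.mul_bdd (c := B)
        ((continuous_test φ).comp continuous_fst).aestronglyMeasurable
        (Eventually.of_forall fun p => hB 0 le_rfl p.1)
    have hin : ∀ (r : ℝ) (ζ : ℂ), ∫ θ, g ζ / (ζ - circleMap 0 r θ) * φ.1 θ ∂μT =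
        g ζ * cauchyPairing φ r ζ := by
      intro r ζ
      rw [cauchyPairing, intervalIntegral.integral_of_le Real.two_pi_pos.le, ← integral_const_mul]
      refine integral_congr_ae (Eventually.of_forall fun θ => ?_)
      simp only [div_eq_mul_inv, mul_assoc]
    have hpair : ∀ r ∈ regularRadii g, circlePairing (pot g 0) φ r =
        ∫ ζ in disk, g ζ * cauchyPairing φ r ζ := by
      intro r hr
      -- Fubini applies precisely because r is a regular radius.
      have h := integral_integral_swap
        (f := fun (θ : ℝ) (ζ : ℂ) => g ζ / (ζ - circleMap 0 r θ) * φ.1 θ) (hprod r hr)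
      simp only [hin, integral_mul_const, ← pot_zero] at h
      rw [← h, circlePairing, intervalIntegral.integral_of_le Real.two_pi_pos.le]
    -- Dominated convergence with a constant multiple of |g|: the circle |ζ| = r, where the bound on
    -- the pairing is not available, is a null set, and 1/r ≤ 2 near r = 1.
    have hlim : Tendsto (fun r => ∫ ζ in disk, g ζ * cauchyPairing φ r ζ) (𝓝[regularRadii g] 1)
        (𝓝 (∫ ζ in disk, g ζ * cauchyLimit φ ζ)) := by
      refine tendsto_integral_filter_of_dominated_convergence
        (fun ζ => ‖g ζ‖ * (2 * Real.pi * (2 * ∑' j : ℤ, ‖fc j φ‖))) ?_ ?_ (hg.norm.mul_const _) ?_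
      · filter_upwards [self_mem_nhdsWithin] with r hr
        have := (hprod r hr).integral_prod_right.1
        simpa only [hin] using this
      · have h2 : ∀ᶠ r in 𝓝[regularRadii g] (1 : ℝ), 1 / 2 < r :=
          nhdsWithin_le_nhds (lt_mem_nhds (by norm_num))
        filter_upwards [h2] with r hr
        have hr0 : 0 < r := by linarith
        have hsph : ∀ᵐ ζ ∂μD, ζ ∉ Metric.sphere (0 : ℂ) r :=
          ae_restrict_of_ae (compl_mem_ae_iff.2 (Measure.addHaar_sphere _ _ _))
        filter_upwards [hsph] with ζ hζ
        rw [norm_mul]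
        have h0 : 0 ≤ ∑' j : ℤ, ‖fc j φ‖ := tsum_nonneg fun _ => norm_nonneg _
        have h1 : r⁻¹ ≤ 2 := by
          rw [show (2 : ℝ) = (1 / 2)⁻¹ by norm_num]
          exact inv_anti₀ (by norm_num) hr.le
        gcongr
        refine (norm_cauchyPairing_le φ hr0 (by simpa using hζ)).trans ?_
        gcongr
      · filter_upwards [ae_restrict_mem isOpen_disk.measurableSet] with ζ hζ
        exact (tendsto_cauchyPairing φ hζ).const_mul _
    have hval : ∫ ζ in disk, g ζ * cauchyLimit φ ζ = ofCoeff _ (polyBdd_cauchyCoeff hq) φ := by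
      rw [← integral_cauchyLimit hq]
      refine integral_congr_ae ?_
      filter_upwards [hgq] with ζ hζ
      rw [hζ]
    rw [hval] at hlim
    refine hlim.congr' ?_
    filter_upwards [self_mem_nhdsWithin] with r hr
    rw [hpair r hr]

/-! ### The regular radii -/

lemma ae_integrableOn_cauchy {f : ℂ → ℂ} (hf : IntegrableOn f disk) :
    ∀ᵐ z ∂μD, IntegrableOn (fun ζ => f ζ / (ζ - z)) disk :=
  (integrable_cauchy_prod hf).prod_right_ae

lemma regularRadii_congr {f g : ℂ → ℂ} (hfg : f =ᵐ[μD] g) : regularRadii g ⊆ regularRadii f := by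
  intro r hr
  rw [mem_regularRadii] at hr ⊢
  refine ⟨hr.1, hr.2.congr ?_⟩
  have h1 := (Measure.quasiMeasurePreserving_snd (μ := μT) (ν := μD)).ae_eq_comp hfg
  filter_upwards [h1] with q hq
  have : f q.2 = g q.2 := hq
  rw [this]

/-- The function Φ(z) = ∫ |f(ζ)/(ζ - z)| is integrable over the disk. In polar coordinates Tonelli
makes its integral over almost every circle finite. -/
lemma volume_sdiff_regularRadii {f : ℂ → ℂ} (hf : IntegrableOn f disk) :
    volume (Ioo (0 : ℝ) 1 \ regularRadii f) = 0 := by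
  -- A circle is a null set, so a representative measurable everywhere is needed before restricting
  -- to circles.
  obtain ⟨g, hg, hfg⟩ := hf.1
  refine measure_mono_null (sdiff_subset_sdiff_right (regularRadii_congr hfg)) ?_
  have hgi : IntegrableOn g disk := hf.congr hfg
  have hG : Measurable fun p : ℂ × ℂ => ‖g p.2 / (p.2 - p.1)‖ₑ :=
    ((hg.measurable.comp measurable_snd).div (measurable_snd.sub measurable_fst)).enorm
  let Φ : ℂ → ENNReal := fun z => ∫⁻ ζ, ‖g ζ / (ζ - z)‖ₑ ∂μD
  have hΦ : Measurable Φ := hG.lintegral_prod_right'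
  have hfin : ∫⁻ z, Φ z ∂μD < ⊤ := by
    have h := (integrable_cauchy_prod hgi).2
    rwa [HasFiniteIntegral, lintegral_prod _ hG.aemeasurable] at h
  rw [← lintegral_indicator isOpen_disk.measurableSet, ← Complex.lintegral_comp_polarCoord_symm,
    polarCoord_target, Measure.volume_eq_prod, ← Measure.prod_restrict] at hfin
  have hmeas : Measurable fun p : ℝ × ℝ =>
      ENNReal.ofReal p.1 • disk.indicator Φ (Complex.polarCoord.symm p) := by
    refine (ENNReal.measurable_ofReal.comp measurable_fst).mul ((hΦ.indicator isOpen_disk.measurableSet).comp ?_)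
    have : (⇑Complex.polarCoord.symm) = fun p : ℝ × ℝ => (p.1 : ℂ) * exp (p.2 * I) :=
      funext polarCoord_symm_eq
    rw [this]
    fun_prop
  rw [lintegral_prod _ hmeas.aemeasurable] at hfin
  have hae := ae_lt_top (hmeas.lintegral_prod_right') hfin.ne
  rw [ae_restrict_iff' measurableSet_Ioi] at hae
  refine measure_mono_null ?_ hae
  rintro r ⟨hr, hrR⟩ hcon
  apply hrR
  have h1 := hcon hr.1
  have h2 : ∀ θ : ℝ, ENNReal.ofReal r • disk.indicator Φ (Complex.polarCoord.symm (r, θ)) =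
      ENNReal.ofReal r * Φ (circleMap 0 r θ) := by
    intro θ
    have h3 : Complex.polarCoord.symm (r, θ) = circleMap 0 r θ := by
      rw [polarCoord_symm_eq, circleMap, zero_add]
    rw [h3, indicator_of_mem (circleMap_mem_disk hr θ), smul_eq_mul]
  have hΦc : Measurable fun θ => Φ (circleMap 0 r θ) :=
    hΦ.comp (continuous_circleMap 0 r).measurable
  simp only [h2] at h1
  rw [lintegral_const_mul _ hΦc] at h1
  have h4 : ∫⁻ θ in Ioo (-Real.pi) Real.pi, Φ (circleMap 0 r θ) < ⊤ := by
    by_contra h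
    rw [not_lt, top_le_iff] at h
    rw [h, ENNReal.mul_top (by simpa using hr.1)] at h1
    exact lt_irrefl _ h1
  -- Polar coordinates use angles in (-π, π), regular radii use (0, 2π]; periodicity identifies the
  -- two integrals.
  have h5 : ∫⁻ θ in Ioc 0 (2 * Real.pi), Φ (circleMap 0 r θ) < ⊤ := by
    have e1 := isAddFundamentalDomain_Ioc Real.two_pi_pos (-Real.pi)
    have e2 := isAddFundamentalDomain_Ioc Real.two_pi_pos 0
    have e3 := e2.setLIntegral_eq e1 (fun θ => Φ (circleMap 0 r θ)) fun g θ => by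
      obtain ⟨k, hk⟩ := AddSubgroup.mem_zmultiples_iff.1 g.2
      have : g +ᵥ θ = θ + k • (2 * Real.pi) := by
        rw [hk, add_comm]
        rfl
      rw [this, (periodic_circleMap 0 r).zsmul k θ]
    rw [zero_add] at e3
    rw [e3, show -Real.pi + 2 * Real.pi = Real.pi by ring,
      ← Measure.restrict_congr_set (Ioo_ae_eq_Ioc (μ := volume))]
    exact h4
  have hGr : Measurable fun q : ℝ × ℂ => g q.2 / (q.2 - circleMap 0 r q.1) :=
    (hg.measurable.comp measurable_snd).div
      (measurable_snd.sub ((continuous_circleMap 0 r).measurable.comp measurable_fst))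
  refine mem_regularRadii.2 ⟨hr, hGr.aestronglyMeasurable, ?_⟩
  rw [HasFiniteIntegral, lintegral_prod _ hGr.enorm.aemeasurable]
  exact h5

lemma continuousAt_circlePairing {u : ℂ → ℂ} (hu : ContinuousOn u disk) (φ : CircleTest) {r : ℝ}
    (hr : r ∈ Ioo (0 : ℝ) 1) : ContinuousAt (circlePairing u φ) r := by
  obtain ⟨s, hs1, hs2⟩ := exists_between hr.2
  have hsub : Metric.closedBall (0 : ℂ) s ⊆ disk := Metric.closedBall_subset_ball hs2
  obtain ⟨C, hC⟩ := (isCompact_closedBall (0 : ℂ) s).exists_bound_of_continuousOn (hu.mono hsub)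
  obtain ⟨B, hB⟩ := exists_derivBound 0 φ
  have hev : ∀ᶠ x in 𝓝 r, x ∈ Ioo 0 s := Ioo_mem_nhds hr.1 hs1
  refine intervalIntegral.continuousAt_of_dominated_interval (bound := fun _ => C * B) ?_ ?_
    (by simp) ?_
  · filter_upwards [hev] with x hx
    have h1 : Continuous fun θ => u (circleMap 0 x θ) :=
      hu.comp_continuous (continuous_circleMap 0 x) (circleMap_mem_disk ⟨hx.1, hx.2.trans hs2⟩)
    exact (h1.mul (continuous_test φ)).aestronglyMeasurable
  · filter_upwards [hev] with x hx
    refine Eventually.of_forall fun θ _ => ?_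
    have h1 := hC (circleMap 0 x θ) (by simp [abs_of_pos hx.1, hx.2.le])
    have h2 : ‖φ.1 θ‖ ≤ B := hB 0 le_rfl θ
    rw [norm_mul]
    exact mul_le_mul h1 h2 (norm_nonneg _) ((norm_nonneg _).trans h1)
  · refine Eventually.of_forall fun θ _ => ContinuousAt.mul ?_ continuousAt_const
    have h1 : ContinuousAt u (circleMap 0 r θ) :=
      hu.continuousAt (isOpen_disk.mem_nhds (circleMap_mem_disk hr θ))
    refine ContinuousAt.comp (f := fun x : ℝ => circleMap 0 x θ) h1 ?_
    simp only [circleMap]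
    fun_prop

/-- For continuous functions, a boundary value along almost all radii is a boundary value. -/
lemma BV.of_ae {R : Set ℝ} {u : ℂ → ℂ} {L : CircleTest →ₗ[ℂ] ℂ} (h : BV R u L)
    (hu : ContinuousOn u disk) (hR : volume (Ioo (0 : ℝ) 1 \ R) = 0) : BV (Ioo 0 1) u L := by
  refine ⟨h.1, fun r hr => ?_, fun φ => ?_⟩
  · exact (hu.comp_continuous (continuous_circleMap 0 r) (circleMap_mem_disk hr)).intervalIntegrable
      _ _
  · rw [Metric.tendsto_nhdsWithin_nhds]
    intro ε hε
    obtain ⟨δ, hδ, hlim⟩ := Metric.tendsto_nhdsWithin_nhds.1 (h.2.2 φ) (ε / 2) (half_pos hε)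
    refine ⟨δ, hδ, fun {r} hr hrδ => ?_⟩
    refine lt_of_le_of_lt ?_ (half_lt_self hε)
    by_contra! hcon
    -- If the pairing at some r were still ε away from its limit, then by continuity it would be
    -- more than ε/2 away on an open interval around r. Such an interval has positive measure and
    -- must contain a radius of R.
    have hc : ContinuousAt (fun x => dist (circlePairing u φ x) (L φ)) r :=
      (continuousAt_circlePairing hu φ hr).dist continuousAt_const
    have hev : ∀ᶠ x in 𝓝 r, x ∈ Ioo (0 : ℝ) 1 ∧ dist x 1 < δ ∧
        ε / 2 < dist (circlePairing u φ x) (L φ) := by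
      have h2 : ∀ᶠ x in 𝓝 r, dist x 1 < δ :=
        (continuous_id.dist continuous_const).continuousAt.eventually (gt_mem_nhds hrδ)
      filter_upwards [Ioo_mem_nhds hr.1 hr.2, h2, hc.eventually (lt_mem_nhds hcon)]
        with x a b c using ⟨a, b, c⟩
    obtain ⟨V, hVsub, hVo, hrV⟩ := mem_nhds_iff.1 hev
    have hVR : V ⊆ Ioo (0 : ℝ) 1 \ R := by
      intro x hx
      obtain ⟨a, b, c⟩ := hVsub hx
      exact ⟨a, fun hxR => absurd (hlim hxR b) (not_lt.2 c.le)⟩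
    exact (hVo.measure_pos volume ⟨r, hrV⟩).ne' (measure_mono_null hVR hR)

/-! ### The area integral -/

/-- The holomorphic part of the integrand of the area integral. -/
def hol (q : ℂ → ℂ) (z ζ : ℂ) : ℂ :=
  -q ζ + conj (q ζ) * ((1 + z * conj ζ) / (1 - z * conj ζ))

/-- The Taylor coefficients of the holomorphic part of the area integral. -/
def areaCoeff (q : ℂ → ℂ) (k : ℤ) : ℂ :=
  (if k = 0 then -moment q 0 else 0) + oneTwo k * conj (moment q k)

lemma norm_oneTwo_le (k : ℤ) : ‖oneTwo k‖ ≤ 2 := by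
  rw [oneTwo]
  split_ifs <;> simp

lemma polyBdd_areaCoeff {q : ℂ → ℂ} (hq : IntegrableOn q disk) : PolyBdd (areaCoeff q) := by
  refine polyBdd_of_le (C := (∫ ζ in disk, ‖q ζ‖) + 2 * ∫ ζ in disk, ‖q ζ‖) fun k => ?_
  have h0 : 0 ≤ ∫ ζ in disk, ‖q ζ‖ := integral_nonneg fun _ => norm_nonneg _
  refine (norm_add_le _ _).trans (add_le_add ?_ ?_)
  · split_ifs
    · rw [norm_neg]
      exact norm_moment_le q 0 hq
    · rwa [norm_zero]
  · rw [norm_mul, norm_conj]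
    gcongr
    · exact norm_oneTwo_le k
    · exact norm_moment_le q k hq

lemma mul_conj_mem {z ζ : ℂ} (hz : z ∈ disk) (hζ : ζ ∈ disk) : ‖z * conj ζ‖ ≤ ‖z‖ ∧ ‖z‖ < 1 := by
  have h1 : ‖z‖ < 1 := by simpa [disk] using hz
  have h2 : ‖ζ‖ < 1 := by simpa [disk] using hζ
  rw [norm_mul, norm_conj]
  exact ⟨mul_le_of_le_one_right (norm_nonneg _) h2.le, h1⟩

lemma integrableOn_hol {q : ℂ → ℂ} (hq : IntegrableOn q disk) {z : ℂ} (hz : z ∈ disk) :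
    IntegrableOn (hol q z) disk := by
  have hqc : IntegrableOn (fun ζ => conj (q ζ)) disk :=
    conjCLE.toContinuousLinearMap.integrable_comp hq
  refine (hq.neg).add (hqc.mul_bdd (c := 2 / (1 - ‖z‖)) ?_ ?_)
  · exact ((((measurable_const.mul continuous_conj.measurable).const_add 1).div
      ((measurable_const.mul continuous_conj.measurable).const_sub 1))).aestronglyMeasurable
  · filter_upwards [ae_restrict_mem isOpen_disk.measurableSet] with ζ hζ
    obtain ⟨h1, h2⟩ := mul_conj_mem hz hζ
    rw [norm_div]
    have h3 : ‖1 + z * conj ζ‖ ≤ 2 := by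
      refine (norm_add_le _ _).trans ?_
      rw [norm_one]
      linarith
    have h4 : 1 - ‖z‖ ≤ ‖1 - z * conj ζ‖ := by
      have := norm_sub_norm_le (1 : ℂ) (z * conj ζ)
      rw [norm_one] at this
      linarith
    have h5 : 0 < 1 - ‖z‖ := by linarith
    gcongr

/-- Expand (1 + zζ̄)/(1 - zζ̄) = 1 + 2 Σ (zζ̄)^k and integrate termwise; conjugate moments appear,
and -q enters only the constant coefficient. -/
lemma integral_hol {q : ℂ → ℂ} (hq : IntegrableOn q disk) {z : ℂ} (hz : z ∈ disk) :
    ∫ ζ in disk, hol q z ζ = ps (areaCoeff q) z := by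
  have hz1 : ‖z‖ < 1 := by simpa [disk] using hz
  have hqc : IntegrableOn (fun ζ => conj (q ζ)) disk :=
    conjCLE.toContinuousLinearMap.integrable_comp hq
  have hgeo : Summable fun k : ℕ => 2 * ‖z‖ ^ k :=
    (summable_geometric_of_lt_one (norm_nonneg z) hz1).mul_left 2
  have h := hasSum_integral_of_dominated_convergence (μ := μD)
    (F := fun (k : ℕ) ζ => (if k = 0 then -q ζ else 0) +
      conj (q ζ) * (oneTwo k * (z * conj ζ) ^ k)) (f := hol q z)
    (fun k ζ => (if k = 0 then ‖q ζ‖ else 0) + ‖q ζ‖ * (2 * ‖z‖ ^ k)) (fun k => ?_) (fun k => ?_)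
    ?_ ?_ ?_
  · suffices h' : HasSum (fun k : ℕ => areaCoeff q k * z ^ k) (∫ ζ in disk, hol q z ζ) from
      h'.tsum_eq.symm
    refine h.congr_fun fun k => ?_
    have e1 : Integrable (fun ζ => if k = 0 then -q ζ else 0) μD := by
      split_ifs
      · exact hq.neg
      · exact integrable_zero _ _ _
    have e2 : Integrable (fun ζ => conj (q ζ) * conj ζ ^ k) μD := by
      refine Integrable.mul_bdd (c := 1) hqc (by fun_prop) ?_
      filter_upwards [ae_restrict_mem isOpen_disk.measurableSet] with ζ hζ
      have h2 : ‖ζ‖ < 1 := by simpa [disk] using hζ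
      rw [norm_pow, norm_conj]
      exact pow_le_one₀ (norm_nonneg _) h2.le
    have e3 : ∀ ζ, conj (q ζ) * (oneTwo k * (z * conj ζ) ^ k) =
        oneTwo k * z ^ k * (conj (q ζ) * conj ζ ^ k) := fun ζ => by
      rw [mul_pow]
      ring
    simp only [e3]
    rw [integral_add e1 (e2.const_mul _), integral_const_mul]
    have e4 : ∫ ζ in disk, conj (q ζ) * conj ζ ^ k = conj (moment q k) := by
      rw [moment, ← integral_conj]
      simp
    rw [e4, areaCoeff]
    rcases eq_or_ne k 0 with rfl | hk
    · simp [moment, integral_neg]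
    · simp [hk]
      ring
  · refine AEStronglyMeasurable.add ?_ (hqc.1.mul (by fun_prop))
    split_ifs
    · exact hq.1.neg
    · exact aestronglyMeasurable_const
  · filter_upwards [ae_restrict_mem isOpen_disk.measurableSet] with ζ hζ
    refine (norm_add_le _ _).trans (add_le_add ?_ ?_)
    · split_ifs <;> simp
    · rw [norm_mul, norm_conj, norm_mul, norm_pow]
      gcongr
      · exact norm_oneTwo_le _
      · exact (mul_conj_mem hz hζ).1
  · refine Eventually.of_forall fun ζ => ?_
    exact (hasSum_ite_eq 0 ‖q ζ‖).summable.add (hgeo.mul_left _)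
  · have : ∀ ζ, ∑' k : ℕ, ((if k = 0 then ‖q ζ‖ else 0) + ‖q ζ‖ * (2 * ‖z‖ ^ k)) =
        ‖q ζ‖ + ‖q ζ‖ * ∑' k : ℕ, 2 * ‖z‖ ^ k := fun ζ => by
      rw [(hasSum_ite_eq 0 ‖q ζ‖).summable.tsum_add (hgeo.mul_left _), tsum_ite_eq, tsum_mul_left]
    simp only [this]
    exact hq.norm.add (hq.norm.mul_const _)
  · filter_upwards [ae_restrict_mem isOpen_disk.measurableSet] with ζ hζ
    obtain ⟨h1, h2⟩ := mul_conj_mem hz hζ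
    exact (hasSum_ite_eq 0 (-q ζ)).add ((hasSum_oneTwo (h1.trans_lt h2)).mul_left _)

/-- The boundary value of the area integral of order one is imaginary. -/
lemma rePart_area {q : ℂ → ℂ} (hq : IntegrableOn q disk) (φ : CircleTest) :
    rePart ((2 : ℂ) • ofCoeff _ (polyBdd_cauchyCoeff hq) +
      hdist _ (polyBdd_areaCoeff hq) : CircleTest →ₗ[ℂ] ℂ) φ = 0 := by
  have hp : (Real.pi : ℂ) ≠ 0 := by exact_mod_cast Real.pi_ne_zero
  have hconj2 : conj (2 : ℂ) = 2 := map_ofNat _ 2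
  have hC : ∀ φ, ∃ a, HasSum (fun k : ℕ => moment q (k + 1) * fc (k + 1) φ) a ∧
      ofCoeff _ (polyBdd_cauchyCoeff hq) φ = -(2 * Real.pi) * a := by
    intro φ
    have h := (hasSum_cauchyCoeff hq φ).mul_left (-(2 * Real.pi) : ℂ)⁻¹
    have hne : (-(2 * Real.pi) : ℂ) ≠ 0 := neg_ne_zero.2 (mul_ne_zero two_ne_zero hp)
    simp only [← mul_assoc, inv_mul_cancel₀ hne, one_mul] at h
    exact ⟨_, h, by rw [← mul_assoc, mul_inv_cancel₀ hne, one_mul]⟩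
  have hH : ∀ φ, ∃ b, HasSum (fun k : ℕ => conj (moment q (k + 1)) * fc (-(k + 1)) φ) b ∧
      hdist _ (polyBdd_areaCoeff hq) φ =
        2 * Real.pi * ((-moment q 0 + conj (moment q 0)) * fc 0 φ + 2 * b) := by
    intro φ
    have h := (summable_mul_fc_neg (polyBdd_areaCoeff hq) φ).of_norm.hasSum
    rw [← hasSum_nat_add_iff' 1] at h
    have h1 : ∀ k : ℕ, areaCoeff q (k + 1 : ℕ) * fc (-(k + 1 : ℕ)) φ =
        2 * (conj (moment q (k + 1)) * fc (-(k + 1)) φ) := fun k => by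
      have : ((k + 1 : ℕ) : ℤ) ≠ 0 := by lia
      rw [areaCoeff, if_neg this, oneTwo, if_neg this]
      push_cast
      ring
    simp only [h1] at h
    have h2 := h.mul_left (2 : ℂ)⁻¹
    simp only [← mul_assoc, inv_mul_cancel₀ (two_ne_zero (α := ℂ)), one_mul] at h2
    refine ⟨_, h2, ?_⟩
    rw [hdist_apply, tsum_mul_left]
    simp [areaCoeff, oneTwo]
  obtain ⟨a, ha, ha'⟩ := hC φ
  obtain ⟨b, hb, hb'⟩ := hH φ
  obtain ⟨a', ha1, ha2⟩ := hC (conjTest φ)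
  obtain ⟨b', hb1, hb2⟩ := hH (conjTest φ)
  -- Conjugation exchanges the frequencies k + 1 and -(k + 1). The Cauchy part at the conjugate of φ
  -- is therefore the conjugate of the holomorphic part at φ up to sign, apart from the constant
  -- term, and everything cancels in the real part.
  have e1 : conj a' = b := by
    refine (hasSum_conj'.2 ha1).unique (hb.congr_fun fun k => ?_)
    rw [fc_conjTest, map_mul, conj_conj]
  have e2 : conj b' = a := by
    refine (hasSum_conj'.2 hb1).unique (ha.congr_fun fun k => ?_)
    rw [fc_conjTest, map_mul, conj_conj, conj_conj, neg_neg]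
  rw [rePart_apply]
  simp only [LinearMap.add_apply, LinearMap.smul_apply, smul_eq_mul, ha', hb', ha2, hb2, map_add,
    map_mul, map_neg, e1, e2, fc_conjTest, neg_zero, conj_conj, hconj2, conj_ofReal]
  ring

/-! ### The area term of the solution -/

lemma conj_X (ζ : ℂ) : conj (X ζ) = X ζ := by
  simp only [X, map_add, conj_conj]
  ring

/-- As X ζ is real, its powers can be absorbed into q and its conjugate alike. -/
lemma X_pow_mul_hol (q : ℂ → ℂ) (j : ℕ) (z ζ : ℂ) :
    X ζ ^ j * hol q z ζ = hol (mulX q j) z ζ := by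
  simp only [hol, mulX, map_mul, map_pow, conj_X]
  ring

/-- The holomorphic functions in the area term. -/
def areaHol (f : ℂ → ℂ) (j : ℕ) (z : ℂ) : ℂ :=
  (-1) ^ j / (j.factorial : ℂ) * ps (areaCoeff (mulX (fun ζ => f ζ / ζ) j)) z

lemma differentiableOn_areaHol {f : ℂ → ℂ} (hf₀ : IntegrableOn (fun ζ => f ζ / ζ) disk) (j : ℕ) :
    DifferentiableOn ℂ (areaHol f j) disk :=
  (polyBdd_areaCoeff (integrableOn_mulX hf₀ j)).differentiableOn_ps.const_mul _

/-- The area term of order `m + 1`. -/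
def areaTerm (f : ℂ → ℂ) (m : ℕ) (z : ℂ) : ℂ :=
  -(1 / (2 * Real.pi)) * (2 * pot f m z + appell (areaHol f) m z)

lemma ae_ne_disk (z : ℂ) : ∀ᵐ ζ ∂μD, ζ ≠ z :=
  ae_restrict_of_ae (compl_mem_ae_iff.2 (measure_singleton z))

/-- Partial fractions: (ζ + z)/(ζ(ζ - z)) = 2/(ζ - z) - 1/ζ. The first term is the singular kernel
acting on f; the second joins the part that is holomorphic in z up to powers of X. -/
lemma areaIntegrand_eq (f : ℂ → ℂ) (m : ℕ) {z ζ : ℂ} (h0 : ζ ≠ 0) (hz : ζ ≠ z) :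
    (-1) ^ m / (m.factorial : ℂ) * areaIntegrand (m + 1) f z ζ =
      2 * (f ζ * κ m (ζ - z)) + shiftX m ζ z * hol (fun ζ => f ζ / ζ) z ζ := by
  have h1 : ζ - z ≠ 0 := sub_ne_zero.2 hz
  have h2 : f ζ / ζ * ((ζ + z) / (ζ - z)) = 2 * (f ζ * (ζ - z)⁻¹) - f ζ / ζ := by
    field_simp
    ring
  rw [areaIntegrand, h2, Nat.add_sub_cancel, κ_sub, hol, map_div₀]
  change _ * (_ * X (ζ - z) ^ m) = _
  rw [shiftX]
  ring

lemma integrable_shiftX_mul_hol {q : ℂ → ℂ} (hq : IntegrableOn q disk) (m : ℕ) {z : ℂ}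
    (hz : z ∈ disk) : IntegrableOn (fun ζ => shiftX m ζ z * hol q z ζ) disk ∧
      ∫ ζ in disk, shiftX m ζ z * hol q z ζ =
        appell (fun j z => (-1) ^ j / (j.factorial : ℂ) * ps (areaCoeff (mulX q j)) z) m z := by
  have h1 : ∀ ζ, shiftX m ζ z * hol q z ζ = ∑ p ∈ Finset.HasAntidiagonal.antidiagonal m,
      Xf p.1 z * ((-1) ^ p.2 / (p.2.factorial : ℂ)) * hol (mulX q p.2) z ζ := by
    intro ζ
    rw [shiftX_eq, appell, Finset.sum_mul]
    refine Finset.sum_congr rfl fun p _ => ?_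
    rw [← X_pow_mul_hol]
    ring
  have h2 : ∀ p ∈ Finset.HasAntidiagonal.antidiagonal m, Integrable (fun ζ =>
      Xf p.1 z * ((-1) ^ p.2 / (p.2.factorial : ℂ)) * hol (mulX q p.2) z ζ) μD := fun p _ =>
    Integrable.const_mul (integrableOn_hol (integrableOn_mulX hq p.2) hz) _
  simp only [h1]
  refine ⟨integrable_finsetSum _ h2, ?_⟩
  rw [integral_finsetSum _ h2]
  refine Finset.sum_congr rfl fun p _ => ?_
  rw [integral_const_mul, integral_hol (integrableOn_mulX hq p.2) hz, mul_assoc]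

lemma integrableOn_κ_of_pos {f : ℂ → ℂ} (hf : IntegrableOn f disk) (m : ℕ) {z : ℂ}
    (hz : z ∈ disk) : IntegrableOn (fun ζ => f ζ * κ (m + 1) (ζ - z)) disk := by
  refine Integrable.mul_bdd (c := 2 * 4 ^ m) hf
    ((measurable_κ (m + 1)).comp (measurable_id.sub_const z)).aestronglyMeasurable ?_
  filter_upwards [ae_restrict_mem isOpen_disk.measurableSet] with ζ hζ
  exact norm_κ_succ_le m (norm_sub_lt_two hz hζ).le

lemma integrableOn_κ {f : ℂ → ℂ} {z : ℂ} (hz : z ∈ disk)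
    (hfz : IntegrableOn (fun ζ => f ζ / (ζ - z)) disk) (m : ℕ) :
    IntegrableOn (fun ζ => f ζ * κ m (ζ - z)) disk := by
  refine (Integrable.bdd_mul (c := 4 ^ m) (f := fun ζ => shiftX m ζ z) hfz ?_ ?_).congr
    (Eventually.of_forall fun ζ => ?_)
  · exact (continuous_const.mul ((continuous_X.comp (continuous_id.sub continuous_const)).pow
      m)).aestronglyMeasurable
  · filter_upwards [ae_restrict_mem isOpen_disk.measurableSet] with ζ hζ
    exact norm_κ_coeff_le m (norm_sub_lt_two hz hζ).le
  · simp only [κ_sub, div_eq_mul_inv]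
    ring

lemma area_eq {f : ℂ → ℂ} (hf₀ : IntegrableOn (fun ζ => f ζ / ζ) disk) {m : ℕ} {z : ℂ}
    (hz : z ∈ disk) (hκ : IntegrableOn (fun ζ => f ζ * κ m (ζ - z)) disk) :
    IntegrableOn (areaIntegrand (m + 1) f z) disk ∧
      (-1) ^ (m + 1) / (2 * Real.pi * (m.factorial : ℂ)) *
        ∫ ζ in disk, areaIntegrand (m + 1) f z ζ = areaTerm f m z := by
  obtain ⟨h1, h2⟩ := integrable_shiftX_mul_hol hf₀ m hz
  have hc : (-1) ^ m / (m.factorial : ℂ) ≠ 0 :=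
    div_ne_zero (pow_ne_zero _ (by norm_num)) (by exact_mod_cast m.factorial_ne_zero)
  have hae : (fun ζ => 2 * (f ζ * κ m (ζ - z)) + shiftX m ζ z * hol (fun ζ => f ζ / ζ) z ζ)
      =ᵐ[μD] fun ζ => (-1) ^ m / (m.factorial : ℂ) * areaIntegrand (m + 1) f z ζ := by
    filter_upwards [ae_ne_disk 0, ae_ne_disk z] with ζ h0 hz
    exact (areaIntegrand_eq f m h0 hz).symm
  have hint := Integrable.congr ((hκ.const_mul 2).add h1) hae
  refine ⟨?_, ?_⟩
  · have := hint.const_mul ((-1) ^ m / (m.factorial : ℂ))⁻¹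
    simp only [← mul_assoc, inv_mul_cancel₀ hc, one_mul] at this
    exact this
  · have h3 := integral_congr_ae hae
    rw [integral_add (hκ.const_mul 2) h1, integral_const_mul, integral_const_mul, h2] at h3
    have h4 : 2 * pot f m z + appell (areaHol f) m z =
        (-1) ^ m / (m.factorial : ℂ) * ∫ ζ in disk, areaIntegrand (m + 1) f z ζ := h3
    rw [areaTerm, h4, pow_succ]
    have hp : (Real.pi : ℂ) ≠ 0 := by exact_mod_cast Real.pi_ne_zero
    have hm : (m.factorial : ℂ) ≠ 0 := by exact_mod_cast m.factorial_ne_zero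
    field_simp

lemma zero_mem_disk : (0 : ℂ) ∈ disk := by simp [disk]

/-- At z = 0 the two summands of the integrand are conjugate to each other and the power of X is
real. -/
lemma im_areaTerm_zero {f : ℂ → ℂ} (hf₀ : IntegrableOn (fun ζ => f ζ / ζ) disk) (m : ℕ) :
    (areaTerm f m 0).im = 0 := by
  rw [← (area_eq hf₀ zero_mem_disk (integrableOn_κ zero_mem_disk (by simpa using hf₀) m)).2,
    ← conj_eq_iff_im]
  have h1 : ∀ ζ, conj (areaIntegrand (m + 1) f 0 ζ) = areaIntegrand (m + 1) f 0 ζ := by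
    intro ζ
    rcases eq_or_ne ζ 0 with rfl | hζ
    · simp [areaIntegrand]
    · simp only [areaIntegrand, add_zero, sub_zero, zero_mul, div_self hζ, mul_one, div_one,
        map_mul, map_pow, map_add, conj_conj, map_div₀]
      ring
  rw [map_mul, ← integral_conj]
  simp only [h1]
  simp [map_ofNat (starRingEnd ℂ) 2]

lemma dbar_areaTerm {f : ℂ → ℂ} (hf : IntegrableOn f disk)
    (hf₀ : IntegrableOn (fun ζ => f ζ / ζ) disk) {m : ℕ} {z : ℂ} (hz : z ∈ disk)
    (h : 0 < m ∨ IntegrableOn (fun ζ => f ζ / (ζ - z)) disk) :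
    DifferentiableAt ℝ (areaTerm f (m + 1)) z ∧ dbar (areaTerm f (m + 1)) z = areaTerm f m z := by
  have hH : ∀ j, DifferentiableAt ℂ (areaHol f j) z := fun j =>
    (differentiableOn_areaHol hf₀ j).differentiableAt (isOpen_disk.mem_nhds hz)
  have h1 : DifferentiableAt ℝ (pot f (m + 1)) z ∧ dbar (pot f (m + 1)) z = pot f m z := by
    rcases h with h | h
    · obtain ⟨m, rfl⟩ := Nat.exists_eq_succ_of_ne_zero h.ne'
      exact dbar_pot_succ_succ hf m hz
    · exact dbar_pot_succ hf m hz h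
  have h2 := differentiableAt_appell hH (m + 1)
  refine ⟨((h1.1.const_mul 2).add h2).const_mul _, ?_⟩
  change dbar (fun z => -(1 / (2 * Real.pi) : ℂ) *
    (2 * pot f (m + 1) z + appell (areaHol f) (m + 1) z)) z = _
  have h3 : DifferentiableAt ℝ
      (fun z => 2 * pot f (m + 1) z + appell (areaHol f) (m + 1) z) z := (h1.1.const_mul 2).add h2
  rw [dbar_const_mul _ h3, dbar_add (h1.1.const_mul 2) h2,
    dbar_const_mul _ h1.1, h1.2, dbar_appell_succ hH, areaTerm]

lemma IsWeakDbar.const_mul {m : ℕ} {u v : ℂ → ℂ} (h : IsWeakDbar m u v) (c : ℂ) :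
    IsWeakDbar m (fun z => c * u z) (fun z => c * v z) := by
  refine ⟨h.1.smul c, h.2.1.smul c, fun φ h1 h2 h3 => ?_⟩
  simp only [mul_assoc, integral_const_mul]
  rw [h.2.2 φ h1 h2 h3]
  ring

lemma isWeakDbar_of_eqOn {u v : ℂ → ℂ} (hu : ContDiffOn ℝ ∞ u disk) (h : EqOn (dbar u) v disk) :
    IsWeakDbar 1 u v := by
  refine (isWeakDbar_of_contDiffOn hu).congr EventuallyEq.rfl ?_
  filter_upwards [ae_restrict_mem isOpen_disk.measurableSet] with z hz using h hz

lemma isWeakDbar_areaTerm_succ {f : ℂ → ℂ} (hf : IntegrableOn f disk)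
    (hf₀ : IntegrableOn (fun ζ => f ζ / ζ) disk) (m : ℕ) :
    IsWeakDbar 1 (areaTerm f (m + 1)) (areaTerm f m) := by
  have h1 := contDiffOn_appell (differentiableOn_areaHol hf₀) (m + 1)
  exact (((isWeakDbar_pot_succ hf m).const_mul 2).add (isWeakDbar_of_eqOn h1 fun z hz =>
    dbar_appell_succ (fun j => (differentiableOn_areaHol hf₀ j).differentiableAt
      (isOpen_disk.mem_nhds hz)) m)).const_mul _

/-- The constants combine to -(1/2π) · 2 · (-π) = 1. -/
lemma isWeakDbar_areaTerm_zero {f : ℂ → ℂ} (hf : IntegrableOn f disk)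
    (hf₀ : IntegrableOn (fun ζ => f ζ / ζ) disk) : IsWeakDbar 1 (areaTerm f 0) f := by
  have h1 := contDiffOn_appell (differentiableOn_areaHol hf₀) 0
  have h2 := (((isWeakDbar_pot_zero hf).const_mul 2).add (isWeakDbar_of_eqOn (v := fun _ => 0) h1
    fun z hz => dbar_appell_zero fun j => (differentiableOn_areaHol hf₀ j).differentiableAt
      (isOpen_disk.mem_nhds hz))).const_mul (-(1 / (2 * Real.pi) : ℂ))
  refine h2.congr EventuallyEq.rfl (Eventually.of_forall fun z => ?_)
  have hp : (Real.pi : ℂ) ≠ 0 := by exact_mod_cast Real.pi_ne_zero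
  simp only [add_zero]
  field_simp

lemma continuousOn_areaTerm_succ {f : ℂ → ℂ} (hf : IntegrableOn f disk)
    (hf₀ : IntegrableOn (fun ζ => f ζ / ζ) disk) (m : ℕ) :
    ContinuousOn (areaTerm f (m + 1)) disk :=
  continuousOn_const.mul ((continuousOn_const.mul (continuousOn_pot_succ hf m)).add
    (contDiffOn_appell (differentiableOn_areaHol hf₀) (m + 1)).continuousOn)

/-- The boundary value of the area term is imaginary. -/
lemma bv_areaTerm {f : ℂ → ℂ} (hf : IntegrableOn f disk)
    (hf₀ : IntegrableOn (fun ζ => f ζ / ζ) disk) (m : ℕ) :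
    ∃ L, BV (regularRadii f) (areaTerm f m) L ∧ ∀ φ, rePart L φ = 0 := by
  let q : ℕ → ℂ → ℂ := fun j => mulX (fun ζ => f ζ / ζ) j
  have hq : ∀ j, IntegrableOn (q j) disk := integrableOn_mulX hf₀
  -- Each H j couples the Cauchy transform of f X^j with its holomorphic partner. Neither has an
  -- imaginary boundary value in general, but this combination does, so `bv_appell` applies with ρ =
  -- 0.
  let H : ℕ → ℂ → ℂ := fun j z => (-(1 / (2 * Real.pi)) * ((-1) ^ j / (j.factorial : ℂ))) *
    (2 * pot (mulX f j) 0 z + ps (areaCoeff (q j)) z)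
  have hH : ∀ j ≤ m, ∃ L, BV (regularRadii f) (H j) L ∧
      ∀ φ, rePart L φ = (-1) ^ j / (j.factorial : ℂ) * (fun _ => (0 : ℂ)) ((M ^ j) φ) := by
    intro j _
    have h1 : BV (regularRadii f) (pot (mulX f j) 0) (ofCoeff _ (polyBdd_cauchyCoeff (hq j))) := by
      refine (bv_pot_zero (integrableOn_mulX hf j) (hq j) ?_).mono (regularRadii_subset f j)
      filter_upwards [ae_ne_disk 0] with ζ hζ
      simp only [q, mulX]
      field_simp
    have h2 := ((polyBdd_areaCoeff (hq j)).bv_ps).mono (R' := regularRadii f) fun r hr => hr.1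
    refine ⟨_, ((h1.const_mul 2).add h2).const_mul
      (-(1 / (2 * Real.pi)) * ((-1) ^ j / (j.factorial : ℂ))), fun φ => ?_⟩
    rw [rePart_smul (by simp [map_ofNat (starRingEnd ℂ) 2]), rePart_area (hq j)]
    simp
  obtain ⟨L, hL, hre⟩ := bv_appell (ρ := fun _ => 0) hH
  refine ⟨L, hL.congr fun r hr => ?_, fun φ => by rw [hre]; simp⟩
  -- On a regular circle the Cauchy integral converges absolutely at almost every angle, and there
  -- the potential splits into Cauchy transforms.
  filter_upwards [(mem_regularRadii.1 hr).2.prod_right_ae] with θ hθ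
  rw [areaTerm, pot_eq_appell hθ, ← appell_const_mul, ← appell_add, ← appell_const_mul]
  refine appell_congr fun j _ => ?_
  simp only [H, areaHol, q]
  ring

/-! ### The polyanalytic terms of the solution -/

/-- The sum of the polyanalytic terms of the `k`-th derivative of the solution. -/
def polySum (H : ℕ → ℕ → ℂ → ℂ) (n k : ℕ) (z : ℂ) : ℂ :=
  ∑ l ∈ Finset.Ico k n, appell (H l) (l - k) z

lemma contDiffOn_polySum {H : ℕ → ℕ → ℂ → ℂ} (hH : ∀ l j, DifferentiableOn ℂ (H l j) disk)
    (n k : ℕ) : ContDiffOn ℝ ∞ (polySum H n k) disk :=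
  ContDiffOn.sum fun l _ => contDiffOn_appell (hH l) (l - k)

lemma dbar_polySum {H : ℕ → ℕ → ℂ → ℂ} (hH : ∀ l j, DifferentiableOn ℂ (H l j) disk)
    {n k : ℕ} (hk : k < n) {z : ℂ} (hz : z ∈ disk) :
    dbar (polySum H n k) z = polySum H n (k + 1) z := by
  have hd : ∀ l j, DifferentiableAt ℂ (H l j) z := fun l j =>
    (hH l j).differentiableAt (isOpen_disk.mem_nhds hz)
  change dbar (fun z => ∑ l ∈ Finset.Ico k n, appell (H l) (l - k) z) z = _
  rw [dbar_sum (Finset.Ico k n) fun l _ => differentiableAt_appell (hd l) (l - k),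
    Finset.sum_eq_sum_Ico_succ_bot hk, Nat.sub_self, dbar_appell_zero (hd k), zero_add, polySum]
  refine Finset.sum_congr rfl fun l hl => ?_
  have h1 := Finset.mem_Ico.1 hl
  have h2 : l - k = l - (k + 1) + 1 := by lia
  rw [h2, dbar_appell_succ (hd l)]

/-- A summand with l > k has `appell` index l - k > 0, and the binomial cancellation removes its
real part; only ρ k survives. -/
lemma bv_polySum {R : Set ℝ} {H : ℕ → ℕ → ℂ → ℂ} {ρ : ℕ → CircleTest → ℂ} {n k : ℕ} (hk : k < n)
    (hH : ∀ l < n, ∀ j ≤ l, ∃ L, BV R (H l j) L ∧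
      ∀ φ, rePart L φ = (-1) ^ j / (j.factorial : ℂ) * ρ l ((M ^ j) φ)) :
    ∃ L, BV R (polySum H n k) L ∧ ∀ φ, rePart L φ = ρ k φ := by
  have h1 : ∀ l ∈ Finset.Ico k n, ∃ L, BV R (appell (H l) (l - k)) L ∧
      ∀ φ, rePart L φ = if l - k = 0 then ρ l φ else 0 := fun l hl =>
    bv_appell fun j hj => hH l (Finset.mem_Ico.1 hl).2 j (hj.trans (Nat.sub_le _ _))
  choose! L hL hre using h1
  refine ⟨∑ l ∈ Finset.Ico k n, L l, BV.sum _ hL, fun φ => ?_⟩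
  rw [rePart_sum, Finset.sum_congr rfl fun l hl => hre l hl φ, Finset.sum_eq_sum_Ico_succ_bot hk,
    Nat.sub_self, if_pos rfl, Finset.sum_eq_zero, add_zero]
  intro l hl
  rw [if_neg]
  have := Finset.mem_Ico.1 hl
  lia

/-! ### Boundary values and values at the origin of the holomorphic families -/

lemma fc_zero_mem_bdd : fc 0 ∈ bdd :=
  ⟨0, 1, zero_le_one, fun φ B hB => by
    rw [one_mul]
    exact norm_fc_le 0 φ (hB 0 le_rfl)⟩

lemma bv_const (R : Set ℝ) (c : ℂ) : BV R (fun _ => c) ((c * (2 * Real.pi)) • fc 0) := by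
  refine ⟨bdd.smul_mem _ fc_zero_mem_bdd, fun r _ => by simp, fun φ => ?_⟩
  have hp : (Real.pi : ℂ) ≠ 0 := by exact_mod_cast Real.pi_ne_zero
  have h1 : circlePairing (fun _ => c) φ = fun _ => (c * (2 * Real.pi)) * fc 0 φ := by
    funext r
    rw [circlePairing, intervalIntegral.integral_const_mul, fc_apply]
    simp only [neg_zero, e_apply, Int.cast_zero, zero_mul, exp_zero, mul_one]
    field_simp
  rw [h1]
  exact tendsto_const_nhds

lemma rePart_const (a : ℝ) (φ : CircleTest) :
    rePart ((I * a * (2 * Real.pi)) • fc 0 : CircleTest →ₗ[ℂ] ℂ) φ = 0 := by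
  simp only [rePart_apply, LinearMap.smul_apply, smul_eq_mul, fc_conjTest, neg_zero, map_mul,
    conj_conj, conj_I, conj_ofReal, map_ofNat]
  ring

/-- The holomorphic functions of which the polyanalytic terms of the solution are composed. -/
def solHol (h₀ : ℂ → ℂ) (h : ℕ → CircleDistribution) (l j : ℕ) (z : ℂ) : ℂ :=
  if l = 0 then (if j = 0 then h₀ z - I * ((taylorCoeff h₀ 0).im : ℂ) else 0) else
    (-1) ^ j / (j.factorial : ℂ) *
      (1 / (2 * Real.pi) * ps (schwarzCoeff ((h l).toLinearMap ∘ₗ M ^ j)) z)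

lemma polyBdd_dist (Λ : CircleDistribution) (j : ℕ) :
    PolyBdd (schwarzCoeff (Λ.toLinearMap ∘ₗ M ^ j)) :=
  polyBdd_schwarzCoeff (comp_M_pow_mem_bdd Λ.mem_bdd j)

lemma differentiableOn_solHol {h₀ : ℂ → ℂ} (hh₀ : h₀ ∈ Hb) (h : ℕ → CircleDistribution) (l j : ℕ) :
    DifferentiableOn ℂ (solHol h₀ h l j) disk := by
  change DifferentiableOn ℂ (fun z => solHol h₀ h l j z) disk
  simp only [solHol]
  split_ifs
  · exact hh₀.1.sub (differentiableOn_const _)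
  · exact differentiableOn_const _
  · exact ((polyBdd_dist (h l) j).differentiableOn_ps.const_mul _).const_mul _

/-- The real parts of the boundary values. -/
def boundaryData (h₀ : ℂ → ℂ) (h : ℕ → CircleDistribution) (l : ℕ) : CircleTest → ℂ :=
  if l = 0 then rePart (boundaryValue h₀) else h l

/-- For l = 0 an imaginary constant is subtracted from h₀, which leaves the real part unchanged. For
l ≥ 1 the function comes from the Schwarz transform of h l multiplied by (2 cos)^j, again a real
distribution. -/
lemma bv_solHol {h₀ : ℂ → ℂ} (hh₀ : h₀ ∈ Hb) (h : ℕ → CircleDistribution) {l : ℕ}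
    (hl : l ≠ 0 → rePart (h l) = h l) {j : ℕ} (hj : j ≤ l) :
    ∃ L, BV (Ioo 0 1) (solHol h₀ h l j) L ∧
      ∀ φ, rePart L φ = (-1) ^ j / (j.factorial : ℂ) * boundaryData h₀ h l ((M ^ j) φ) := by
  have hp : (Real.pi : ℂ) ≠ 0 := by exact_mod_cast Real.pi_ne_zero
  rcases eq_or_ne l 0 with rfl | hl0
  · obtain rfl : j = 0 := by lia
    have h1 := (bv_of_mem_Hb hh₀).add (bv_const (Ioo 0 1) (I * ((-(taylorCoeff h₀ 0).im : ℝ) : ℂ)))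
    refine ⟨_, h1.congr fun r hr => Eventually.of_forall fun θ => ?_, fun φ => ?_⟩
    · simp only [solHol, if_true, ofReal_neg]
      ring
    · rw [rePart_add, rePart_const, boundaryData, if_pos rfl, boundaryValue_eq (bv_of_mem_Hb hh₀)]
      simp
  · have hmem := comp_M_pow_mem_bdd (h l).mem_bdd j
    have hre : rePart ((h l).toLinearMap ∘ₗ M ^ j : CircleTest →ₗ[ℂ] ℂ) =
        ((h l).toLinearMap ∘ₗ M ^ j : CircleTest →ₗ[ℂ] ℂ) := by
      funext φ
      rw [rePart_comp_M_pow, hl hl0]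
      rfl
    have h1 := (((polyBdd_dist (h l) j).bv_ps).const_mul (1 / (2 * Real.pi) : ℂ)).const_mul
      ((-1) ^ j / (j.factorial : ℂ))
    refine ⟨_, h1.congr fun r hr => Eventually.of_forall fun θ => ?_, fun φ => ?_⟩
    · simp only [solHol, if_neg hl0]
    · rw [rePart_smul (by simp), rePart_smul (by simp [map_ofNat (starRingEnd ℂ) 2]),
        rePart_hdist_schwarzCoeff hmem hre, boundaryData, if_neg hl0]
      simp only [LinearMap.comp_apply]
      field_simp

/-- A Schwarz transform at 0 is the value of the distribution on the constant 1 or on a power of 2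
cos, real for real data. For l = 0 the imaginary part of h₀(0) has been subtracted. -/
lemma im_solHol_zero {h₀ : ℂ → ℂ} (h : ℕ → CircleDistribution) {l : ℕ}
    (hl : l ≠ 0 → rePart (h l) = h l) (j : ℕ) : (solHol h₀ h l j 0).im = 0 := by
  have hps : ∀ b : ℤ → ℂ, ps b 0 = b 0 := fun b => by
    rw [ps, tsum_eq_single 0 fun k hk => by simp [hk]]
    simp
  rw [solHol]
  split_ifs with h1 h2
  · have : taylorCoeff h₀ 0 = h₀ 0 := by simp [taylorCoeff]
    simp [this]
  · simp
  · rw [hps, ← conj_eq_iff_im]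
    have h3 : conj ((h l) ((M ^ j) (e 0))) = (h l) ((M ^ j) (e 0)) := by
      have h4 := congrFun (hl h1) ((M ^ j) (e 0))
      rw [rePart_apply, conjTest_M_pow, conjTest_e, neg_zero] at h4
      linear_combination 2 * h4
    simp [schwarzCoeff, oneTwo, h3, map_ofNat (starRingEnd ℂ) 2]

/-- The families of holomorphic functions of the solution, including the polynomial terms. -/
def solFam (h₀ : ℂ → ℂ) (h : ℕ → CircleDistribution) (c : ℕ → ℝ) (l j : ℕ) (z : ℂ) : ℂ :=
  (if j = 0 then I * (c l : ℂ) else 0) + solHol h₀ h l j z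

lemma differentiableOn_solFam {h₀ : ℂ → ℂ} (hh₀ : h₀ ∈ Hb) (h : ℕ → CircleDistribution)
    (c : ℕ → ℝ) (l j : ℕ) : DifferentiableOn ℂ (solFam h₀ h c l j) disk :=
  (differentiableOn_const _).add (differentiableOn_solHol hh₀ h l j)

lemma bv_solFam {h₀ : ℂ → ℂ} (hh₀ : h₀ ∈ Hb) (h : ℕ → CircleDistribution) (c : ℕ → ℝ) {l : ℕ}
    (hl : l ≠ 0 → rePart (h l) = h l) {j : ℕ} (hj : j ≤ l) :
    ∃ L, BV (Ioo 0 1) (solFam h₀ h c l j) L ∧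
      ∀ φ, rePart L φ = (-1) ^ j / (j.factorial : ℂ) * boundaryData h₀ h l ((M ^ j) φ) := by
  obtain ⟨L, hL, hre⟩ := bv_solHol hh₀ h hl hj
  have h1 := (bv_const (Ioo 0 1) (I * ((if j = 0 then c l else 0 : ℝ) : ℂ))).add hL
  refine ⟨_, h1.congr fun r hr => Eventually.of_forall fun θ => ?_, fun φ => ?_⟩
  · simp only [solFam]
    split_ifs <;> simp
  · rw [rePart_add, rePart_const, hre, zero_add]

lemma appell_solFam (h₀ : ℂ → ℂ) (h : ℕ → CircleDistribution) (c : ℕ → ℝ) (l m : ℕ) (z : ℂ) :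
    appell (solFam h₀ h c l) m z = I * (c l) * Xf m z + appell (solHol h₀ h l) m z := by
  have h1 := appell_add (fun j _ => if j = 0 then I * (c l : ℂ) else 0) (solHol h₀ h l) m z
  have h2 : appell (fun j _ => if j = 0 then I * (c l : ℂ) else 0) m z = I * (c l) * Xf m z := by
    rw [appell, Finset.sum_eq_single (m, 0)]
    · simp
      ring
    · rintro ⟨i, j⟩ hp hne
      have h3 := Finset.HasAntidiagonal.mem_antidiagonal.1 hp
      have h4 : j ≠ 0 := by
        rintro rfl
        exact hne (by simpa using h3)
      simp [h4]
    · simp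
  rw [h2] at h1
  exact h1

lemma appell_solHol (h₀ : ℂ → ℂ) (h : ℕ → CircleDistribution) {l : ℕ} (hl : l ≠ 0) {z : ℂ}
    (hz : z ∈ disk) : appell (solHol h₀ h l) l z =
      (-1) ^ l / (2 * Real.pi * (l.factorial : ℂ)) * pair (h l) (schwarzFun l z) := by
  have h1 := apply_schwarzFun (h l).toLinearMap l hz
  have h2 : ∀ j ≤ l, solHol h₀ h l j z = 1 / (2 * Real.pi) * ((-1) ^ j / (j.factorial : ℂ) *
      pair ((h l).toLinearMap ∘ₗ M ^ j : CircleTest →ₗ[ℂ] ℂ) (schwarzFun 0 z)) := by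
    intro j _
    rw [solHol, if_neg hl, pair_of_mem _ (schwarz_mem 0 hz)]
    have := apply_schwarzTest (comp_M_pow_mem_bdd (h l).mem_bdd j) hz
    rw [schwarzTest] at this
    rw [this]
    ring
  rw [appell_congr (H' := fun j z => 1 / (2 * Real.pi) * ((-1) ^ j / (j.factorial : ℂ) *
      pair ((h l).toLinearMap ∘ₗ M ^ j : CircleTest →ₗ[ℂ] ℂ) (schwarzFun 0 z))) h2,
    appell_const_mul, ← h1, pair_of_mem _ (schwarz_mem l hz)]
  ring

lemma hdist_e_zero (b : ℤ → ℂ) (hb : PolyBdd b) : hdist b hb (e 0) = 2 * Real.pi * b 0 := by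
  rw [hdist_apply, tsum_eq_single 0 fun k hk => by
    rw [fc_e, if_neg (by lia)]
    ring]
  simp [fc_e]

/-- The explicit solution is the sum of its polyanalytic terms and its area term. -/
lemma schwarzSolution_eq {n : ℕ} {f h₀ : ℂ → ℂ} (hh₀ : h₀ ∈ Hb) (h : ℕ → CircleDistribution)
    (c : ℕ → ℝ) {z : ℂ} (hz : z ∈ disk) :
    schwarzSolution (n + 1) f h₀ h c z = polySum (solFam h₀ h c) (n + 1) 0 z +
      (-1) ^ (n + 1) / (2 * Real.pi * (n.factorial : ℂ)) *
        ∫ ζ in disk, areaIntegrand (n + 1) f z ζ := by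
  have hp : (Real.pi : ℂ) ≠ 0 := by exact_mod_cast Real.pi_ne_zero
  have hbv := boundaryValue_eq (bv_of_mem_Hb hh₀)
  have hone : (fun _ => 1 : ℝ → ℂ) = (e 0).1 := by
    funext t
    simp [e_apply]
  -- The total mass of the boundary value is 2π h₀(0), so the term I of the formula is i Im h₀(0).
  have h1 : pair (imPart (boundaryValue h₀)) (fun _ => 1) =
      2 * Real.pi * ((taylorCoeff h₀ 0).im : ℂ) := by
    rw [hone, pair_of_mem _ (e 0).2]
    change (boundaryValue h₀ (e 0) - conj (boundaryValue h₀ (conjTest (e 0)))) / (2 * I) = _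
    rw [conjTest_e, neg_zero, hbv, hdist_e_zero, map_mul, map_mul, conj_ofReal, map_ofNat,
      ← mul_sub, sub_conj]
    push_cast
    field_simp
  have h2 : pair (boundaryValue h₀) (poissonFun z) = 2 * Real.pi * h₀ z := by
    rw [pair_of_mem _ (poisson_mem hz), hbv, hdist_poisson _ hz, ← eq_ps_taylorCoeff hh₀.1 hz]
  have h3 : polySum (solFam h₀ h c) (n + 1) 0 z =
      I * ∑ k ∈ Finset.range (n + 1), (c k : ℂ) / (k.factorial : ℂ) * X z ^ k +
      ((h₀ z - I * ((taylorCoeff h₀ 0).im : ℂ)) + ∑ k ∈ Finset.Icc 1 n,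
        (-1 : ℂ) ^ k / (2 * Real.pi * (k.factorial : ℂ)) * pair (h k) (schwarzFun k z)) := by
    simp only [polySum, appell_solFam, Finset.sum_add_distrib, Nat.sub_zero]
    congr 1
    · rw [Finset.mul_sum, Finset.range_eq_Ico]
      refine Finset.sum_congr rfl fun k _ => ?_
      rw [Xf]
      ring
    · rw [Finset.sum_eq_sum_Ico_succ_bot (Nat.succ_pos n), appell_zero]
      have h4 : Finset.Ico (0 + 1) (n + 1) = Finset.Icc 1 n := by
        ext k
        simp only [Finset.mem_Ico, Finset.mem_Icc]
        lia
      congr 1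
      rw [h4]
      refine Finset.sum_congr rfl fun k hk => ?_
      have := Finset.mem_Icc.1 hk
      exact appell_solHol h₀ h (by lia) hz
  rw [schwarzSolution, h1, h2, h3, Nat.add_sub_cancel]
  simp only [X]
  field_simp
  ring

/-! ### Iterated derivatives of the solution -/

/-- The `k`-th derivative of the solution of order `N + 1`. -/
def solDeriv (f h₀ : ℂ → ℂ) (h : ℕ → CircleDistribution) (c : ℕ → ℝ) (N k : ℕ) (z : ℂ) : ℂ :=
  polySum (solFam h₀ h c) (N + 1) k z + areaTerm f (N - k) z

lemma integrableOn_areaIntegrand {f : ℂ → ℂ} (hf : IntegrableOn f disk)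
    (hf₀ : IntegrableOn (fun ζ => f ζ / ζ) disk) {N : ℕ} {z : ℂ} (hz : z ∈ disk)
    (hN : 0 < N ∨ IntegrableOn (fun ζ => f ζ / (ζ - z)) disk) :
    IntegrableOn (areaIntegrand (N + 1) f z) disk ∧
      (-1) ^ (N + 1) / (2 * Real.pi * (N.factorial : ℂ)) *
        ∫ ζ in disk, areaIntegrand (N + 1) f z ζ = areaTerm f N z := by
  refine area_eq hf₀ hz ?_
  rcases hN with hN | hN
  · obtain ⟨m, rfl⟩ := Nat.exists_eq_succ_of_ne_zero hN.ne'
    exact integrableOn_κ_of_pos hf m hz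
  · exact integrableOn_κ hz hN N

lemma dbar_solDeriv {f h₀ : ℂ → ℂ} (hf : IntegrableOn f disk)
    (hf₀ : IntegrableOn (fun ζ => f ζ / ζ) disk) (hh₀ : h₀ ∈ Hb) (h : ℕ → CircleDistribution)
    (c : ℕ → ℝ) {N k : ℕ} (hk : k < N) {z : ℂ} (hz : z ∈ disk)
    (hfz : k + 1 < N ∨ IntegrableOn (fun ζ => f ζ / (ζ - z)) disk) :
    DifferentiableAt ℝ (solDeriv f h₀ h c N k) z ∧
      dbar (solDeriv f h₀ h c N k) z = solDeriv f h₀ h c N (k + 1) z := by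
  have h1 : N - k = N - (k + 1) + 1 := by lia
  have hH := differentiableOn_solFam hh₀ h c
  have h2 : DifferentiableAt ℝ (polySum (solFam h₀ h c) (N + 1) k) z :=
    (((contDiffOn_polySum hH (N + 1) k).differentiableOn (by simp)).differentiableAt
      (isOpen_disk.mem_nhds hz))
  obtain ⟨h3, h4⟩ := dbar_areaTerm hf hf₀ (m := N - (k + 1)) hz
    (hfz.imp_left fun hk => by lia)
  rw [← h1] at h3 h4
  refine ⟨h2.add h3, ?_⟩
  change dbar (fun z => polySum (solFam h₀ h c) (N + 1) k z + areaTerm f (N - k) z) z = _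
  rw [dbar_add h2 h3, dbar_polySum hH (by lia) hz, h4, solDeriv]

/-- Differentiating once more requires the formula on a whole neighbourhood. For k < N it holds on
the entire disk, so integrability of f(ζ)/(ζ - z) is needed only for the derivative of order N. -/
lemma iterate_dbar_solution {f h₀ : ℂ → ℂ} (hf : IntegrableOn f disk)
    (hf₀ : IntegrableOn (fun ζ => f ζ / ζ) disk) (hh₀ : h₀ ∈ Hb) {h : ℕ → CircleDistribution}
    {c : ℕ → ℝ} {N : ℕ} {w : ℂ → ℂ} (hw : ∀ z ∈ disk, w z = schwarzSolution (N + 1) f h₀ h c z)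
    {k : ℕ} (hk : k ≤ N) {z : ℂ} (hz : z ∈ disk)
    (hfz : k < N ∨ IntegrableOn (fun ζ => f ζ / (ζ - z)) disk) :
    dbar^[k] w z = solDeriv f h₀ h c N k z := by
  induction k generalizing z with
  | zero =>
    rw [Function.iterate_zero_apply, hw z hz, schwarzSolution_eq hh₀ h c hz,
      (integrableOn_areaIntegrand hf hf₀ hz hfz).2, solDeriv, Nat.sub_zero]
  | succ k ih =>
    rw [Function.iterate_succ_apply', dbar_eq_of_eqOn
      (fun z hz => ih (Nat.le_of_succ_le hk) hz (Or.inl hk)) hz,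
      (dbar_solDeriv hf hf₀ hh₀ h c hk hz hfz).2]

lemma isWeakDbar_solDeriv {f h₀ : ℂ → ℂ} (hf : IntegrableOn f disk)
    (hf₀ : IntegrableOn (fun ζ => f ζ / ζ) disk) (hh₀ : h₀ ∈ Hb) (h : ℕ → CircleDistribution)
    (c : ℕ → ℝ) {N k : ℕ} (hk : k < N) :
    IsWeakDbar 1 (solDeriv f h₀ h c N k) (solDeriv f h₀ h c N (k + 1)) := by
  have h1 : N - k = N - (k + 1) + 1 := by lia
  have hH := differentiableOn_solFam hh₀ h c
  have h2 := isWeakDbar_areaTerm_succ hf hf₀ (N - (k + 1))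
  rw [← h1] at h2
  exact (isWeakDbar_of_eqOn (contDiffOn_polySum hH (N + 1) k)
    fun z hz => dbar_polySum hH (by lia) hz).add h2

lemma isWeakDbar_solDeriv_last {f h₀ : ℂ → ℂ} (hf : IntegrableOn f disk)
    (hf₀ : IntegrableOn (fun ζ => f ζ / ζ) disk) (hh₀ : h₀ ∈ Hb) (h : ℕ → CircleDistribution)
    (c : ℕ → ℝ) (N : ℕ) : IsWeakDbar 1 (solDeriv f h₀ h c N N) f := by
  have hH := differentiableOn_solFam hh₀ h c
  have h1 := (isWeakDbar_of_eqOn (contDiffOn_polySum hH (N + 1) N)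
    fun z hz => dbar_polySum hH N.lt_succ_self hz).add (isWeakDbar_areaTerm_zero hf hf₀)
  rw [← Nat.sub_self N] at h1
  exact h1.congr EventuallyEq.rfl (Eventually.of_forall fun z => by simp [polySum])

lemma isWeakDbar_iterate_solDeriv {f h₀ : ℂ → ℂ} (hf : IntegrableOn f disk)
    (hf₀ : IntegrableOn (fun ζ => f ζ / ζ) disk) (hh₀ : h₀ ∈ Hb) (h : ℕ → CircleDistribution)
    (c : ℕ → ℝ) {N k : ℕ} (hk : k ≤ N) :
    IsWeakDbar k (solDeriv f h₀ h c N 0) (solDeriv f h₀ h c N k) := by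
  induction k with
  | zero =>
    refine IsWeakDbar.zero_refl ?_
    rcases N.eq_zero_or_pos with rfl | hN
    · exact (isWeakDbar_solDeriv_last hf hf₀ hh₀ h c 0).1
    · exact (isWeakDbar_solDeriv hf hf₀ hh₀ h c hN).1
  | succ k ih =>
    exact (ih (Nat.le_of_succ_le hk)).trans (isWeakDbar_solDeriv hf hf₀ hh₀ h c hk)

lemma continuousOn_solDeriv {f h₀ : ℂ → ℂ} (hf : IntegrableOn f disk)
    (hf₀ : IntegrableOn (fun ζ => f ζ / ζ) disk) (hh₀ : h₀ ∈ Hb) (h : ℕ → CircleDistribution)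
    (c : ℕ → ℝ) {N k : ℕ} (hk : k < N) : ContinuousOn (solDeriv f h₀ h c N k) disk := by
  have h1 : N - k = N - (k + 1) + 1 := by lia
  have h2 := continuousOn_areaTerm_succ hf hf₀ (N - (k + 1))
  rw [← h1] at h2
  exact (contDiffOn_polySum (differentiableOn_solFam hh₀ h c) (N + 1) k).continuousOn.add h2

lemma bv_solDeriv {f h₀ : ℂ → ℂ} (hf : IntegrableOn f disk)
    (hf₀ : IntegrableOn (fun ζ => f ζ / ζ) disk) (hh₀ : h₀ ∈ Hb) {h : ℕ → CircleDistribution}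
    (c : ℕ → ℝ) {N k : ℕ} (hl : ∀ l ≤ N, l ≠ 0 → rePart (h l) = h l) (hk : k ≤ N) :
    ∃ L, BV (regularRadii f) (solDeriv f h₀ h c N k) L ∧
      ∀ φ, rePart L φ = boundaryData h₀ h k φ := by
  obtain ⟨L, hL, hre⟩ := bv_polySum (R := Ioo 0 1) (Nat.lt_succ_of_le hk)
    (fun l hlN j hj => bv_solFam hh₀ h c (hl l (Nat.le_of_lt_succ hlN)) hj)
  obtain ⟨L', hL', hre'⟩ := bv_areaTerm hf hf₀ (N - k)
  refine ⟨_, (hL.mono fun r hr => hr.1).add hL', fun φ => ?_⟩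
  rw [rePart_add, hre, hre', add_zero]

/-- At 0 each `appell` sum reduces to its member of index l - k, and the constant i c_l sits at
index 0; hence only l = k contributes an imaginary part. -/
lemma im_solDeriv_zero {f h₀ : ℂ → ℂ} (hf₀ : IntegrableOn (fun ζ => f ζ / ζ) disk)
    {h : ℕ → CircleDistribution} (c : ℕ → ℝ) {N k : ℕ}
    (hl : ∀ l ≤ N, l ≠ 0 → rePart (h l) = h l) (hk : k ≤ N) :
    (solDeriv f h₀ h c N k 0).im = c k := by
  rw [solDeriv, add_im, im_areaTerm_zero hf₀, add_zero, polySum, im_sum, Finset.sum_eq_single k]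
  · simp [appell_at_zero, solFam, im_solHol_zero h (hl k hk)]
  · intro l hlm hne
    have h1 := Finset.mem_Ico.1 hlm
    have h2 : l - k ≠ 0 := by lia
    simp [appell_at_zero, solFam, im_solHol_zero h (hl l (by lia)), h2]
  · intro hk'
    exact absurd (Finset.mem_Ico.2 ⟨le_rfl, Nat.lt_succ_of_le hk⟩) hk'

end DiskSchwarz

end

/-! ### Solution of the Schwarz boundary value problem -/

theorem mainTheorem2 (n : ℕ) (hn : 1 ≤ n)
    (f : ℂ → ℂ) (hf : IntegrableOn f disk) (hf₀ : IntegrableOn (fun ζ => f ζ / ζ) disk)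
    (h₀ : ℂ → ℂ) (hh₀ : h₀ ∈ Hb)
    (p : ℕ → ℝ) (hp : ∀ k, 1 ≤ k → k ≤ n - 1 → 1 / 2 < p k ∧ p k ≤ 1)
    (h : ℕ → CircleDistribution) (hh : ∀ k, 1 ≤ k → k ≤ n - 1 → h k ∈ reHardyBoundary (p k))
    (c : ℕ → ℝ) (w : ℂ → ℂ) (hw : ∀ z ∈ disk, w z = schwarzSolution n f h₀ h c z) :
    -- the integral in the formula is defined
    ((∀ᵐ z ∂(volume.restrict disk), IntegrableOn (areaIntegrand n f z) disk) ∧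
      IntegrableOn (areaIntegrand n f 0) disk ∧
      (2 ≤ n → ∀ z ∈ disk, IntegrableOn (areaIntegrand n f z) disk)) ∧
    -- the differential equation
    IsWeakDbar n w f ∧
    -- the lower derivatives exist classically almost everywhere and at the origin,
    -- and they are also the derivatives in the sense of distributions
    (∀ k, k + 1 < n → (∀ᵐ z ∂(volume.restrict disk), DifferentiableAt ℝ (dbar^[k] w) z) ∧
      DifferentiableAt ℝ (dbar^[k] w) 0) ∧
    (∀ k, k ≤ n - 1 → IsWeakDbar k w (dbar^[k] w)) ∧
    -- the boundary conditions
    volume (Ioo (0 : ℝ) 1 \ regularRadii f) = 0 ∧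
    (∀ k, 1 ≤ k → k ≤ n - 1 → ∃ Λ : CircleDistribution,
      HasBoundaryValueAlong (regularRadii f) (dbar^[k] w) Λ ∧
      (k + 1 < n → HasBoundaryValue (dbar^[k] w) Λ) ∧
      rePart Λ = h k) ∧
    (∃ Λ : CircleDistribution,
      HasBoundaryValueAlong (regularRadii f) w Λ ∧
      (1 < n → HasBoundaryValue w Λ) ∧
      rePart Λ = rePart (boundaryValue h₀)) ∧
    -- the conditions at the origin
    (∀ k, k ≤ n - 1 → (dbar^[k] w 0).im = c k) := by
  obtain ⟨N, rfl⟩ := Nat.exists_eq_add_of_le' hn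
  simp only [Nat.add_sub_cancel] at hh hp ⊢
  -- Taking real parts is idempotent, so the data h l are real distributions.
  have hl : ∀ l ≤ N, l ≠ 0 → rePart (h l) = h l := by
    intro l hlN hl0
    obtain ⟨-, -, Λ, -, hΛ⟩ := hh l (Nat.one_le_iff_ne_zero.2 hl0) hlN
    rw [hΛ, rePart_rePart]
  have hae := ae_integrableOn_cauchy hf
  have hmem : ∀ᵐ z ∂(volume.restrict disk), z ∈ disk := ae_restrict_mem isOpen_disk.measurableSet
  -- Integrability of f(ζ)/ζ says exactly that the origin is one of the good points.
  have h0 : IntegrableOn (fun ζ => f ζ / (ζ - 0)) disk := by simpa only [sub_zero] using hf₀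
  have hit : ∀ k ≤ N, ∀ z ∈ disk, (k < N ∨ IntegrableOn (fun ζ => f ζ / (ζ - z)) disk) →
      dbar^[k] w z = solDeriv f h₀ h c N k z :=
    fun k hk z hz hfz => iterate_dbar_solution hf hf₀ hh₀ hw hk hz hfz
  have hit_ae : ∀ k ≤ N, solDeriv f h₀ h c N k =ᵐ[volume.restrict disk] dbar^[k] w := by
    intro k hk
    filter_upwards [hae, hmem] with z hfz hz using (hit k hk z hz (Or.inr hfz)).symm
  have hw_ae : solDeriv f h₀ h c N 0 =ᵐ[volume.restrict disk] w := hit_ae 0 N.zero_le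
  have hdiff : ∀ k < N, ∀ z ∈ disk, IntegrableOn (fun ζ => f ζ / (ζ - z)) disk →
      DifferentiableAt ℝ (dbar^[k] w) z := by
    intro k hk z hz hfz
    refine (dbar_solDeriv hf hf₀ hh₀ h c hk hz (Or.inr hfz)).1.congr_of_eventuallyEq ?_
    filter_upwards [isOpen_disk.mem_nhds hz] with y hy using hit k hk.le y hy (Or.inl hk)
  have hR := volume_sdiff_regularRadii hf
  have hbv : ∀ k ≤ N, ∃ Λ : CircleDistribution,
      HasBoundaryValueAlong (regularRadii f) (dbar^[k] w) Λ ∧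
      (k < N → HasBoundaryValue (dbar^[k] w) Λ) ∧ rePart Λ = boundaryData h₀ h k := by
    intro k hk
    obtain ⟨L, hL, hre⟩ := bv_solDeriv hf hf₀ hh₀ c hl hk
    refine ⟨toDist L hL.1, ?_, fun hkN => ?_, funext hre⟩
    · refine (hL.congr fun r hr => ?_).hasBoundaryValueAlong
      filter_upwards [(mem_regularRadii.1 hr).2.prod_right_ae] with θ hθ
      exact (hit k hk _ (circleMap_mem_disk hr.1 θ) (Or.inr hθ)).symm
    -- Below the top order the derivative is continuous on the disk, so the limit along regular
    -- radii is a limit along all radii.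
    · have h1 := hL.of_ae (continuousOn_solDeriv hf hf₀ hh₀ h c hkN) hR
      exact (h1.congr fun r hr => Eventually.of_forall fun θ =>
        (hit k hk _ (circleMap_mem_disk hr θ) (Or.inl hkN)).symm).hasBoundaryValueAlong
  refine ⟨⟨?_, (integrableOn_areaIntegrand hf hf₀ zero_mem_disk (Or.inr h0)).1, ?_⟩, ?_, ?_, ?_,
    hR, ?_, ?_, ?_⟩
  · filter_upwards [hae, hmem] with z hfz hz
    exact (integrableOn_areaIntegrand hf hf₀ hz (Or.inr hfz)).1
  · exact fun hN z hz => (integrableOn_areaIntegrand hf hf₀ hz (Or.inl (by lia))).1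
  · exact ((isWeakDbar_iterate_solDeriv hf hf₀ hh₀ h c le_rfl).trans
      (isWeakDbar_solDeriv_last hf hf₀ hh₀ h c N)).congr hw_ae EventuallyEq.rfl
  · intro k hk
    have hk' : k < N := by lia
    refine ⟨?_, hdiff k hk' 0 zero_mem_disk h0⟩
    filter_upwards [hae, hmem] with z hfz hz using hdiff k hk' z hz hfz
  · exact fun k hk => (isWeakDbar_iterate_solDeriv hf hf₀ hh₀ h c hk).congr hw_ae (hit_ae k hk)
  · intro k hk1 hk
    obtain ⟨Λ, h1, h2, h3⟩ := hbv k hk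
    refine ⟨Λ, h1, fun hkN => h2 (by lia), ?_⟩
    rw [h3, boundaryData, if_neg (by lia)]
  · obtain ⟨Λ, h1, h2, h3⟩ := hbv 0 N.zero_le
    refine ⟨Λ, h1, fun hN => h2 (by lia), ?_⟩
    rw [h3, boundaryData, if_pos rfl]
  · intro k hk
    rw [hit k hk 0 zero_mem_disk (Or.inr h0), im_solDeriv_zero hf₀ c hl hk]
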